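/- **Setting.** Let $\Omega=(0,1)$, $1<s<2$, $(v,w)=\int_\Omega vw\,dx$. For $\sigma\ge 0$ let $H^\sigma(I)$ be the Sobolev–Slobodeckij space on an open interval $I$, with $$\|u\|_{H^\sigma(I)}^2=\sum_{j\le\lfloor\sigma\rfloor}\|D^ju\|_{L^2(I)}^2+\iint_{I\times I}\frac{|D^{\lfloor\sigma\rfloor}u(x)-D^{\lfloor\sigma\rfloor}u(y)|^2}{|x-y|^{1+2(\sigma-\lfloor\sigma\rfloor)}}\,dx\,dy$$ (weak derivatives; the double integral is omitted for integral $\sigma$; the norm is $+\infty$ outside $H^\sigma(I)$). $\tilde H^{s/2}(\Omega)$ is the space of functions on $\Omega$ whose extension by zero $\tilde u$ is in $H^{s/2}(\mathbb R)$, with $\|u\|_{\tilde H^{s/2}(\Omega)}=\|\tilde u\|_{H^{s/2}(\mathbb R)}$. Let ${}_0D_x^{s/2}u=D\,{}_0I_x^{1-s/2}u$ and ${}_xD_1^{s/2}v=-D\,{}_xI_1^{1-s/2}v$ be the left and right Riemann–Liouville derivatives on $(0,1)$ (with ${}_0I_x^\alpha u(x)=\frac1{\Gamma(\alpha)}\int_0^x(x-y)^{\alpha-1}u(y)\,dy$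 and ${}_xI_1^\alpha v(x)=\frac1{\Gamma(\alpha)}\int_x^1(y-x)^{\alpha-1}v(y)\,dy$), and $$\mathcal A(u,v)=-({}_0D_x^{s/2}u,\;{}_xD_1^{s/2}v),\qquad \mathcal B(u,v)=(g(\cdot,u),v).$$ Let $c_0$ be the coercivity constant of $\mathcal A$, i.e. the best constant in $\mathcal A(v,v)\ge c_0\|v\|^2_{\tilde H^{s/2}(\Omega)}$ for all $v\in\tilde H^{s/2}(\Omega)$. Let $g:\Omega\times\mathbb R\to\mathbb R$ be measurable in $x$ with $g(x,0)=0$, $G(x,t)=\int_0^{|t|}g(x,\tau)\,d\tau$, and $U=\{\phi\in\tilde H^{s/2}(\Omega): G(\cdot,\phi)\in L^1(\Omega)\}$. For $N\ge 1$, $h=1/N$ and $r\ge1$ let $U_h$ be the space of continuous functions on $[0,1]$ that vanish at $0$ and $1$ and are polynomials of degree at most $r$ on each interval $[i/N,(i+1)/N]$. For a function $\phi$ put $\tilde\phi(x)=\phi(x)-\gamma_\phi(1-x)^{s-1}$ with $\gamma_\phi=(x^{1-s},\phi)/(x^{1-s},(1-x)^{s-1})$. The test spaces are $V=U$, $V_h=U_h$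 in the Riemann–Liouville case and $V=\{\tilde\phi:\phi\in U\}$, $V_h=\{\tilde\phi:\phi\in U_h\}$ in the Caputo case. For a linear functional $F$, a weak solution of $$-{}_0D_x^su+g(x,u)=f,\quad u(0)=u(1)=0$$ (with $F(v)=\langle f,v\rangle$ and the Riemann–Liouville or Caputo derivative ${}_0D^s_x$) is a $u\in U$ with $\mathcal A(u,v)+\mathcal B(u,v)=F(v)$ for all $v\in V$; a finite element solution is a $u_h\in U_h$ with $\mathcal A(u_h,v_h)+\mathcal B(u_h,v_h)=F(v_h)$ for all $v_h\in V_h$. **Theorem.** Let $l_M<c_0$, and let $\gamma=s$ in the Caputo case and $\gamma\in[\frac s2,s-\frac12]$ in the Riemann–Liouville case. Then there is a constant $C>0$, depending only on $s$, $r$, $l_M$, $\gamma$ and the type of derivative, such that the following holds. Let $M>0$ and let $g$ satisfy the local Lipschitz condition $$|g(x,t_1)-g(x,t_2)|\le l_M|t_1-t_2|\qquad\text{for a.e. }x\in\Omega\text{ and all }|t_1|,|t_2|\le M.$$ If $u$ is a weak solution and $u_h$ a finite element solution for the same $F$, and $|u|\le M$, $|u_h|\le M$ on $\Omega$, then $$\|u-u_h\|_{H^{s/2}(\Omega)}\le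 C\,h^{\gamma-\frac s2}\,\|u\|_{H^\gamma(\Omega)}$$ (where the right-hand side is $+\infty$ if $u\notin H^\gamma(\Omega)$). -/

import Mathlib

open MeasureTheory
open scoped ENNReal

noncomputable section

namespace FracBVP

/-- The interval `(0,1)`; its end points carry no Lebesgue measure. -/
abbrev Ω : Set ℝ := Set.Ioo 0 1

/-! ### Weak derivatives and fractional Sobolev (Sobolev-Slobodeckij) norms -/

/-- `w` is the weak derivative of order `k` of `u` on the open set `I`. -/
def IsWeakDeriv (I : Set ℝ) (k : ℕ) (u w : ℝ → ℝ) : Prop :=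
  LocallyIntegrableOn u I ∧ LocallyIntegrableOn w I ∧
    ∀ φ : ℝ → ℝ, ContDiff ℝ ((⊤ : ℕ∞) : WithTop ℕ∞) φ → HasCompactSupport φ → tsupport φ ⊆ I →
      ∫ x in I, u x * iteratedDeriv k φ x = (-1) ^ k * ∫ x in I, w x * φ x

open Classical in
/-- The weak derivative of order `k` on `I` (unique up to null sets; `0` if there is none). -/
def weakDeriv (I : Set ℝ) (k : ℕ) (u : ℝ → ℝ) : ℝ → ℝ :=
  if h : ∃ w, IsWeakDeriv I k u w then h.choose else 0

/-- The square of the Slobodeckij semi-norm of order `lam ∈ (0,1)` on `I`. -/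
def slobodeckijSq (I : Set ℝ) (lam : ℝ) (w : ℝ → ℝ) : ℝ≥0∞ :=
  ∫⁻ x in I, ∫⁻ y in I, ENNReal.ofReal ((w x - w y) ^ 2 / |x - y| ^ (1 + 2 * lam))

open Classical in
/-- The norm of `H^σ(I)`, `σ ≥ 0`, with value `∞` for functions outside `H^σ(I)`:
all weak derivatives up to order `⌊σ⌋` in `L²`, plus, for non-integral `σ`,
the Slobodeckij semi-norm of order `σ - ⌊σ⌋` of the highest one. -/
def sobolevNorm (I : Set ℝ) (σ : ℝ) (u : ℝ → ℝ) : ℝ≥0∞ :=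
  if ∀ j ≤ ⌊σ⌋₊, ∃ w, IsWeakDeriv I j u w then
    (∑ j ∈ Finset.range (⌊σ⌋₊ + 1), eLpNorm (weakDeriv I j u) 2 (volume.restrict I) ^ 2 +
      if σ = ⌊σ⌋₊ then 0 else slobodeckijSq I (σ - ⌊σ⌋₊) (weakDeriv I ⌊σ⌋₊ u)) ^ (1 / 2 : ℝ)
  else ⊤

/-- The norm of `H̃^σ(Ω)`: the `H^σ(ℝ)` norm of the extension by zero. -/
def tildeNorm (σ : ℝ) (u : ℝ → ℝ) : ℝ≥0∞ :=
  sobolevNorm Set.univ σ (Ω.indicator u)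

/-- Membership in `H̃^σ(Ω)`: the extension by zero belongs to `H^σ(ℝ)`. -/
def MemTilde (σ : ℝ) (u : ℝ → ℝ) : Prop := tildeNorm σ u < ⊤

/-! ### Riemann-Liouville integrals and derivatives on `(0,1)` -/

/-- Left fractional integral of order `α > 0`. -/
def fracIntLeft (α : ℝ) (u : ℝ → ℝ) (x : ℝ) : ℝ :=
  1 / Real.Gamma α * ∫ y in (0 : ℝ)..x, (x - y) ^ (α - 1) * u y

/-- Right fractional integral of order `α > 0`. -/
def fracIntRight (α : ℝ) (u : ℝ → ℝ) (x : ℝ) : ℝ :=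
  1 / Real.Gamma α * ∫ y in x..(1 : ℝ), (y - x) ^ (α - 1) * u y

/-- Left Riemann-Liouville derivative of non-integral order `β`, `n - 1 < β < n`:
`D^n I^{n-β} u`, the derivative being taken in the weak sense. -/
def rlDerivLeft (β : ℝ) (u : ℝ → ℝ) : ℝ → ℝ :=
  weakDeriv Ω (⌊β⌋₊ + 1) (fracIntLeft (⌊β⌋₊ + 1 - β) u)

/-- Right Riemann-Liouville derivative of non-integral order `β`, `n - 1 < β < n`:
`(-1)^n D^n I^{n-β} u`, the derivative being taken in the weak sense. -/
def rlDerivRight (β : ℝ) (u : ℝ → ℝ) (x : ℝ) : ℝ :=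
  (-1) ^ (⌊β⌋₊ + 1) * weakDeriv Ω (⌊β⌋₊ + 1) (fracIntRight (⌊β⌋₊ + 1 - β) u) x

/-! ### The variational problem -/

/-- `𝒜(u,v) = -(₀D^{s/2} u, D₁^{s/2} v)`. -/
def formA (s : ℝ) (u v : ℝ → ℝ) : ℝ :=
  -∫ x in Ω, rlDerivLeft (s / 2) u x * rlDerivRight (s / 2) v x

/-- `ℬ(u,v) = (g(·,u), v)`. -/
def formB (g : ℝ → ℝ → ℝ) (u v : ℝ → ℝ) : ℝ :=
  ∫ x in Ω, g x (u x) * v x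

/-- The coercivity constant `c₀` of `𝒜`: the best constant in
`𝒜(v,v) ≥ c ‖v‖²` for `v` in `H̃^{s/2}(Ω)`. -/
def coercivityConst (s : ℝ) : ℝ :=
  sSup {c : ℝ | ∀ v : ℝ → ℝ, MemTilde (s / 2) v → c * (tildeNorm (s / 2) v).toReal ^ 2 ≤ formA s v v}

/-- `G(x,t) = ∫₀^{|t|} g(x,τ) dτ`. -/
def primG (g : ℝ → ℝ → ℝ) (x t : ℝ) : ℝ := ∫ τ in (0 : ℝ)..|t|, g x τ

/-- The space `U` of those `φ` in `H̃^{s/2}(Ω)` with `G(·,φ)` in `L¹(Ω)`. -/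
def spaceU (s : ℝ) (g : ℝ → ℝ → ℝ) : Set (ℝ → ℝ) :=
  {φ | MemTilde (s / 2) φ ∧ IntegrableOn (fun x => primG g x (φ x)) Ω}

/-- `φ̃ = φ - γ_φ (1-x)^{s-1}` with `γ_φ = (x^{1-s}, φ) / (x^{1-s}, (1-x)^{s-1})`,
so that `(x^{1-s}, φ̃) = 0`. -/
def caputoTest (s : ℝ) (φ : ℝ → ℝ) (x : ℝ) : ℝ :=
  φ x - (∫ y in Ω, y ^ (1 - s) * φ y) / (∫ y in Ω, y ^ (1 - s) * (1 - y) ^ (s - 1)) *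
    (1 - x) ^ (s - 1)

/-- The two kinds of fractional derivative in the boundary value problem. -/
inductive Kind
  | riemannLiouville
  | caputo

/-- The test functions made from a space `X` of trial functions: `X` itself in the
Riemann-Liouville case, `{φ̃ | φ ∈ X}` (the span of the `φ̃`, as `φ ↦ φ̃` is linear)
in the Caputo case. -/
def testSpace (s : ℝ) : Kind → Set (ℝ → ℝ) → Set (ℝ → ℝ)
  | Kind.riemannLiouville, X => X
  | Kind.caputo, X => caputoTest s '' X

/-- `u ∈ U` is a weak solution: `𝒜(u,v) + ℬ(u,v) = F(v)` for all test functions `v`. -/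
def IsWeakSolution (κ : Kind) (s : ℝ) (g : ℝ → ℝ → ℝ) (F : (ℝ → ℝ) →ₗ[ℝ] ℝ) (u : ℝ → ℝ) : Prop :=
  u ∈ spaceU s g ∧ ∀ v ∈ testSpace s κ (spaceU s g), formA s u v + formB g u v = F v

/-! ### The finite element method -/

/-- The space `A_h`, `h = 1/N`: functions continuous on `[0,1]`, polynomial of degree at most `r`
on each interval `[i/N, (i+1)/N]`, vanishing at `0` and `1`. -/
def feSpace (r N : ℕ) : Set (ℝ → ℝ) :=
  {v | ContinuousOn v (Set.Icc 0 1) ∧ v 0 = 0 ∧ v 1 = 0 ∧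
    ∀ i < N, ∃ p : Polynomial ℝ, p.natDegree ≤ r ∧
      ∀ x ∈ Set.Icc ((i : ℝ) / N) (((i : ℝ) + 1) / N), v x = p.eval x}

/-- `u_h ∈ A_h` is a finite element solution on the uniform mesh with `N` cells. -/
def IsFESolution (κ : Kind) (s : ℝ) (r N : ℕ) (g : ℝ → ℝ → ℝ) (F : (ℝ → ℝ) →ₗ[ℝ] ℝ)
    (uh : ℝ → ℝ) : Prop :=
  uh ∈ feSpace r N ∧ ∀ v ∈ testSpace s κ (feSpace r N), formA s uh v + formB g uh v = F v

/-! ### The nonlinearity -/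

/-- `g(·,t)` is measurable, `g(x,0) = 0`, and `g(x,·)` is Lipschitz on `[-M,M]` with constant `l`. -/
structure IsLocLipschitz (g : ℝ → ℝ → ℝ) (M l : ℝ) : Prop where
  meas : ∀ t : ℝ, AEMeasurable (fun x => g x t) (volume.restrict Ω)
  zero : ∀ᵐ x ∂volume.restrict Ω, g x 0 = 0
  lip : ∀ᵐ x ∂volume.restrict Ω, ∀ t₁ t₂ : ℝ, |t₁| ≤ M → |t₂| ≤ M →
    |g x t₁ - g x t₂| ≤ l * |t₁ - t₂|

end FracBVP

end

open MeasureTheory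
open scoped ENNReal

noncomputable section

namespace FracBVP

/-! ### Elementary properties of the Slobodeckij energy -/

/-! The proof is a Céa argument in the norm ‖·‖ of H^{s/2}(ℝ). Let e = u - u_h, let v_h be the
piecewise linear nodal interpolant of u, let w = u - v_h, and let T be the map from trial to test
functions (the identity, or φ ↦ φ̃). Testing both equations with T(e - w) gives A(e, T(e - w)) +
(g(·,u) - g(·,u_h), T(e - w)) = 0.

The correction in T is invisible to A. In the Caputo case Tφ - φ is a multiple of (1-x)^{s-1}, whose
right derivative of order s/2 is a multiple of (1-x)^{s/2-1}. The left derivative of any f in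
H̃^{s/2}(Ω) is orthogonal to that function, because the pairing equals f(1) = 0 up to a factor
(`formA_caputoTest`). Hence A(e,e) = A(e,w) - (g(·,u) - g(·,u_h), T(e - w)) ≤ C_A ‖e‖ ‖w‖ + l ∫ |e|
(|Te| + |Tw|).

The decisive estimate is ∫ |e| |Tw| ≤ ‖e‖ ‖w‖ with constant exactly 1
(`integral_abs_mul_testMap_le`). Coercivity with some c > l then absorbs l ‖e‖², and (c - l) ‖e‖ ≤
(C_A + l) ‖w‖. In the Caputo case the L² norms pay for ∫ |e w|, while the Slobodeckij semi-norms pay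
for the correction through a Hardy inequality with the explicit constant s/2
(`IsEnergyFun.hardy_le`).

Boundedness of A rests on the Fourier transform: the energy dominates ∫ |ξ|^s |𝓕f|², the truncated
kernel z^{-β} has a transform of size |ξ|^{β-1}, and duality yields a fractional derivative in L²
(`exists_isWeakDeriv_fracIntLeft`).

The bound on ‖w‖ (`exists_nodalInterp_error_le`) is local. Since w vanishes at the nodes, the
interaction of a cell with its exterior is a Hardy integral, which the energy inside the cell
controls; the interpolation error is then estimated on each cell by scaling. The same Hardy
inequality shows that functions of finite energy have continuous representatives, which are used
throughout.

Finite element functions need not belong to U, since g is controlled only on [-M,M]; a small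
multiple of each does, and linearity in the test function suffices
(`IsWeakSolution.eq_of_mem_feSpace`). -/

theorem measurable_slobodeckij_kernel {w : ℝ → ℝ} (hw : Measurable w) (e : ℝ) :
    Measurable fun p : ℝ × ℝ => ENNReal.ofReal ((w p.1 - w p.2) ^ 2 / |p.1 - p.2| ^ e) := by
  have h1 : Measurable fun p : ℝ × ℝ => |p.1 - p.2| :=
    (measurable_fst.sub measurable_snd).abs
  exact (((hw.comp measurable_fst).sub (hw.comp measurable_snd)).pow_const 2 |>.div
    (h1.pow_const e)).ennreal_ofReal

theorem measurable_slobodeckij_kernel_right {w : ℝ → ℝ} (hw : Measurable w) (e x : ℝ) :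
    Measurable fun y : ℝ => ENNReal.ofReal ((w x - w y) ^ 2 / |x - y| ^ e) := by
  have h1 : Measurable fun y : ℝ => |x - y| := (measurable_const.sub measurable_id).abs
  exact (((measurable_const.sub hw).pow_const 2).div (h1.pow_const e)).ennreal_ofReal

theorem slobodeckijSq_congr_ae {I : Set ℝ} {lam : ℝ} {w w' : ℝ → ℝ}
    (h : w =ᵐ[volume.restrict I] w') : slobodeckijSq I lam w = slobodeckijSq I lam w' := by
  unfold slobodeckijSq
  refine lintegral_congr_ae ?_
  filter_upwards [h] with x hx
  refine lintegral_congr_ae ?_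
  filter_upwards [h] with y hy
  rw [hx, hy]

theorem slobodeckijSq_congr {I : Set ℝ} (hI : MeasurableSet I) {lam : ℝ} {w w' : ℝ → ℝ}
    (h : ∀ x ∈ I, w x = w' x) : slobodeckijSq I lam w = slobodeckijSq I lam w' :=
  slobodeckijSq_congr_ae ((ae_restrict_iff' hI).2 (Filter.Eventually.of_forall h))

theorem slobodeckijSq_mono {I J : Set ℝ} (h : I ⊆ J) (lam : ℝ) (w : ℝ → ℝ) :
    slobodeckijSq I lam w ≤ slobodeckijSq J lam w :=
  (lintegral_mono fun _ => lintegral_mono_set h).trans (lintegral_mono_set h)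

theorem slobodeckijSq_sub_const (I : Set ℝ) (lam : ℝ) (w : ℝ → ℝ) (c : ℝ) :
    slobodeckijSq I lam (fun x => w x - c) = slobodeckijSq I lam w := by
  simp [slobodeckijSq]

theorem slobodeckijSq_const_mul (I : Set ℝ) (lam : ℝ) (w : ℝ → ℝ) (c : ℝ) :
    slobodeckijSq I lam (fun x => c * w x) = ENNReal.ofReal (c ^ 2) * slobodeckijSq I lam w := by
  unfold slobodeckijSq
  rw [← lintegral_const_mul' _ _ ENNReal.ofReal_ne_top]
  refine lintegral_congr fun x => ?_
  rw [← lintegral_const_mul' _ _ ENNReal.ofReal_ne_top]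
  refine lintegral_congr fun y => ?_
  rw [← ENNReal.ofReal_mul (sq_nonneg c)]
  congr 1
  ring

theorem lintegral_le_two_mul_add {α : Type*} [MeasurableSpace α] {μ : Measure α}
    {f g h : α → ℝ≥0∞} (hg : Measurable g) (hle : ∀ x, f x ≤ 2 * g x + 2 * h x) :
    ∫⁻ x, f x ∂μ ≤ 2 * ∫⁻ x, g x ∂μ + 2 * ∫⁻ x, h x ∂μ := by
  refine (lintegral_mono hle).trans_eq ?_
  rw [lintegral_add_left (hg.const_mul 2), lintegral_const_mul' 2 g ENNReal.ofNat_ne_top,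
    lintegral_const_mul' 2 h ENNReal.ofNat_ne_top]

theorem ofReal_sq_div_le_two_mul_add {a b p : ℝ} (hp : 0 ≤ p) :
    ENNReal.ofReal ((a + b) ^ 2 / p) ≤
      2 * ENNReal.ofReal (a ^ 2 / p) + 2 * ENNReal.ofReal (b ^ 2 / p) := by
  have h2 : (2 : ℝ≥0∞) = ENNReal.ofReal 2 := by simp
  rw [h2, ← ENNReal.ofReal_mul zero_le_two, ← ENNReal.ofReal_mul zero_le_two,
    ← ENNReal.ofReal_add (by positivity) (by positivity)]
  refine ENNReal.ofReal_le_ofReal ?_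
  rw [mul_div_assoc', mul_div_assoc', ← add_div]
  refine div_le_div_of_nonneg_right ?_ hp
  nlinarith [sq_nonneg (a - b)]

theorem slobodeckijSq_add_le (I : Set ℝ) (lam : ℝ) {v w : ℝ → ℝ} (hv : Measurable v) :
    slobodeckijSq I lam (fun x => v x + w x) ≤
      2 * slobodeckijSq I lam v + 2 * slobodeckijSq I lam w := by
  have hk := measurable_slobodeckij_kernel hv (1 + 2 * lam)
  unfold slobodeckijSq
  refine lintegral_le_two_mul_add (Measurable.lintegral_prod_right' (ν := volume.restrict I) hk)
    fun x => ?_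
  refine lintegral_le_two_mul_add (measurable_slobodeckij_kernel_right hv _ x) fun y => ?_
  rw [add_sub_add_comm]
  exact ofReal_sq_div_le_two_mul_add (Real.rpow_nonneg (abs_nonneg _) _)

theorem slobodeckijSq_comp_isometry {e : ℝ → ℝ} (he : MeasurePreserving e)
    (hem : MeasurableEmbedding e) (hi : Isometry e) (I : Set ℝ) (lam : ℝ) (w : ℝ → ℝ) :
    slobodeckijSq (e ⁻¹' I) lam (fun x => w (e x)) = slobodeckijSq I lam w := by
  unfold slobodeckijSq
  rw [← he.setLIntegral_comp_preimage_emb hem _ I]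
  refine lintegral_congr fun x => ?_
  rw [← he.setLIntegral_comp_preimage_emb hem _ I]
  refine lintegral_congr fun y => ?_
  have := hi.dist_eq x y
  rw [Real.dist_eq, Real.dist_eq] at this
  rw [this]

theorem slobodeckijSq_comp_add_left (I : Set ℝ) (lam a : ℝ) (w : ℝ → ℝ) :
    slobodeckijSq ((fun x => a + x) ⁻¹' I) lam (fun x => w (a + x)) = slobodeckijSq I lam w :=
  slobodeckijSq_comp_isometry (measurePreserving_add_left volume a)
    (measurableEmbedding_addLeft a) (IsometryEquiv.addLeft a).isometry I lam w

theorem slobodeckijSq_comp_sub_left (I : Set ℝ) (lam a : ℝ) (w : ℝ → ℝ) :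
    slobodeckijSq ((fun x => a - x) ⁻¹' I) lam (fun x => w (a - x)) = slobodeckijSq I lam w :=
  slobodeckijSq_comp_isometry (Measure.measurePreserving_sub_left volume a)
    (measurableEmbedding_subLeft a) (IsometryEquiv.subLeft a).isometry I lam w

/-! ### Weak derivatives -/

/-- The fundamental lemma of the calculus of variations. It makes the arbitrary choice in
`weakDeriv` harmless up to null sets. -/
theorem IsWeakDeriv.ae_eq {I : Set ℝ} (hI : IsOpen I) {k : ℕ} {u w w' : ℝ → ℝ}
    (h : IsWeakDeriv I k u w) (h' : IsWeakDeriv I k u w') : w =ᵐ[volume.restrict I] w' := by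
  have hloc : LocallyIntegrableOn (fun x => w x - w' x) I := h.2.1.sub h'.2.1
  have := hI.ae_eq_zero_of_integral_contDiff_smul_eq_zero hloc ?_
  · refine (ae_restrict_iff' hI.measurableSet).2 ?_
    filter_upwards [this] with x hx hxI
    linarith [hx hxI]
  intro φ hφ hc hs
  have e1 := h.2.2 φ hφ hc hs
  have e2 := h'.2.2 φ hφ hc hs
  have key : ∀ v : ℝ → ℝ, LocallyIntegrableOn v I → IntegrableOn (fun x => v x * φ x) I := by
    intro v hv
    have h1 : IntegrableOn v (tsupport φ) := hv.integrableOn_compact_subset hs hc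
    have h2 : IntegrableOn (fun x => v x * φ x) (tsupport φ) :=
      h1.mul_continuousOn hφ.continuous.continuousOn hc
    have h3 : Integrable (fun x => v x * φ x) := by
      refine (integrableOn_iff_integrable_of_support_subset ?_).1 h2
      intro x hx
      refine subset_tsupport φ ?_
      intro h0
      simp [h0] at hx
    exact h3.integrableOn
  have e3 : ∫ x in I, (w x - w' x) * φ x = 0 := by
    have : ∀ x, (w x - w' x) * φ x = w x * φ x - w' x * φ x := fun x => by ring
    simp_rw [this]
    rw [integral_sub (key w h.2.1) (key w' h'.2.1)]
    have := e1.symm.trans e2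
    have h1 : ((-1 : ℝ)) ^ k ≠ 0 := by positivity
    rw [mul_right_injective₀ h1 this, sub_self]
  rw [← e3, ← setIntegral_eq_integral_of_forall_compl_eq_zero (s := I)]
  · refine integral_congr_ae (Filter.Eventually.of_forall fun x => ?_)
    simp [mul_comm]
  · intro x hx
    have : φ x = 0 := by
      by_contra h0
      exact hx (hs (subset_tsupport φ h0))
    simp [this]

theorem isWeakDeriv_weakDeriv {I : Set ℝ} {k : ℕ} {u w : ℝ → ℝ} (h : IsWeakDeriv I k u w) :
    IsWeakDeriv I k u (weakDeriv I k u) := by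
  have h' : ∃ w, IsWeakDeriv I k u w := ⟨w, h⟩
  rw [weakDeriv, dif_pos h']
  exact h'.choose_spec

theorem IsWeakDeriv.weakDeriv_ae_eq {I : Set ℝ} (hI : IsOpen I) {k : ℕ} {u w : ℝ → ℝ}
    (h : IsWeakDeriv I k u w) : weakDeriv I k u =ᵐ[volume.restrict I] w :=
  (isWeakDeriv_weakDeriv h).ae_eq hI h

theorem LocallyIntegrableOn.isWeakDeriv_zero {I : Set ℝ} {u : ℝ → ℝ}
    (h : LocallyIntegrableOn u I) : IsWeakDeriv I 0 u u :=
  ⟨h, h, fun φ _ _ _ => by simp⟩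

theorem LocallyIntegrableOn.congr_ae {I : Set ℝ} {u v : ℝ → ℝ}
    (h : LocallyIntegrableOn u I) (huv : u =ᵐ[volume.restrict I] v) :
    LocallyIntegrableOn v I := by
  intro x hx
  obtain ⟨t, ht, hi⟩ := h x hx
  refine ⟨t ∩ I, Filter.inter_mem ht self_mem_nhdsWithin, ?_⟩
  exact (hi.mono_set Set.inter_subset_left).congr_fun_ae
    (ae_restrict_of_ae_restrict_of_subset Set.inter_subset_right huv)

theorem IsWeakDeriv.congr_ae {I : Set ℝ} {k : ℕ} {u u' w w' : ℝ → ℝ}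
    (h : IsWeakDeriv I k u w) (hu : u =ᵐ[volume.restrict I] u')
    (hw : w =ᵐ[volume.restrict I] w') : IsWeakDeriv I k u' w' := by
  refine ⟨LocallyIntegrableOn.congr_ae h.1 hu, LocallyIntegrableOn.congr_ae h.2.1 hw,
    fun φ h1 h2 h3 => ?_⟩
  rw [integral_congr_ae (g := fun x => u x * iteratedDeriv k φ x),
    integral_congr_ae (g := fun x => w x * φ x) (f := fun x => w' x * φ x), h.2.2 φ h1 h2 h3]
  · filter_upwards [hw] with x hx
    rw [hx]
  · filter_upwards [hu] with x hx
    rw [hx]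

/-! ### The Sobolev norm of order between `0` and `1` -/

/-- Only the derivative of order 0 enters, but `weakDeriv I 0 u` is a chosen function that agrees
with `u` merely almost everywhere. -/
theorem sobolevNorm_eq_of_lt_one {I : Set ℝ} (hI : IsOpen I) {σ : ℝ} (h0 : 0 < σ) (h1 : σ < 1)
    {u : ℝ → ℝ} (hu : LocallyIntegrableOn u I) :
    sobolevNorm I σ u =
      (eLpNorm u 2 (volume.restrict I) ^ 2 + slobodeckijSq I σ u) ^ (1 / 2 : ℝ) := by
  have hf : ⌊σ⌋₊ = 0 := Nat.floor_eq_zero.2 h1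
  have hd := LocallyIntegrableOn.isWeakDeriv_zero hu
  have hae := hd.weakDeriv_ae_eq hI
  unfold sobolevNorm
  rw [hf, if_pos, if_neg]
  · simp only [zero_add, Finset.range_one, Finset.sum_singleton, Nat.cast_zero, sub_zero]
    rw [eLpNorm_congr_ae hae, slobodeckijSq_congr_ae hae]
  · simp [h0.ne']
  · intro j hj
    obtain rfl : j = 0 := by omega
    exact ⟨u, hd⟩

theorem locallyIntegrableOn_of_sobolevNorm_lt_top {I : Set ℝ} {σ : ℝ} {u : ℝ → ℝ}
    (hu : sobolevNorm I σ u < ⊤) : LocallyIntegrableOn u I := by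
  unfold sobolevNorm at hu
  split_ifs at hu with h
  · obtain ⟨w, hw⟩ := h 0 (Nat.zero_le _)
    exact hw.1
  · obtain ⟨w, hw⟩ := h 0 (Nat.zero_le _)
    exact hw.1
  · exact absurd hu (lt_irrefl _)

/-! ### The fractional Hardy inequality on an interval -/

theorem setLIntegral_comp_mul_left {t : ℝ} (ht : 0 < t) (F : ℝ → ℝ≥0∞) (S : Set ℝ) :
    ∫⁻ x in (fun x => t * x) ⁻¹' S, F (t * x) = ENNReal.ofReal t⁻¹ * ∫⁻ y in S, F y := by
  have he : MeasurableEmbedding (fun x : ℝ => t * x) :=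
    (Homeomorph.mulLeft₀ t ht.ne').measurableEmbedding
  rw [← he.lintegral_map, ← he.restrict_map, Real.map_volume_mul_left ht.ne',
    Measure.restrict_smul, lintegral_smul_measure, abs_of_pos (inv_pos.2 ht), smul_eq_mul]

theorem setLIntegral_Ioo_comp_mul_left {t : ℝ} (ht : 0 < t) (F : ℝ → ℝ≥0∞) (h : ℝ) :
    ∫⁻ x in Set.Ioo 0 h, F (t * x) = ENNReal.ofReal t⁻¹ * ∫⁻ y in Set.Ioo 0 (t * h), F y := by
  rw [← setLIntegral_comp_mul_left ht F]
  congr 2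
  ext x
  simp only [Set.mem_Ioo, Set.mem_preimage]
  exact ⟨fun hx => ⟨mul_pos ht hx.1, mul_lt_mul_of_pos_left hx.2 ht⟩,
    fun hx => ⟨pos_of_mul_pos_right hx.1 ht.le, lt_of_mul_lt_mul_left hx.2 ht.le⟩⟩

/-- The substitution y = tx produces the factor t^{s-1} ≤ (1/2)^{s-1}, which is smaller than 1
because s > 1. This contraction drives the Hardy inequality. -/
theorem setLIntegral_sq_dilate_le {s h t : ℝ} (hs : 1 < s) (ht : 0 < t)
    (ht2 : t ≤ 1 / 2) (hh : 0 < h) (w : ℝ → ℝ) :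
    ∫⁻ x in Set.Ioo 0 h, ENNReal.ofReal (w (t * x) ^ 2 * x ^ (-s)) ≤
      ENNReal.ofReal ((1 / 2) ^ (s - 1)) *
        ∫⁻ x in Set.Ioo 0 h, ENNReal.ofReal (w x ^ 2 * x ^ (-s)) := by
  have h1 : ∫⁻ x in Set.Ioo 0 h, ENNReal.ofReal (w (t * x) ^ 2 * x ^ (-s)) =
      ∫⁻ x in Set.Ioo 0 h, ENNReal.ofReal (t ^ s) *
        ENNReal.ofReal (w (t * x) ^ 2 * (t * x) ^ (-s)) := by
    refine setLIntegral_congr_fun measurableSet_Ioo fun x hx => ?_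
    rw [← ENNReal.ofReal_mul (Real.rpow_nonneg ht.le _), Real.mul_rpow ht.le hx.1.le,
      Real.rpow_neg ht.le s]
    congr 1
    have := (Real.rpow_pos_of_pos ht s).ne'
    field_simp
  rw [h1, lintegral_const_mul' _ _ ENNReal.ofReal_ne_top,
    setLIntegral_Ioo_comp_mul_left ht (fun y => ENNReal.ofReal (w y ^ 2 * y ^ (-s))) h, ← mul_assoc,
    ← ENNReal.ofReal_mul (Real.rpow_nonneg ht.le _)]
  refine mul_le_mul' (ENNReal.ofReal_le_ofReal ?_) (lintegral_mono_set ?_)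
  · rw [← div_eq_mul_inv, ← Real.rpow_sub_one ht.ne']
    exact Real.rpow_le_rpow ht.le ht2 (by linarith)
  · exact Set.Ioo_subset_Ioo_right (by nlinarith)

/-- With y = tx one has dt = dy/x, and 0 < x - y ≤ x bounds x^{-1-s} by the Slobodeckij kernel. -/
theorem lintegral_dilate_le_slobodeckij {s h x : ℝ} (hs : 1 < s) (hx : x ∈ Set.Ioo 0 h)
    (w : ℝ → ℝ) :
    ∫⁻ t in Set.Ioo (0 : ℝ) (1 / 2), ENNReal.ofReal ((w x - w (t * x)) ^ 2 * x ^ (-s)) ≤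
      ∫⁻ y in Set.Ioo 0 h, ENNReal.ofReal ((w x - w y) ^ 2 / |x - y| ^ (1 + s)) := by
  have h1 := setLIntegral_Ioo_comp_mul_left hx.1
    (fun y => ENNReal.ofReal ((w x - w y) ^ 2 * x ^ (-s))) (1 / 2)
  simp_rw [mul_comm x] at h1
  rw [h1, ← lintegral_const_mul' _ _ ENNReal.ofReal_ne_top]
  refine (setLIntegral_mono' measurableSet_Ioo fun y hy => ?_).trans
    (lintegral_mono_set (Set.Ioo_subset_Ioo_right (by linarith [hx.1, hx.2] : 1 / 2 * x ≤ h)))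
  rw [← ENNReal.ofReal_mul (inv_nonneg.2 hx.1.le)]
  refine ENNReal.ofReal_le_ofReal ?_
  have hxy : 0 < x - y := by linarith [hy.2, hx.1]
  rw [abs_of_pos hxy]
  have h2 : (x - y) ^ (1 + s) ≤ x ^ (1 + s) :=
    Real.rpow_le_rpow hxy.le (by linarith [hy.1]) (by linarith)
  have h3 : x⁻¹ * ((w x - w y) ^ 2 * x ^ (-s)) = (w x - w y) ^ 2 / x ^ (1 + s) := by
    rw [Real.rpow_add hx.1, Real.rpow_neg hx.1.le, Real.rpow_one]
    have := (Real.rpow_pos_of_pos hx.1 s).ne'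
    have := hx.1.ne'
    field_simp
  rw [h3]
  exact div_le_div_of_nonneg_left (sq_nonneg _) (Real.rpow_pos_of_pos hxy _) h2

/-- The Hardy inequality at the left end point, for functions with finite Hardy integral. -/
theorem exists_hardy_const {s : ℝ} (hs : 1 < s) :
    ∃ K : ℝ, 0 < K ∧ ∀ (h : ℝ) (w : ℝ → ℝ), 0 < h → Measurable w →
      ∫⁻ x in Set.Ioo 0 h, ENNReal.ofReal (w x ^ 2 * x ^ (-s)) < ⊤ →
      ∫⁻ x in Set.Ioo 0 h, ENNReal.ofReal (w x ^ 2 * x ^ (-s)) ≤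
        ENNReal.ofReal K * slobodeckijSq (Set.Ioo 0 h) (s / 2) w := by
  set ρ : ℝ := (1 / 2) ^ (s - 1) with hρ
  have hρ0 : 0 < ρ := Real.rpow_pos_of_pos (by norm_num) _
  have hρ1 : ρ < 1 := Real.rpow_lt_one (by norm_num) (by norm_num) (by linarith)
  -- Chosen so that (1 + δ)ρ is the midpoint q of ρ and 1, leaving room for absorption.
  set δ : ℝ := (1 - ρ) / (2 * ρ) with hδ
  have hδ0 : 0 < δ := div_pos (by linarith) (by linarith)
  set q : ℝ := (1 + ρ) / 2 with hq
  have hqδ : (1 + δ) * ρ = q := by rw [hδ, hq]; field_simp; ring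
  have hq1 : q < 1 := by rw [hq]; linarith
  have hq0 : 0 < q := by rw [hq]; linarith
  set A : ℝ := 1 + 1 / δ with hA
  have hA0 : 0 < A := by positivity
  refine ⟨2 * A / (1 - q), by have := sub_pos.2 hq1; positivity, fun h w hh hw hN => ?_⟩
  set N := ∫⁻ x in Set.Ioo 0 h, ENNReal.ofReal (w x ^ 2 * x ^ (-s)) with hNdef
  -- For fixed t, write w(x) = (w(x) - w(tx)) + w(tx) and apply Young's inequality with weight δ.
  -- The dilated part is at most qN and is subtracted from N, which requires N to be finite.
  have step : ∀ t ∈ Set.Ioo (0 : ℝ) (1 / 2), ENNReal.ofReal (1 - q) * N ≤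
      ENNReal.ofReal A *
        ∫⁻ x in Set.Ioo 0 h, ENNReal.ofReal ((w x - w (t * x)) ^ 2 * x ^ (-s)) := by
    intro t ht
    have h1 : N ≤ ∫⁻ x in Set.Ioo 0 h,
        (ENNReal.ofReal A * ENNReal.ofReal ((w x - w (t * x)) ^ 2 * x ^ (-s)) +
          ENNReal.ofReal (1 + δ) * ENNReal.ofReal (w (t * x) ^ 2 * x ^ (-s))) := by
      refine setLIntegral_mono' measurableSet_Ioo fun x hx => ?_
      have hp : 0 ≤ x ^ (-s) := Real.rpow_nonneg hx.1.le _
      rw [← ENNReal.ofReal_mul hA0.le, ← ENNReal.ofReal_mul (by linarith),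
        ← ENNReal.ofReal_add (by positivity) (by positivity)]
      refine ENNReal.ofReal_le_ofReal ?_
      rw [← mul_assoc, ← mul_assoc, ← add_mul]
      refine mul_le_mul_of_nonneg_right ?_ hp
      set a := w x - w (t * x) with ha
      set b := w (t * x) with hb
      have hx' : w x = a + b := by rw [ha]; ring
      rw [hx', hA]
      have h5 : (1 + 1 / δ) * a ^ 2 + (1 + δ) * b ^ 2 - (a + b) ^ 2 = (a - δ * b) ^ 2 / δ := by
        field_simp; ring
      have h6 : 0 ≤ (a - δ * b) ^ 2 / δ := by positivity
      linarith
    rw [lintegral_add_left (by fun_prop), lintegral_const_mul' _ _ ENNReal.ofReal_ne_top,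
      lintegral_const_mul' _ _ ENNReal.ofReal_ne_top] at h1
    have h2 : ENNReal.ofReal (1 + δ) *
        ∫⁻ x in Set.Ioo 0 h, ENNReal.ofReal (w (t * x) ^ 2 * x ^ (-s)) ≤ ENNReal.ofReal q * N := by
      rw [← hqδ, ENNReal.ofReal_mul (by linarith), mul_assoc]
      exact mul_le_mul_right (setLIntegral_sq_dilate_le hs ht.1 ht.2.le hh w) _
    have h3 : ENNReal.ofReal (1 - q) * N + ENNReal.ofReal q * N = N := by
      rw [← add_mul, ← ENNReal.ofReal_add (by linarith) hq0.le]
      simp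
    exact ENNReal.le_of_add_le_add_right (ENNReal.mul_ne_top ENNReal.ofReal_ne_top hN.ne)
      (h3.le.trans (h1.trans (add_le_add_right h2 _)))
  -- Integrating over t in (0,1/2) turns the differences w(x) - w(tx) into the Slobodeckij double
  -- integral.
  have h5 := setLIntegral_mono' (μ := volume) measurableSet_Ioo step
  rw [setLIntegral_const, Real.volume_Ioo, lintegral_const_mul' _ _ ENNReal.ofReal_ne_top,
    lintegral_lintegral_swap] at h5
  · have h6 := h5.trans (mul_le_mul_right (setLIntegral_mono' (μ := volume) measurableSet_Ioo
      fun x hx => lintegral_dilate_le_slobodeckij hs hx w) _)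
    have h7 : slobodeckijSq (Set.Ioo 0 h) (s / 2) w = ∫⁻ x in Set.Ioo 0 h,
        ∫⁻ y in Set.Ioo 0 h, ENNReal.ofReal ((w x - w y) ^ 2 / |x - y| ^ (1 + s)) := by
      unfold slobodeckijSq
      rw [show 2 * (s / 2) = s by ring]
    rw [← h7] at h6
    have h8 : N = ENNReal.ofReal (2 / (1 - q)) *
        (ENNReal.ofReal (1 - q) * N * ENNReal.ofReal (1 / 2 - 0)) := by
      rw [mul_comm (ENNReal.ofReal (1 - q)) N, mul_assoc N, mul_left_comm,
        ← ENNReal.ofReal_mul (by linarith), ← ENNReal.ofReal_mul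
          (div_nonneg zero_le_two (by linarith))]
      have : 2 / (1 - q) * ((1 - q) * (1 / 2 - 0)) = 1 := by
        have : 1 - q ≠ 0 := by linarith
        field_simp; norm_num
      rw [this]; simp
    rw [h8]
    refine (mul_le_mul_right h6 _).trans_eq ?_
    rw [← mul_assoc, ← ENNReal.ofReal_mul (div_nonneg zero_le_two (by linarith))]
    congr 2
    ring
  · exact (by fun_prop : Measurable (Function.uncurry fun t x : ℝ =>
      ENNReal.ofReal ((w x - w (t * x)) ^ 2 * x ^ (-s)))).aemeasurable

/-- The Hardy integral of `u - u a` at the left end point of `(a,b)`. -/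
def hardyLeft (s : ℝ) (u : ℝ → ℝ) (a b : ℝ) : ℝ≥0∞ :=
  ∫⁻ x in Set.Ioo a b, ENNReal.ofReal ((u x - u a) ^ 2 * (x - a) ^ (-s))

/-- The Hardy integral of `u - u b` at the right end point of `(a,b)`. -/
def hardyRight (s : ℝ) (u : ℝ → ℝ) (a b : ℝ) : ℝ≥0∞ :=
  ∫⁻ x in Set.Ioo a b, ENNReal.ofReal ((u x - u b) ^ 2 * (b - x) ^ (-s))

theorem preimage_add_sub_Ioo (a b : ℝ) :
    (fun x => a + b - x) ⁻¹' Set.Ioo a b = Set.Ioo a b := by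
  ext x
  simp only [Set.mem_preimage, Set.mem_Ioo]
  constructor <;> rintro ⟨h1, h2⟩ <;> constructor <;> linarith

theorem hardyRight_eq_hardyLeft (s : ℝ) (u : ℝ → ℝ) (a b : ℝ) :
    hardyRight s u a b = hardyLeft s (fun x => u (a + b - x)) a b := by
  unfold hardyRight hardyLeft
  rw [← (Measure.measurePreserving_sub_left volume (a + b)).setLIntegral_comp_preimage_emb
    (measurableEmbedding_subLeft (a + b)), preimage_add_sub_Ioo]
  refine lintegral_congr fun x => ?_
  beta_reduce
  rw [show b - (a + b - x) = x - a by ring, show a + b - a = b by ring]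

theorem slobodeckijSq_Ioo_reflect (a b lam : ℝ) (u : ℝ → ℝ) :
    slobodeckijSq (Set.Ioo a b) lam (fun x => u (a + b - x)) = slobodeckijSq (Set.Ioo a b) lam u := by
  have := slobodeckijSq_comp_sub_left (Set.Ioo a b) lam (a + b) u
  rwa [preimage_add_sub_Ioo] at this

/-- The Hardy inequality at `a` on `(a,b)` holds with constant `K`
whenever its left-hand side is finite. -/
def IsHardyConst (s K : ℝ) : Prop :=
  ∀ (u : ℝ → ℝ) (a b : ℝ), Measurable u → a < b → hardyLeft s u a b < ⊤ →
    hardyLeft s u a b ≤ ENNReal.ofReal K * slobodeckijSq (Set.Ioo a b) (s / 2) u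

theorem exists_isHardyConst {s : ℝ} (hs : 1 < s) : ∃ K, 0 < K ∧ IsHardyConst s K := by
  obtain ⟨K, hK, h⟩ := exists_hardy_const hs
  refine ⟨K, hK, fun u a b hu hab hfin => ?_⟩
  have hpre : (fun x => a + x) ⁻¹' Set.Ioo a b = Set.Ioo 0 (b - a) := by
    ext x
    simp only [Set.mem_preimage, Set.mem_Ioo]
    constructor <;> rintro ⟨h1, h2⟩ <;> constructor <;> linarith
  have e1 : hardyLeft s u a b =
      ∫⁻ x in Set.Ioo 0 (b - a), ENNReal.ofReal ((u (a + x) - u a) ^ 2 * x ^ (-s)) := by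
    unfold hardyLeft
    rw [← (measurePreserving_add_left volume a).setLIntegral_comp_preimage_emb
      (measurableEmbedding_addLeft a), hpre]
    refine lintegral_congr fun x => ?_
    rw [add_sub_cancel_left]
  have e2 : slobodeckijSq (Set.Ioo 0 (b - a)) (s / 2) (fun x => u (a + x) - u a) =
      slobodeckijSq (Set.Ioo a b) (s / 2) u := by
    rw [slobodeckijSq_sub_const, ← slobodeckijSq_comp_add_left (Set.Ioo a b) (s / 2) a u, hpre]
  rw [← e2]
  rw [e1] at hfin ⊢
  exact h (b - a) (fun x => u (a + x) - u a) (by linarith) (by fun_prop) hfin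

theorem IsHardyConst.right {s K : ℝ} (hK : IsHardyConst s K) {u : ℝ → ℝ} {a b : ℝ}
    (hu : Measurable u) (hab : a < b) (h : hardyRight s u a b < ⊤) :
    hardyRight s u a b ≤ ENNReal.ofReal K * slobodeckijSq (Set.Ioo a b) (s / 2) u := by
  rw [← slobodeckijSq_Ioo_reflect]
  rw [hardyRight_eq_hardyLeft] at h ⊢
  exact hK _ a b (by fun_prop) hab h

/-- The inner integral of the Slobodeckij energy of order `s/2`. -/
def slobodeckijAt (I : Set ℝ) (s : ℝ) (u : ℝ → ℝ) (x : ℝ) : ℝ≥0∞ :=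
  ∫⁻ y in I, ENNReal.ofReal ((u x - u y) ^ 2 / |x - y| ^ (1 + s))

theorem slobodeckijSq_half (I : Set ℝ) (s : ℝ) (u : ℝ → ℝ) :
    slobodeckijSq I (s / 2) u = ∫⁻ x in I, slobodeckijAt I s u x := by
  unfold slobodeckijSq slobodeckijAt
  rw [show 2 * (s / 2) = s by ring]

theorem ae_slobodeckijAt_lt_top {I : Set ℝ} {s : ℝ} {u : ℝ → ℝ} (hu : Measurable u)
    (h : slobodeckijSq I (s / 2) u < ⊤) :
    ∀ᵐ x ∂volume.restrict I, slobodeckijAt I s u x < ⊤ := by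
  rw [slobodeckijSq_half] at h
  exact ae_lt_top (Measurable.lintegral_prod_right' (ν := volume.restrict I)
    (measurable_slobodeckij_kernel hu (1 + s))) h.ne

theorem mul_rpow_neg_le_mul_div_rpow {s A t L : ℝ} (hA : 0 ≤ A) (ht : 0 < t) (htL : t ≤ L) :
    A * t ^ (-s) ≤ L * (A / t ^ (1 + s)) := by
  have h1 : t ^ (-s) = t * (1 / t ^ (1 + s)) := by
    rw [Real.rpow_add ht, Real.rpow_one, Real.rpow_neg ht.le]
    have := (Real.rpow_pos_of_pos ht s).ne'
    field_simp
  have h2 : 0 ≤ A * (1 / t ^ (1 + s)) :=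
    mul_nonneg hA (one_div_nonneg.2 (Real.rpow_nonneg ht.le _))
  calc A * t ^ (-s) = t * (A * (1 / t ^ (1 + s))) := by rw [h1]; ring
    _ ≤ L * (A * (1 / t ^ (1 + s))) := mul_le_mul_of_nonneg_right htL h2
    _ = L * (A / t ^ (1 + s)) := by ring

/-- On (a,b) the factor x - a ≤ b - a trades the weight (x-a)^{-s} for (x-a)^{-1-s}. So the
finiteness demanded by `IsHardyConst` holds at every point of finite energy density. -/
theorem hardyLeft_lt_top {I : Set ℝ} {s : ℝ} {u : ℝ → ℝ} {a b : ℝ} (hab : a < b)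
    (hI : Set.Ioo a b ⊆ I) (h : slobodeckijAt I s u a < ⊤) : hardyLeft s u a b < ⊤ := by
  refine lt_of_le_of_lt ?_ (ENNReal.mul_lt_top (ENNReal.ofReal_lt_top (r := b - a)) h)
  unfold hardyLeft slobodeckijAt
  rw [← lintegral_const_mul' _ _ ENNReal.ofReal_ne_top]
  refine (setLIntegral_mono' measurableSet_Ioo fun x hx => ?_).trans (lintegral_mono_set hI)
  rw [← ENNReal.ofReal_mul (by linarith), abs_sub_comm a x, abs_of_pos (by linarith [hx.1]),
    ← neg_sub (u a), neg_sq]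
  exact ENNReal.ofReal_le_ofReal (mul_rpow_neg_le_mul_div_rpow (sq_nonneg _)
    (by linarith [hx.1]) (by linarith [hx.2]))

theorem hardyRight_lt_top {I : Set ℝ} {s : ℝ} {u : ℝ → ℝ} {a b : ℝ} (hab : a < b)
    (hI : Set.Ioo a b ⊆ I) (h : slobodeckijAt I s u b < ⊤) : hardyRight s u a b < ⊤ := by
  refine lt_of_le_of_lt ?_ (ENNReal.mul_lt_top (ENNReal.ofReal_lt_top (r := b - a)) h)
  unfold hardyRight slobodeckijAt
  rw [← lintegral_const_mul' _ _ ENNReal.ofReal_ne_top]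
  refine (setLIntegral_mono' measurableSet_Ioo fun x hx => ?_).trans (lintegral_mono_set hI)
  rw [← ENNReal.ofReal_mul (by linarith), abs_of_pos (by linarith [hx.2]),
    ← neg_sub (u b), neg_sq]
  exact ENNReal.ofReal_le_ofReal (mul_rpow_neg_le_mul_div_rpow (sq_nonneg _)
    (by linarith [hx.2]) (by linarith [hx.1]))

/-- The two Hardy integrals control the increment between the end points. -/
theorem ofReal_sq_sub_le_hardy {s : ℝ} (hs : 1 < s) {u : ℝ → ℝ} (hu : Measurable u) {a b : ℝ}
    (hab : a < b) :
    ENNReal.ofReal ((u b - u a) ^ 2) ≤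
      ENNReal.ofReal (2 * (b - a) ^ (s - 1)) * (hardyLeft s u a b + hardyRight s u a b) := by
  have hh : 0 < b - a := by linarith
  have hm : ∀ c : ℝ, Measurable fun x => ENNReal.ofReal ((u x - u a) ^ 2 * (x - a) ^ c) := by
    intro c; fun_prop
  -- The increment is integrated as a constant over (a,b), where both Hardy weights are at least
  -- (b-a)^{-s}.
  have h1 : ENNReal.ofReal ((u b - u a) ^ 2) * ENNReal.ofReal (b - a) ≤
      ENNReal.ofReal (2 * (b - a) ^ s) * (hardyLeft s u a b + hardyRight s u a b) := by
    unfold hardyLeft hardyRight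
    rw [← lintegral_add_left (hm _), ← lintegral_const_mul' _ _ ENNReal.ofReal_ne_top,
      ← Real.volume_Ioo, ← setLIntegral_const]
    refine setLIntegral_mono' measurableSet_Ioo fun x hx => ?_
    have hxa : 0 < x - a := by linarith [hx.1]
    have hxb : 0 < b - x := by linarith [hx.2]
    have hpa := Real.rpow_pos_of_pos hxa (-s)
    have hpb := Real.rpow_pos_of_pos hxb (-s)
    rw [← ENNReal.ofReal_add (by positivity) (by positivity), ← ENNReal.ofReal_mul (by positivity)]
    refine ENNReal.ofReal_le_ofReal ?_
    have key : ∀ t, 0 < t → t ≤ b - a → 1 ≤ (b - a) ^ s * t ^ (-s) := by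
      intro t ht htb
      rw [Real.rpow_neg ht.le, ← div_eq_mul_inv, one_le_div (Real.rpow_pos_of_pos ht s)]
      exact Real.rpow_le_rpow ht.le htb (by linarith)
    have k1 := mul_le_mul_of_nonneg_left (key _ hxa (by linarith)) (sq_nonneg (u x - u a))
    have k2 := mul_le_mul_of_nonneg_left (key _ hxb (by linarith)) (sq_nonneg (u x - u b))
    nlinarith [sq_nonneg ((u x - u a) + (u x - u b))]
  have h2 : ENNReal.ofReal ((u b - u a) ^ 2) =
      ENNReal.ofReal ((u b - u a) ^ 2) * ENNReal.ofReal (b - a) * ENNReal.ofReal (b - a)⁻¹ := by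
    rw [mul_assoc, ← ENNReal.ofReal_mul hh.le, mul_inv_cancel₀ hh.ne']; simp
  rw [h2]
  refine (mul_le_mul_left h1 _).trans_eq ?_
  rw [mul_right_comm, ← ENNReal.ofReal_mul (by positivity), Real.rpow_sub_one hh.ne']
  congr 2
  ring

/-- Local Hölder estimate between two points of finite Slobodeckij density. -/
theorem IsHardyConst.ofReal_sq_sub_le {s K : ℝ} (hs : 1 < s) (hK0 : 0 < K) (hK : IsHardyConst s K)
    {u : ℝ → ℝ} (hu : Measurable u) {a b : ℝ} (hab : a < b)
    (hL : hardyLeft s u a b < ⊤) (hR : hardyRight s u a b < ⊤) :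
    ENNReal.ofReal ((u b - u a) ^ 2) ≤
      ENNReal.ofReal (4 * K * (b - a) ^ (s - 1)) * slobodeckijSq (Set.Ioo a b) (s / 2) u := by
  refine (ofReal_sq_sub_le_hardy hs hu hab).trans
    ((mul_le_mul_right (add_le_add (hK u a b hu hab hL) (hK.right hu hab hR)) _).trans_eq ?_)
  have hh : 0 < b - a := by linarith
  rw [← two_mul, ← mul_assoc, ← mul_assoc, show (2 : ℝ≥0∞) = ENNReal.ofReal 2 by simp,
    ← ENNReal.ofReal_mul (by positivity), ← ENNReal.ofReal_mul (by positivity)]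
  congr 2
  ring

/-- A function of finite Slobodeckij energy of order `s/2 > 1/2` has a continuous representative. -/
theorem exists_continuous_ae_eq {s : ℝ} (hs : 1 < s) {u : ℝ → ℝ} (hu : Measurable u)
    (hfin : slobodeckijSq Set.univ (s / 2) u < ⊤) : ∃ f : ℝ → ℝ, Continuous f ∧ f =ᵐ[volume] u := by
  obtain ⟨K, hK0, hK⟩ := exists_isHardyConst hs
  -- Points of finite density have full measure, hence are dense. On them `u` is Hölder continuous
  -- with exponent (s-1)/2 and a uniform constant, so its restriction extends continuously to the
  -- line.
  set S : Set ℝ := {x | slobodeckijAt Set.univ s u x < ⊤} with hS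
  have hae : ∀ᵐ x, x ∈ S := by
    have := ae_slobodeckijAt_lt_top hu hfin
    rwa [Measure.restrict_univ] at this
  have hdense : Dense S := Measure.dense_of_ae hae
  set E := (slobodeckijSq Set.univ (s / 2) u).toReal with hE
  have hlt : ∀ a ∈ S, ∀ b ∈ S, a < b → (u b - u a) ^ 2 ≤ 4 * K * (b - a) ^ (s - 1) * E := by
    intro a ha b hb hab
    have h1 := (hK.ofReal_sq_sub_le hs hK0 hu hab
      (hardyLeft_lt_top hab (Set.subset_univ _) ha)
      (hardyRight_lt_top hab (Set.subset_univ _) hb)).trans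
      (mul_le_mul_right (slobodeckijSq_mono (Set.subset_univ _) (s / 2) u) _)
    have hh : 0 < b - a := by linarith
    rw [← ENNReal.ofReal_toReal hfin.ne, ← ENNReal.ofReal_mul (by positivity)] at h1
    exact (ENNReal.ofReal_le_ofReal_iff (by positivity)).1 h1
  have hall : ∀ a ∈ S, ∀ b ∈ S, (u a - u b) ^ 2 ≤ 4 * K * |a - b| ^ (s - 1) * E := by
    intro a ha b hb
    rcases lt_trichotomy a b with h | h | h
    · rw [abs_sub_comm, abs_of_pos (by linarith), ← neg_sub, neg_sq]
      exact hlt a ha b hb h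
    · subst h
      rw [sub_self, zero_pow two_ne_zero]
      positivity
    · rw [abs_of_pos (by linarith)]
      exact hlt b hb a ha h
  have huc : UniformContinuous fun x : S => u x := by
    rw [Metric.uniformContinuous_iff]
    intro ε hε
    have hE0 : 0 ≤ E := ENNReal.toReal_nonneg
    have hD : 0 < 4 * K * E + 1 := by positivity
    -- This radius δ solves (4KE + 1) δ^{s-1} = ε²; the summand 1 covers E = 0.
    refine ⟨(ε ^ 2 / (4 * K * E + 1)) ^ (1 / (s - 1)), by positivity, ?_⟩
    rintro ⟨a, ha⟩ ⟨b, hb⟩ hab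
    rw [Subtype.dist_eq, Real.dist_eq] at hab
    rw [Real.dist_eq]
    have h1 : |a - b| ^ (s - 1) < ε ^ 2 / (4 * K * E + 1) := by
      have := Real.rpow_lt_rpow (abs_nonneg _) hab (by linarith : 0 < s - 1)
      rwa [← Real.rpow_mul (by positivity), one_div_mul_cancel (by linarith), Real.rpow_one] at this
    have h2 : (u a - u b) ^ 2 < ε ^ 2 := by
      refine (hall a ha b hb).trans_lt ?_
      rw [lt_div_iff₀ hD] at h1
      have h3 : 0 ≤ |a - b| ^ (s - 1) := by positivity
      have h4 : 0 ≤ 4 * K * E := by positivity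
      by_cases h5 : |a - b| ^ (s - 1) = 0
      · rw [h5]; simp; positivity
      · have : 0 < |a - b| ^ (s - 1) := lt_of_le_of_ne h3 (Ne.symm h5)
        nlinarith
    exact abs_lt_of_sq_lt_sq h2 hε.le
  refine ⟨hdense.extend fun x : S => u x, (hdense.uniformContinuous_extend huc).continuous, ?_⟩
  filter_upwards [hae] with x hx
  exact hdense.extend_of_ind huc ⟨x, hx⟩

/-- For continuous functions the Hardy inequality holds at every point. -/
theorem IsHardyConst.left_of_continuous {s K : ℝ} (hK0 : 0 < K) (hK : IsHardyConst s K)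
    {f : ℝ → ℝ} (hf : Continuous f) {a b : ℝ} (hab : a < b) :
    hardyLeft s f a b ≤ ENNReal.ofReal K * slobodeckijSq (Set.Ioo a b) (s / 2) f := by
  rcases eq_or_ne (slobodeckijSq (Set.Ioo a b) (s / 2) f) ⊤ with htop | htop
  · rw [htop, ENNReal.mul_top (by simpa using hK0)]
    exact le_top
  have hae := ae_slobodeckijAt_lt_top hf.measurable (lt_top_iff_ne_top.2 htop)
  rw [ae_restrict_iff' measurableSet_Ioo] at hae
  have hdense := Measure.dense_of_ae hae
  -- The density may be infinite at `a` itself. The point is approached from the right through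
  -- points of finite density, and Fatou's lemma passes to the limit.
  have hex : ∀ n : ℕ, ∃ a', a' ∈ Set.Ioo a (min b (a + 1 / (n + 1))) ∧
      slobodeckijAt (Set.Ioo a b) s f a' < ⊤ := by
    intro n
    have : a < min b (a + 1 / ((n : ℝ) + 1)) := by
      refine lt_min hab ?_
      have : 0 < 1 / ((n : ℝ) + 1) := by positivity
      linarith
    obtain ⟨c, hc, h1⟩ := hdense.exists_between this
    exact ⟨c, h1, hc ⟨h1.1, h1.2.trans_le (min_le_left _ _)⟩⟩
  choose α hα hαfin using hex
  have hαb : ∀ n, α n < b := fun n => (hα n).2.trans_le (min_le_left _ _)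
  have hlim : Filter.Tendsto α Filter.atTop (nhds a) := by
    have h2 : Filter.Tendsto (fun n : ℕ => a + 1 / ((n : ℝ) + 1)) Filter.atTop (nhds (a + 0)) :=
      tendsto_const_nhds.add tendsto_one_div_add_atTop_nhds_zero_nat
    rw [add_zero] at h2
    exact tendsto_of_tendsto_of_tendsto_of_le_of_le tendsto_const_nhds h2
      (fun n => (hα n).1.le) (fun n => ((hα n).2.trans_le (min_le_right _ _)).le)
  set F : ℕ → ℝ → ℝ≥0∞ := fun n => (Set.Ioo (α n) b).indicator
    (fun x => ENNReal.ofReal ((f x - f (α n)) ^ 2 * (x - α n) ^ (-s))) with hF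
  have hFm : ∀ n, Measurable (F n) := fun n =>
    Measurable.indicator (by have := hf.measurable; fun_prop) measurableSet_Ioo
  have hpt : ∀ x ∈ Set.Ioo a b, Filter.Tendsto (fun n => F n x) Filter.atTop
      (nhds (ENNReal.ofReal ((f x - f a) ^ 2 * (x - a) ^ (-s)))) := by
    intro x hx
    have h1 : ∀ᶠ n in Filter.atTop,
        ENNReal.ofReal ((f x - f (α n)) ^ 2 * (x - α n) ^ (-s)) = F n x := by
      filter_upwards [hlim.eventually (gt_mem_nhds hx.1)] with n hn
      rw [hF]
      simp only [Set.indicator_of_mem (show x ∈ Set.Ioo (α n) b from ⟨hn, hx.2⟩)]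
    refine Filter.Tendsto.congr' h1 (ENNReal.tendsto_ofReal ?_)
    refine (((hf.tendsto a).comp hlim).const_sub (f x) |>.pow 2).mul ?_
    exact (hlim.const_sub x).rpow_const (Or.inl (by linarith [hx.1]))
  have hInt : ∀ n, ∫⁻ x in Set.Ioo a b, F n x ≤
      ENNReal.ofReal K * slobodeckijSq (Set.Ioo a b) (s / 2) f := by
    intro n
    have hsub : Set.Ioo (α n) b ⊆ Set.Ioo a b := Set.Ioo_subset_Ioo_left (hα n).1.le
    have h1 := hK f (α n) b hf.measurable (hαb n) (hardyLeft_lt_top (hαb n) hsub (hαfin n))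
    refine le_trans ?_ (h1.trans (mul_le_mul_right (slobodeckijSq_mono hsub _ _) _))
    rw [hF, setLIntegral_indicator measurableSet_Ioo, Set.inter_eq_left.2 hsub]
    rfl
  calc hardyLeft s f a b = ∫⁻ x in Set.Ioo a b, Filter.liminf (fun n => F n x) Filter.atTop :=
        setLIntegral_congr_fun measurableSet_Ioo fun x hx => (hpt x hx).liminf_eq.symm
    _ ≤ Filter.liminf (fun n => ∫⁻ x in Set.Ioo a b, F n x) Filter.atTop :=
        lintegral_liminf_le hFm
    _ ≤ Filter.liminf (fun _ : ℕ => ENNReal.ofReal K * slobodeckijSq (Set.Ioo a b) (s / 2) f)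
          Filter.atTop := Filter.liminf_le_liminf (Filter.Eventually.of_forall hInt)
    _ = _ := Filter.liminf_const _

theorem IsHardyConst.right_of_continuous {s K : ℝ} (hK0 : 0 < K) (hK : IsHardyConst s K)
    {f : ℝ → ℝ} (hf : Continuous f) {a b : ℝ} (hab : a < b) :
    hardyRight s f a b ≤ ENNReal.ofReal K * slobodeckijSq (Set.Ioo a b) (s / 2) f := by
  rw [← slobodeckijSq_Ioo_reflect, hardyRight_eq_hardyLeft]
  exact hK.left_of_continuous hK0 (by fun_prop) hab

/-- The local Hölder estimate for continuous functions. -/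
theorem IsHardyConst.ofReal_sq_sub_le_of_continuous {s K : ℝ} (hs : 1 < s) (hK0 : 0 < K)
    (hK : IsHardyConst s K) {f : ℝ → ℝ} (hf : Continuous f) {a b : ℝ} (hab : a < b) :
    ENNReal.ofReal ((f b - f a) ^ 2) ≤
      ENNReal.ofReal (4 * K * (b - a) ^ (s - 1)) * slobodeckijSq (Set.Ioo a b) (s / 2) f := by
  have hh : 0 < b - a := by linarith
  rcases eq_or_ne (slobodeckijSq (Set.Ioo a b) (s / 2) f) ⊤ with htop | htop
  · rw [htop, ENNReal.mul_top (by simpa using (by positivity : 0 < 4 * K * (b - a) ^ (s - 1)))]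
    exact le_top
  have hfin : ENNReal.ofReal K * slobodeckijSq (Set.Ioo a b) (s / 2) f < ⊤ :=
    ENNReal.mul_lt_top ENNReal.ofReal_lt_top (lt_top_iff_ne_top.2 htop)
  exact hK.ofReal_sq_sub_le hs hK0 hf.measurable hab
    ((hK.left_of_continuous hK0 hf hab).trans_lt hfin)
    ((hK.right_of_continuous hK0 hf hab).trans_lt hfin)

/-! ### Fourier characterization of the Slobodeckij energy -/

-- The transform on `Lp` is not given by the Fourier integral. The two agree because they have the
-- same pairing with every test function: one by compatibility with tempered distributions, the
-- other by moving the integral transform across the pairing.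
open scoped FourierTransform SchwartzMap in
theorem fourier_toLp_ae_eq {g : ℝ → ℂ} (h1 : Integrable g) (h2 : MemLp g 2) :
    (𝓕 (h2.toLp g) : Lp ℂ 2 (volume : Measure ℝ)) =ᵐ[volume] 𝓕 g := by
  set G : Lp ℂ 2 (volume : Measure ℝ) := 𝓕 (h2.toLp g) with hG
  have hcont : Continuous (𝓕 g) :=
    VectorFourier.fourierIntegral_continuous Real.continuous_fourierChar
      (by exact continuous_inner) h1
  refine ae_eq_of_integral_contDiff_smul_eq
    ((Lp.memLp G).locallyIntegrable (by norm_num)) hcont.locallyIntegrable ?_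
  intro φ hφ hc
  have hc' : HasCompactSupport fun x => (φ x : ℂ) := hc.comp_left Complex.ofReal_zero
  have hφ' : ContDiff ℝ ((⊤ : ℕ∞) : WithTop ℕ∞) fun x => (φ x : ℂ) :=
    Complex.ofRealCLM.contDiff.comp hφ
  set ψ : 𝓢(ℝ, ℂ) := hc'.toSchwartzMap hφ' with hψ
  have hψx : ∀ x, ψ x = φ x := fun x => rfl
  have e1 : ∫ x, ψ x • G x = ∫ x, (𝓕 ψ) x • (h2.toLp g) x := by
    rw [← Lp.toTemperedDistribution_apply, ← Lp.toTemperedDistribution_apply,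
      ← TemperedDistribution.fourier_apply, Lp.fourier_toTemperedDistribution_eq]
  have e2 : ∫ x, (𝓕 ψ) x • (h2.toLp g) x = ∫ x, (𝓕 ψ) x • g x := by
    refine integral_congr_ae ?_
    filter_upwards [h2.coeFn_toLp] with x hx
    rw [hx]
  have e3 : ∫ x, (𝓕 ψ) x • g x = ∫ x, ψ x • 𝓕 g x := by
    simpa using! VectorFourier.integral_bilin_fourierIntegral_eq_flip
      (ContinuousLinearMap.lsmul ℂ ℂ) (L := innerₗ ℝ)
      Real.continuous_fourierChar continuous_inner ψ.integrable h1
  have e4 := (e1.trans e2).trans e3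
  simpa [hψx] using e4

theorem eLpNorm_two_sq {α E : Type*} [MeasurableSpace α] [NormedAddCommGroup E] {μ : Measure α}
    (f : α → E) : eLpNorm f 2 μ ^ 2 = ∫⁻ x, ‖f x‖ₑ ^ 2 ∂μ := by
  have h := eLpNorm_nnreal_pow_eq_lintegral (f := f) (μ := μ) (p := 2) (by norm_num)
  have h2 : (((2 : NNReal) : ℝ)) = ((2 : ℕ) : ℝ) := by norm_num
  rw [h2] at h
  simp only [ENNReal.rpow_natCast] at h
  exact h

open scoped FourierTransform in
/-- Plancherel's identity for integrable and square integrable functions. -/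
theorem lintegral_enorm_sq_fourier {g : ℝ → ℂ} (h1 : Integrable g) (h2 : MemLp g 2) :
    ∫⁻ ξ, ‖𝓕 g ξ‖ₑ ^ 2 = ∫⁻ x, ‖g x‖ₑ ^ 2 := by
  rw [← eLpNorm_two_sq, ← eLpNorm_two_sq, ← eLpNorm_congr_ae (fourier_toLp_ae_eq h1 h2),
    ← eLpNorm_congr_ae h2.coeFn_toLp]
  have h3 := Lp.norm_fourier_eq (h2.toLp g)
  rw [Lp.norm_def, Lp.norm_def, ENNReal.toReal_eq_toReal_iff' (Lp.eLpNorm_ne_top _)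
    (Lp.eLpNorm_ne_top _)] at h3
  rw [h3]

open scoped FourierTransform in
theorem fourier_sub_comp_add {g : ℝ → ℂ} (h1 : Integrable g) (t ξ : ℝ) :
    𝓕 (fun x => g (x + t) - g x) ξ =
      (Complex.exp (((2 * Real.pi * (t * ξ) : ℝ) : ℂ) * Complex.I) - 1) * 𝓕 g ξ := by
  have e1 : 𝓕 (fun x => g (x + t)) ξ =
      Complex.exp (((2 * Real.pi * (t * ξ) : ℝ) : ℂ) * Complex.I) * 𝓕 g ξ := by
    have := congrFun (VectorFourier.fourierIntegral_comp_add_right Real.fourierChar volume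
      (innerₗ ℝ) g t) ξ
    refine this.trans ?_
    rw [Circle.smul_def, Real.fourierChar_apply, smul_eq_mul]
    simp [mul_comm]
    rfl
  rw [sub_mul, one_mul, ← e1, Real.fourier_real_eq, Real.fourier_real_eq, Real.fourier_real_eq,
    ← integral_sub]
  · simp_rw [smul_sub]
  · have h := (Real.fourierIntegral_convergent_iff ξ).2 (h1.comp_add_right t)
    simpa [mul_comm] using h
  · have h := (Real.fourierIntegral_convergent_iff ξ).2 h1
    simpa [mul_comm] using h

/-- The square equals 2 - 2 cos θ, and cos θ ≤ 0 on this range. -/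
theorem two_le_norm_exp_sub_one_sq {θ : ℝ} (h1 : Real.pi / 2 ≤ |θ|) (h2 : |θ| ≤ Real.pi) :
    2 ≤ ‖Complex.exp ((θ : ℂ) * Complex.I) - 1‖ ^ 2 := by
  rw [← Complex.normSq_eq_norm_sq, Complex.normSq_apply]
  simp only [Complex.sub_re, Complex.exp_ofReal_mul_I_re, Complex.one_re, Complex.sub_im,
    Complex.exp_ofReal_mul_I_im, Complex.one_im, sub_zero]
  have hc : Real.cos θ ≤ 0 := by
    rw [← Real.cos_abs]
    exact Real.cos_nonpos_of_pi_div_two_le_of_le h1 (by linarith [Real.pi_pos])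
  nlinarith [Real.sin_sq_add_cos_sq θ]

/-- By scaling the integral is a multiple of |ξ|^s. Only a lower bound is needed, and the range 1/4
< t|ξ| < 1/2, where the phase has modulus between π/2 and π, already provides it. -/
theorem lintegral_rpow_mul_norm_exp_sub_one_ge {s : ℝ} (hs : 0 < s) {ξ : ℝ} (hξ : ξ ≠ 0) :
    ENNReal.ofReal (|ξ| ^ s) ≤ ∫⁻ t : ℝ, ENNReal.ofReal (1 / |t| ^ (1 + s)) *
      ‖Complex.exp (((2 * Real.pi * (t * ξ) : ℝ) : ℂ) * Complex.I) - 1‖ₑ ^ 2 := by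
  have hx : 0 < |ξ| := abs_pos.2 hξ
  have hlow : ∀ t ∈ Set.Ioo (1 / (4 * |ξ|)) (1 / (2 * |ξ|)),
      ENNReal.ofReal (2 * (2 * |ξ|) ^ (1 + s)) ≤ ENNReal.ofReal (1 / |t| ^ (1 + s)) *
      ‖Complex.exp (((2 * Real.pi * (t * ξ) : ℝ) : ℂ) * Complex.I) - 1‖ₑ ^ 2 := by
    intro t ht
    have ht0 : 0 < t := lt_trans (by positivity) ht.1
    have ht1 : 1 < t * (4 * |ξ|) := (div_lt_iff₀ (by positivity)).1 ht.1
    have ht2 : t * (2 * |ξ|) < 1 := (lt_div_iff₀ (by positivity)).1 ht.2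
    have hθ : |2 * Real.pi * (t * ξ)| = 2 * Real.pi * (t * |ξ|) := by
      rw [abs_mul, abs_mul t, abs_of_pos ht0, abs_of_pos (by positivity)]
    have h3 := two_le_norm_exp_sub_one_sq (θ := 2 * Real.pi * (t * ξ))
      (by rw [hθ]; nlinarith [Real.pi_pos]) (by rw [hθ]; nlinarith [Real.pi_pos])
    rw [← ofReal_norm, ← ENNReal.ofReal_pow (norm_nonneg _),
      ← ENNReal.ofReal_mul (by positivity)]
    refine ENNReal.ofReal_le_ofReal ?_
    rw [mul_comm 2]
    refine mul_le_mul ?_ h3 (by norm_num) (by positivity)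
    rw [abs_of_pos ht0, le_div_iff₀ (by positivity), ← Real.mul_rpow (by positivity) ht0.le]
    refine Real.rpow_le_one (by positivity) ?_ (by positivity)
    linarith
  refine le_trans ?_ (setLIntegral_le_lintegral (Set.Ioo (1 / (4 * |ξ|)) (1 / (2 * |ξ|))) _)
  refine le_trans ?_ (setLIntegral_mono' measurableSet_Ioo hlow)
  rw [setLIntegral_const, Real.volume_Ioo, ← ENNReal.ofReal_mul (by positivity)]
  refine ENNReal.ofReal_le_ofReal ?_
  have e1 : 2 * (2 * |ξ|) ^ (1 + s) * (1 / (2 * |ξ|) - 1 / (4 * |ξ|)) = (2 * |ξ|) ^ s := by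
    rw [Real.rpow_add (by positivity), Real.rpow_one]
    field_simp
    ring
  rw [e1]
  exact Real.rpow_le_rpow hx.le (by linarith) hs.le

/-- Grouping pairs by their shift t = y - x exposes the L² norms of f(· + t) - f, to which
Plancherel's identity applies. -/
theorem slobodeckijSq_univ_eq {s : ℝ} {f : ℝ → ℝ} (hf : Measurable f) :
    slobodeckijSq Set.univ (s / 2) f = ∫⁻ t : ℝ, ENNReal.ofReal (1 / |t| ^ (1 + s)) *
      ∫⁻ x : ℝ, ENNReal.ofReal ((f (x + t) - f x) ^ 2) := by
  have e1 : slobodeckijSq Set.univ (s / 2) f = ∫⁻ x : ℝ, ∫⁻ t : ℝ,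
      ENNReal.ofReal (1 / |t| ^ (1 + s)) * ENNReal.ofReal ((f (x + t) - f x) ^ 2) := by
    rw [slobodeckijSq_half, Measure.restrict_univ]
    refine lintegral_congr fun x => ?_
    unfold slobodeckijAt
    rw [Measure.restrict_univ, ← lintegral_add_left_eq_self _ x]
    refine lintegral_congr fun t => ?_
    rw [← ENNReal.ofReal_mul (by positivity), show x - (x + t) = -t by ring, abs_neg]
    congr 1
    ring
  rw [e1, lintegral_lintegral_swap]
  · refine lintegral_congr fun t => ?_
    rw [lintegral_const_mul' _ _ ENNReal.ofReal_ne_top]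
  · exact (by fun_prop : Measurable (Function.uncurry fun x t : ℝ =>
      ENNReal.ofReal (1 / |t| ^ (1 + s)) * ENNReal.ofReal ((f (x + t) - f x) ^ 2))).aemeasurable

open scoped FourierTransform in
/-- The Slobodeckij energy controls the weighted `L²` norm of the Fourier transform. -/
theorem lintegral_rpow_mul_fourier_le {s : ℝ} (hs : 0 < s) {f : ℝ → ℝ} (hf : Measurable f)
    (h1 : Integrable f) (h2 : MemLp f 2) :
    ∫⁻ ξ : ℝ, ENNReal.ofReal (|ξ| ^ s) * ‖𝓕 (fun x => (f x : ℂ)) ξ‖ₑ ^ 2 ≤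
      slobodeckijSq Set.univ (s / 2) f := by
  set g : ℝ → ℂ := fun x => (f x : ℂ) with hg
  have g1 : Integrable g := h1.ofReal
  have g2 : MemLp g 2 := h2.ofReal
  have hcont : Continuous (𝓕 g) :=
    VectorFourier.fourierIntegral_continuous Real.continuous_fourierChar
      (by exact continuous_inner) g1
  -- Plancherel for the difference, whose transform is (e^{2πitξ} - 1) 𝓕f(ξ).
  have e2 : ∀ t : ℝ, ∫⁻ x : ℝ, ENNReal.ofReal ((f (x + t) - f x) ^ 2) =
      ∫⁻ ξ : ℝ, ‖Complex.exp (((2 * Real.pi * (t * ξ) : ℝ) : ℂ) * Complex.I) - 1‖ₑ ^ 2 *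
        ‖𝓕 g ξ‖ₑ ^ 2 := by
    intro t
    have k1 : Integrable fun x => g (x + t) - g x := (g1.comp_add_right t).sub g1
    have k2 : MemLp (fun x => g (x + t) - g x) 2 :=
      (g2.comp_measurePreserving (measurePreserving_add_right volume t)).sub g2
    have := lintegral_enorm_sq_fourier k1 k2
    simp_rw [fourier_sub_comp_add g1, enorm_mul, mul_pow] at this
    rw [this]
    refine lintegral_congr fun x => ?_
    rw [hg, ← Complex.ofReal_sub, ← ofReal_norm, Complex.norm_real, Real.norm_eq_abs,
      ← ENNReal.ofReal_pow (abs_nonneg _), sq_abs]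
  rw [slobodeckijSq_univ_eq hf]
  simp_rw [e2, ← lintegral_const_mul' _ _ ENNReal.ofReal_ne_top]
  rw [lintegral_lintegral_swap]
  · refine lintegral_mono_ae ?_
    have : ∀ᵐ ξ : ℝ, ξ ≠ 0 := by simp [ae_iff, measure_singleton]
    filter_upwards [this] with ξ hξ
    simp_rw [← mul_assoc (ENNReal.ofReal _)]
    rw [lintegral_mul_const' _ _ (by finiteness)]
    exact mul_le_mul_left (lintegral_rpow_mul_norm_exp_sub_one_ge hs hξ) _
  · have := hcont.measurable
    exact (by fun_prop : Measurable (Function.uncurry fun t ξ : ℝ =>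
      ENNReal.ofReal (1 / |t| ^ (1 + s)) *
      (‖Complex.exp (((2 * Real.pi * (t * ξ) : ℝ) : ℂ) * Complex.I) - 1‖ₑ ^ 2 *
        ‖𝓕 g ξ‖ₑ ^ 2))).aemeasurable

/-! ### Boundedness of the fractional derivative -/

/-- Continuous functions that vanish outside `(0,1)` and have finite Slobodeckij energy of
order `β` on the line: the good representatives of the elements of `H̃^β(Ω)`, `β > 1/2`. -/
structure IsEnergyFun (β : ℝ) (f : ℝ → ℝ) : Prop where
  continuous : Continuous f
  eq_zero : ∀ x ∉ Ω, f x = 0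
  lt_top : slobodeckijSq Set.univ β f < ⊤

theorem IsEnergyFun.hasCompactSupport {β : ℝ} {f : ℝ → ℝ} (h : IsEnergyFun β f) :
    HasCompactSupport f :=
  HasCompactSupport.intro (isCompact_Icc (a := (0 : ℝ)) (b := 1)) fun x hx =>
    h.eq_zero x fun hx' => hx (Set.Ioo_subset_Icc_self hx')

theorem IsEnergyFun.integrable {β : ℝ} {f : ℝ → ℝ} (h : IsEnergyFun β f) : Integrable f :=
  h.continuous.integrable_of_hasCompactSupport h.hasCompactSupport

theorem IsEnergyFun.memLp {β : ℝ} {f : ℝ → ℝ} (h : IsEnergyFun β f) (p : ℝ≥0∞) : MemLp f p :=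
  h.continuous.memLp_of_hasCompactSupport h.hasCompactSupport

theorem sq_lintegral_mul_le {α : Type*} [MeasurableSpace α] {μ : Measure α} {F G : α → ℝ≥0∞}
    (hF : AEMeasurable F μ) (hG : AEMeasurable G μ) :
    (∫⁻ x, F x * G x ∂μ) ^ 2 ≤ (∫⁻ x, F x ^ 2 ∂μ) * ∫⁻ x, G x ^ 2 ∂μ := by
  have h := ENNReal.lintegral_mul_le_Lp_mul_Lq μ Real.HolderConjugate.two_two hF hG
  have h2 : ∀ a : ℝ≥0∞, (a ^ (1 / 2 : ℝ)) ^ 2 = a := by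
    intro a
    rw [← ENNReal.rpow_natCast, ← ENNReal.rpow_mul]
    norm_num
  have h3 := pow_le_pow_left' h 2
  simp only [mul_pow, h2] at h3
  simpa using h3

/-- Integration by parts gains 1/|c| from the oscillation. The boundary terms and the variation of
z^{-β} contribute 1 + a^{-β} + (a^{-β} - 1) = 2a^{-β}. -/
theorem norm_integral_rpow_mul_exp_le {β a : ℝ} (hβ : 0 < β) (ha : 0 < a) (ha1 : a ≤ 1)
    {c : ℝ} (hc : c ≠ 0) :
    ‖∫ z in a..1, ((z ^ (-β) : ℝ) : ℂ) * Complex.exp (((c * z : ℝ) : ℂ) * Complex.I)‖ ≤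
      2 * a ^ (-β) / |c| := by
  have hpos : ∀ z ∈ Set.uIcc a 1, 0 < z := by
    intro z hz
    rw [Set.uIcc_of_le ha1] at hz
    linarith [hz.1]
  have hcI : (c : ℂ) * Complex.I ≠ 0 := mul_ne_zero (by exact_mod_cast hc) Complex.I_ne_zero
  set u : ℝ → ℂ := fun z => ((z ^ (-β) : ℝ) : ℂ) with hu
  set u' : ℝ → ℂ := fun z => ((-β * z ^ (-β - 1) : ℝ) : ℂ) with hu'
  set v : ℝ → ℂ := fun z => Complex.exp (((c * z : ℝ) : ℂ) * Complex.I) / (c * Complex.I) with hv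
  set v' : ℝ → ℂ := fun z => Complex.exp (((c * z : ℝ) : ℂ) * Complex.I) with hv'
  have hud : ∀ z ∈ Set.uIcc a 1, HasDerivAt u (u' z) z := by
    intro z hz
    exact (Real.hasDerivAt_rpow_const (Or.inl (hpos z hz).ne')).ofReal_comp
  have hvd : ∀ z ∈ Set.uIcc a 1, HasDerivAt v (v' z) z := by
    intro z _
    have h1 : HasDerivAt (fun z : ℝ => ((c * z : ℝ) : ℂ) * Complex.I) (c * Complex.I) z := by
      have := (((hasDerivAt_id z).const_mul c).ofReal_comp).mul_const Complex.I
      simpa using this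
    have h2 := (h1.cexp).div_const ((c : ℂ) * Complex.I)
    rwa [mul_div_cancel_right₀ _ hcI] at h2
  have hu'i : IntervalIntegrable u' volume a 1 := by
    refine ContinuousOn.intervalIntegrable ?_
    intro z hz
    refine (Complex.continuous_ofReal.continuousAt.comp ?_).continuousWithinAt
    exact continuousAt_const.mul (Real.continuousAt_rpow_const _ _ (Or.inl (hpos z hz).ne'))
  have hv'i : IntervalIntegrable v' volume a 1 := by
    refine Continuous.intervalIntegrable ?_ _ _
    fun_prop
  have hvn : ∀ z, ‖v z‖ = 1 / |c| := by
    intro z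
    rw [hv, norm_div, Complex.norm_exp_ofReal_mul_I, norm_mul, Complex.norm_real, Complex.norm_I,
      mul_one, Real.norm_eq_abs]
  rw [intervalIntegral.integral_mul_deriv_eq_deriv_mul hud hvd hu'i hv'i]
  have hap : 0 < a ^ (-β) := Real.rpow_pos_of_pos ha _
  have hun : ∀ z, 0 < z → ‖u z‖ = z ^ (-β) := by
    intro z hz
    rw [hu, Complex.norm_real, Real.norm_of_nonneg (Real.rpow_nonneg hz.le _)]
  have h3 : ‖∫ z in a..1, u' z * v z‖ ≤ ∫ z in a..1, β * z ^ (-β - 1) * (1 / |c|) := by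
    refine intervalIntegral.norm_integral_le_of_norm_le ha1 ?_ ?_
    · refine Filter.Eventually.of_forall fun z hz => ?_
      have hz0 : 0 < z := ha.trans hz.1
      rw [norm_mul, hvn, hu', Complex.norm_real, Real.norm_eq_abs, abs_mul, abs_neg,
        abs_of_pos hβ, abs_of_pos (Real.rpow_pos_of_pos hz0 _)]
    · refine ContinuousOn.intervalIntegrable fun z hz => ContinuousAt.continuousWithinAt ?_
      exact (continuousAt_const.mul
        (Real.continuousAt_rpow_const _ _ (Or.inl (hpos z hz).ne'))).mul continuousAt_const
  have h4 : ∫ z in a..1, β * z ^ (-β - 1) * (1 / |c|) = (a ^ (-β) - 1) * (1 / |c|) := by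
    rw [intervalIntegral.integral_mul_const, intervalIntegral.integral_const_mul,
      integral_rpow (Or.inr ⟨by linarith, fun h0 => absurd (hpos 0 h0) (lt_irrefl _)⟩)]
    rw [show -β - 1 + 1 = -β by ring, Real.one_rpow]
    field_simp
    ring
  calc ‖u 1 * v 1 - u a * v a - ∫ z in a..1, u' z * v z‖
      ≤ ‖u 1 * v 1‖ + ‖u a * v a‖ + ‖∫ z in a..1, u' z * v z‖ :=
        (norm_sub_le _ _).trans (add_le_add_left (norm_sub_le _ _) _)
    _ ≤ 1 / |c| + a ^ (-β) * (1 / |c|) + (a ^ (-β) - 1) * (1 / |c|) := by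
        rw [norm_mul, norm_mul, hvn, hvn, hun 1 one_pos, hun a ha, Real.one_rpow, one_mul]
        linarith [h3.trans_eq h4]
    _ = 2 * a ^ (-β) / |c| := by ring

/-- The truncated Riesz kernel `z^{-β}` on `(0,1)`. -/
def rieszKernel (β : ℝ) : ℝ → ℝ := (Set.Ioo (0 : ℝ) 1).indicator fun z => z ^ (-β)

theorem integrable_rieszKernel {β : ℝ} (hβ : β < 1) : Integrable (rieszKernel β) := by
  unfold rieszKernel
  rw [integrable_indicator_iff measurableSet_Ioo]
  have := intervalIntegral.intervalIntegrable_rpow' (a := 0) (b := 1) (r := -β) (by linarith)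
  rw [intervalIntegrable_iff_integrableOn_Ioo_of_le zero_le_one] at this
  exact this

-- For |ξ| > 1 the integral is split at 1/|ξ|: absolute values suffice below, oscillation is used
-- above, and each part has size |ξ|^{β-1}. For |ξ| ≤ 1 the L¹ norm is enough since |ξ|^{β-1} ≥ 1.
open scoped FourierTransform in
theorem norm_fourier_rieszKernel_le {β : ℝ} (h0 : 0 < β) (h1 : β < 1) {ξ : ℝ} (hξ : ξ ≠ 0) :
    ‖𝓕 (fun z => (rieszKernel β z : ℂ)) ξ‖ ≤ (1 / (1 - β) + 2) * |ξ| ^ (β - 1) := by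
  have hx : 0 < |ξ| := abs_pos.2 hξ
  set E : ℝ → ℂ := fun z => Complex.exp (((-2 * Real.pi * ξ * z : ℝ) : ℂ) * Complex.I) with hE
  set k : ℝ → ℂ := fun z => ((z ^ (-β) : ℝ) : ℂ) * E z with hk
  have hkn : ∀ z, 0 < z → ‖k z‖ = z ^ (-β) := by
    intro z hz
    rw [hk, hE, norm_mul, Complex.norm_exp_ofReal_mul_I, mul_one, Complex.norm_real,
      Real.norm_of_nonneg (Real.rpow_nonneg hz.le _)]
  have hrp : ∀ a b : ℝ, IntervalIntegrable (fun z : ℝ => z ^ (-β)) volume a b := fun a b =>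
    intervalIntegral.intervalIntegrable_rpow' (by linarith)
  have hki : ∀ a b : ℝ, IntervalIntegrable k volume a b := by
    intro a b
    have h2 : IntervalIntegrable (fun z : ℝ => ((z ^ (-β) : ℝ) : ℂ)) volume a b :=
      ⟨(hrp a b).1.ofReal, (hrp a b).2.ofReal⟩
    exact h2.mul_continuousOn (by rw [hE]; fun_prop)
  have e1 : 𝓕 (fun z => (rieszKernel β z : ℂ)) ξ = ∫ z in (0 : ℝ)..1, k z := by
    rw [Real.fourier_real_eq_integral_exp_smul, intervalIntegral.integral_of_le zero_le_one,
      integral_Ioc_eq_integral_Ioo, ← integral_indicator measurableSet_Ioo]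
    refine integral_congr_ae (Filter.Eventually.of_forall fun z => ?_)
    by_cases hz : z ∈ Set.Ioo (0 : ℝ) 1
    · simp only [rieszKernel, Set.indicator_of_mem hz, hk, hE, smul_eq_mul]
      rw [mul_comm, show -2 * Real.pi * z * ξ = -2 * Real.pi * ξ * z by ring]
    · simp [rieszKernel, Set.indicator_of_notMem hz]
  have e2 : ∀ a : ℝ, 0 ≤ a → ‖∫ z in (0 : ℝ)..a, k z‖ ≤ a ^ (1 - β) / (1 - β) := by
    intro a ha
    have h2 : ‖∫ z in (0 : ℝ)..a, k z‖ ≤ ∫ z in (0 : ℝ)..a, z ^ (-β) :=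
      intervalIntegral.norm_integral_le_of_norm_le ha
        (Filter.Eventually.of_forall fun z hz => (hkn z hz.1).le) (hrp 0 a)
    rw [integral_rpow (Or.inl (by linarith)), Real.zero_rpow (by linarith), sub_zero,
      show -β + 1 = 1 - β by ring] at h2
    exact h2
  have hb : 0 < 1 - β := by linarith
  have hP : 0 < |ξ| ^ (β - 1) := Real.rpow_pos_of_pos hx _
  rw [e1]
  rcases le_or_gt |ξ| 1 with h | h
  · have h3 : 1 ≤ |ξ| ^ (β - 1) := Real.one_le_rpow_of_pos_of_le_one_of_nonpos hx h (by linarith)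
    have h4 := e2 1 zero_le_one
    rw [Real.one_rpow] at h4
    refine h4.trans ?_
    have : 0 < 1 / (1 - β) := by positivity
    nlinarith
  · have ha : 0 < 1 / |ξ| := by positivity
    have ha1 : 1 / |ξ| ≤ 1 := by rw [div_le_one hx]; exact h.le
    rw [← intervalIntegral.integral_add_adjacent_intervals (hki 0 (1 / |ξ|)) (hki (1 / |ξ|) 1)]
    have hc : -2 * Real.pi * ξ ≠ 0 := by
      have := Real.pi_pos.ne'
      simp [hξ, this]
    have h5 := norm_integral_rpow_mul_exp_le h0 ha ha1 hc
    have h6 := e2 (1 / |ξ|) ha.le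
    have e3 : (1 / |ξ|) ^ (1 - β) = |ξ| ^ (β - 1) := by
      rw [one_div, Real.inv_rpow hx.le, ← Real.rpow_neg hx.le]
      congr 1; ring
    have e4 : (1 / |ξ|) ^ (-β) = |ξ| ^ β := by
      rw [one_div, Real.inv_rpow hx.le, ← Real.rpow_neg hx.le, neg_neg]
    have e5 : |(-2 * Real.pi * ξ)| = 2 * Real.pi * |ξ| := by
      rw [abs_mul, abs_mul, abs_neg, abs_of_pos Real.pi_pos]; norm_num
    rw [e4, e5] at h5
    rw [e3] at h6
    have h7 : 2 * |ξ| ^ β / (2 * Real.pi * |ξ|) ≤ 2 * |ξ| ^ (β - 1) := by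
      rw [Real.rpow_sub_one hx.ne', div_le_iff₀ (by positivity)]
      have : 2 * (|ξ| ^ β / |ξ|) * (2 * Real.pi * |ξ|) = 4 * Real.pi * |ξ| ^ β := by
        field_simp; norm_num
      rw [this]
      have h8 : 0 ≤ |ξ| ^ β := by positivity
      nlinarith [Real.pi_gt_three]
    calc _ ≤ _ := norm_add_le _ _
      _ ≤ |ξ| ^ (β - 1) / (1 - β) + 2 * |ξ| ^ (β - 1) := add_le_add h6 (h5.trans h7)
      _ = _ := by ring

/-- For x in Ω and f supported in Ω only 0 < x - y < 1 occurs, so truncating the kernel at 1 changes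
nothing. It does make the kernel integrable, and the convolution theorem becomes available. -/
theorem integral_zero_sub_rpow_mul_eq {β : ℝ} {f : ℝ → ℝ} (hf : ∀ x ∉ Ω, f x = 0) {x : ℝ}
    (hx : x ∈ Ω) :
    ∫ y in (0 : ℝ)..x, (x - y) ^ (-β) * f y = ∫ z, rieszKernel β z * f (x - z) := by
  have e1 : ∫ y in (0 : ℝ)..x, (x - y) ^ (-β) * f y =
      ∫ z in (0 : ℝ)..x, z ^ (-β) * f (x - z) := by
    have := intervalIntegral.integral_comp_sub_left (a := 0) (b := x)
      (fun y => (x - y) ^ (-β) * f y) x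
    simp only [sub_sub_cancel, sub_self, sub_zero] at this
    exact this.symm
  rw [e1, intervalIntegral.integral_of_le hx.1.le, integral_Ioc_eq_integral_Ioo,
    ← integral_indicator measurableSet_Ioo]
  refine integral_congr_ae (Filter.Eventually.of_forall fun z => ?_)
  by_cases hz : z ∈ Set.Ioo (0 : ℝ) x
  · have hz' : z ∈ Set.Ioo (0 : ℝ) 1 := ⟨hz.1, hz.2.trans hx.2⟩
    simp only [Set.indicator_of_mem hz, rieszKernel, Set.indicator_of_mem hz']
  · simp only [Set.indicator_of_notMem hz, rieszKernel]
    by_cases hz' : z ∈ Set.Ioo (0 : ℝ) 1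
    · rw [Set.indicator_of_mem hz', hf (x - z), mul_zero]
      intro h
      exact hz ⟨hz'.1, by linarith [h.1]⟩
    · rw [Set.indicator_of_notMem hz', zero_mul]

theorem fracIntLeft_eq {β : ℝ} {f : ℝ → ℝ} (hf : ∀ x ∉ Ω, f x = 0) {x : ℝ}
    (hx : x ∈ Ω) :
    fracIntLeft (1 - β) f x =
      1 / Real.Gamma (1 - β) * ∫ z, rieszKernel β z * f (x - z) := by
  rw [fracIntLeft, ← integral_zero_sub_rpow_mul_eq hf hx, show 1 - β - 1 = -β by ring]

open scoped FourierTransform SchwartzMap Convolution in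
/-- The `L²` bound for the fractional derivative in duality form, for the truncated kernel. -/
theorem sq_enorm_integral_deriv_mul_convolution_le {β : ℝ} (h0 : 0 < β) (h1 : β < 1) {f : ℝ → ℝ}
    (hf : IsEnergyFun β f) {φ : ℝ → ℝ} (hφ : ContDiff ℝ ((⊤ : ℕ∞) : WithTop ℕ∞) φ)
    (hc : HasCompactSupport φ) :
    ‖∫ x, deriv φ x * ∫ z, rieszKernel β z * f (x - z)‖ₑ ^ 2 ≤
      ENNReal.ofReal ((2 * Real.pi * (1 / (1 - β) + 2)) ^ 2) * slobodeckijSq Set.univ β f *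
        ∫⁻ x, ‖φ x‖ₑ ^ 2 := by
  set κc : ℝ → ℂ := fun z => (rieszKernel β z : ℂ) with hκc
  set fc : ℝ → ℂ := fun z => (f z : ℂ) with hfc
  set φc : ℝ → ℂ := fun z => (φ z : ℂ) with hφc
  have hκi : Integrable κc := (integrable_rieszKernel h1).ofReal
  have hfi : Integrable fc := hf.integrable.ofReal
  set h : ℝ → ℂ := κc ⋆[ContinuousLinearMap.mul ℂ ℂ] fc with hh
  have hhi : Integrable h := hκi.integrable_convolution _ hfi
  have hhx : ∀ x, h x = ((∫ z, rieszKernel β z * f (x - z) : ℝ) : ℂ) := by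
    intro x
    rw [hh, convolution_def, ← integral_complex_ofReal]
    simp [hκc, hfc]
  have hφcd : ContDiff ℝ ((⊤ : ℕ∞) : WithTop ℕ∞) φc := Complex.ofRealCLM.contDiff.comp hφ
  have hφcc : HasCompactSupport φc := hc.comp_left Complex.ofReal_zero
  have hderiv : ∀ x, deriv φc x = ((deriv φ x : ℝ) : ℂ) := fun x =>
    ((hφ.differentiable (by simp)) x).hasDerivAt.ofReal_comp.deriv
  have hdd : ContDiff ℝ ((⊤ : ℕ∞) : WithTop ℕ∞) (deriv φc) :=
    (contDiff_infty_iff_deriv.1 hφcd).2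
  have hdc : HasCompactSupport (deriv φc) := hφcc.deriv
  set D : 𝓢(ℝ, ℂ) := hdc.toSchwartzMap hdd with hD
  have hDx : ∀ x, D x = deriv φc x := fun x => rfl
  -- Since `q` is the inverse transform of φ', moving the Fourier transform across the pairing gives
  -- ∫ φ' h = ∫ q 𝓕h. The factor |ξ| from the derivative and |ξ|^{β-1} from the kernel combine to
  -- |ξ|^β.
  set q : 𝓢(ℝ, ℂ) := 𝓕⁻ D with hq
  have hFq : 𝓕 q = D := FourierTransform.fourier_fourierInv_eq D
  have hqx : ∀ ξ, q ξ = (2 * Real.pi * Complex.I * ((-ξ : ℝ) : ℂ)) • 𝓕 φc (-ξ) := by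
    intro ξ
    have e1 : q ξ = 𝓕 (deriv φc) (-ξ) := by
      rw [hq, SchwartzMap.fourierInv_coe, Real.fourierInv_eq_fourier_neg]
      rfl
    rw [e1, Real.fourier_deriv (hφcd.continuous.integrable_of_hasCompactSupport hφcc)
      (hφcd.differentiable (by simp)) (hdd.continuous.integrable_of_hasCompactSupport hdc)]
  have e1 : ((∫ x, deriv φ x * ∫ z, rieszKernel β z * f (x - z) : ℝ) : ℂ) =
      ∫ ξ, q ξ • 𝓕 h ξ := by
    have h2 : ∫ x, (𝓕 q) x • h x = ∫ x, q x • 𝓕 h x := by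
      simpa using! VectorFourier.integral_bilin_fourierIntegral_eq_flip
        (ContinuousLinearMap.lsmul ℂ ℂ) (L := innerₗ ℝ)
        Real.continuous_fourierChar continuous_inner q.integrable hhi
    rw [← h2, hFq, ← integral_complex_ofReal]
    refine integral_congr_ae (Filter.Eventually.of_forall fun x => ?_)
    simp only [hDx, hderiv, hhx, smul_eq_mul, Complex.ofReal_mul]
  have hFf : Continuous (𝓕 fc) :=
    VectorFourier.fourierIntegral_continuous Real.continuous_fourierChar
      (by exact continuous_inner) hfi
  have hφi : Integrable φc := hφcd.continuous.integrable_of_hasCompactSupport hφcc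
  have hFφ : Continuous (𝓕 φc) :=
    VectorFourier.fourierIntegral_continuous Real.continuous_fourierChar
      (by exact continuous_inner) hφi
  set A : ℝ := 2 * Real.pi * (1 / (1 - β) + 2) with hA
  have hA0 : 0 ≤ A := by
    have : 0 < 1 - β := by linarith
    have := Real.pi_pos
    positivity
  have hpt : ∀ᵐ ξ : ℝ, ‖q ξ • 𝓕 h ξ‖ₑ ≤
      ENNReal.ofReal A * (‖𝓕 φc (-ξ)‖ₑ * (ENNReal.ofReal (|ξ| ^ β) * ‖𝓕 fc ξ‖ₑ)) := by
    have : ∀ᵐ ξ : ℝ, ξ ≠ 0 := by simp [ae_iff, measure_singleton]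
    filter_upwards [this] with ξ hξ
    have h3 := norm_fourier_rieszKernel_le h0 h1 hξ
    have h4 : 𝓕 h ξ = 𝓕 κc ξ * 𝓕 fc ξ := Real.fourier_mul_convolution_eq hκi hfi ξ
    have hx : 0 < |ξ| := abs_pos.2 hξ
    rw [← ofReal_norm, ← ofReal_norm, ← ofReal_norm, ← ENNReal.ofReal_mul (by positivity),
      ← ENNReal.ofReal_mul (by positivity), ← ENNReal.ofReal_mul hA0]
    refine ENNReal.ofReal_le_ofReal ?_
    rw [norm_smul, hqx, h4, norm_smul, norm_mul (𝓕 κc ξ)]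
    have h5 : ‖(2 * Real.pi * Complex.I * ((-ξ : ℝ) : ℂ))‖ = 2 * Real.pi * |ξ| := by
      simp [abs_of_pos Real.pi_pos]
    rw [h5]
    have h6 : |ξ| ^ β = |ξ| * |ξ| ^ (β - 1) := by
      rw [Real.rpow_sub_one hx.ne']; field_simp
    calc 2 * Real.pi * |ξ| * ‖𝓕 φc (-ξ)‖ * (‖𝓕 κc ξ‖ * ‖𝓕 fc ξ‖)
        ≤ 2 * Real.pi * |ξ| * ‖𝓕 φc (-ξ)‖ *
          ((1 / (1 - β) + 2) * |ξ| ^ (β - 1) * ‖𝓕 fc ξ‖) := by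
          have := Real.pi_pos
          gcongr
      _ = _ := by rw [h6, hA]; ring
  have e2 : ‖∫ x, deriv φ x * ∫ z, rieszKernel β z * f (x - z)‖ₑ ≤
      ENNReal.ofReal A * ∫⁻ ξ, ‖𝓕 φc (-ξ)‖ₑ * (ENNReal.ofReal (|ξ| ^ β) * ‖𝓕 fc ξ‖ₑ) := by
    rw [← lintegral_const_mul' _ _ ENNReal.ofReal_ne_top]
    refine le_trans ?_ (lintegral_mono_ae hpt)
    refine le_trans (le_of_eq ?_) (enorm_integral_le_lintegral_enorm _)
    rw [← e1, ← ofReal_norm, ← ofReal_norm, Complex.norm_real]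
  have e3 := pow_le_pow_left' e2 2
  rw [mul_pow] at e3
  have m1 := hFf.measurable
  have m2 := hFφ.measurable
  have e4 := sq_lintegral_mul_le (μ := (volume : Measure ℝ)) (F := fun ξ => ‖𝓕 φc (-ξ)‖ₑ)
    (G := fun ξ => ENNReal.ofReal (|ξ| ^ β) * ‖𝓕 fc ξ‖ₑ) (by fun_prop) (by fun_prop)
  refine (e3.trans (mul_le_mul_right e4 _)).trans ?_
  have e5 : ∫⁻ ξ, ‖𝓕 φc (-ξ)‖ₑ ^ 2 = ∫⁻ x, ‖φ x‖ₑ ^ 2 := by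
    rw [(Measure.measurePreserving_neg (volume : Measure ℝ)).lintegral_comp
      (f := fun ξ => ‖𝓕 φc ξ‖ₑ ^ 2) (by fun_prop),
      lintegral_enorm_sq_fourier hφi (hφcd.continuous.memLp_of_hasCompactSupport hφcc)]
    refine lintegral_congr fun x => ?_
    rw [← ofReal_norm, ← ofReal_norm, hφc, Complex.norm_real]
  have e6 : ∫⁻ ξ, (ENNReal.ofReal (|ξ| ^ β) * ‖𝓕 fc ξ‖ₑ) ^ 2 ≤ slobodeckijSq Set.univ β f := by
    have := lintegral_rpow_mul_fourier_le (s := 2 * β) (by linarith) hf.continuous.measurable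
      hf.integrable (hf.memLp 2)
    rw [show 2 * β / 2 = β by ring] at this
    refine le_trans (le_of_eq (lintegral_congr fun ξ => ?_)) this
    rw [mul_pow, ← ENNReal.ofReal_pow (by positivity), ← Real.rpow_natCast,
      ← Real.rpow_mul (abs_nonneg _)]
    congr 3
    push_cast
    ring
  rw [e5, ENNReal.ofReal_pow hA0, mul_assoc]
  refine mul_le_mul_right ?_ _
  rw [mul_comm]
  exact mul_le_mul_left e6 _

-- The bound forces `L` to vanish on the kernel of `T`, so `L` descends to a bounded functional on
-- the range of `T`, although `E` carries no norm and `T` need not be injective. Hahn-Banach extends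
-- it and Riesz represents it.
open scoped InnerProductSpace in
theorem exists_inner_eq_of_abs_le {E H : Type*} [AddCommGroup E] [Module ℝ E]
    [NormedAddCommGroup H] [InnerProductSpace ℝ H] [CompleteSpace H] (T : E →ₗ[ℝ] H)
    (L : E →ₗ[ℝ] ℝ) {C : ℝ} (hC : 0 ≤ C) (h : ∀ φ, |L φ| ≤ C * ‖T φ‖) :
    ∃ w : H, ‖w‖ ≤ C ∧ ∀ φ, L φ = ⟪w, T φ⟫_ℝ := by
  obtain ⟨g, hg⟩ := T.rangeRestrict.exists_rightInverse_of_surjective T.range_rangeRestrict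
  have hTg : ∀ y : T.range, T (g y) = y := fun y =>
    congrArg Subtype.val (LinearMap.congr_fun hg y)
  set ℓ : T.range →L[ℝ] ℝ := (L.comp g).mkContinuous C (by
    intro y
    have := h (g y)
    rw [hTg] at this
    exact this) with hℓ
  have hℓn : ‖ℓ‖ ≤ C := LinearMap.mkContinuous_norm_le _ hC _
  obtain ⟨G, hG1, hG2⟩ := exists_extension_norm_eq _ ℓ
  refine ⟨(InnerProductSpace.toDual ℝ H).symm G, ?_, fun φ => ?_⟩
  · rw [LinearIsometryEquiv.norm_map, hG2]
    exact hℓn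
  · rw [InnerProductSpace.toDual_symm_apply]
    have h1 := hG1 (T.rangeRestrict φ)
    have h2 : ℓ (T.rangeRestrict φ) = L (g (T.rangeRestrict φ)) := rfl
    have h3 := h (φ - g (T.rangeRestrict φ))
    rw [map_sub, map_sub, hTg] at h3
    have h4 : ((T.rangeRestrict φ : T.range) : H) = T φ := rfl
    rw [h4, sub_self, norm_zero, mul_zero] at h3
    have h5 := sub_eq_zero.1 (abs_eq_zero.1 (le_antisymm h3 (abs_nonneg _)))
    rw [h5, ← h2, ← h1, h4]

/-- The test functions on an open set, as a space of functions. -/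
def testFunctions (I : Set ℝ) : Submodule ℝ (ℝ → ℝ) where
  carrier := {φ | ContDiff ℝ ((⊤ : ℕ∞) : WithTop ℕ∞) φ ∧ HasCompactSupport φ ∧ tsupport φ ⊆ I}
  add_mem' := fun {a b} ha hb => ⟨ha.1.add hb.1, ha.2.1.add hb.2.1,
    (tsupport_add a b).trans (Set.union_subset ha.2.2 hb.2.2)⟩
  zero_mem' := ⟨contDiff_const, HasCompactSupport.zero, by simp [tsupport]⟩
  smul_mem' := fun c φ h => ⟨contDiff_const.smul h.1, h.2.1.smul_left (f := fun _ => c),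
    (closure_mono (Function.support_const_smul_subset c φ)).trans h.2.2⟩

theorem integrable_convolution_rieszKernel {β : ℝ} (h1 : β < 1) {f : ℝ → ℝ}
    (hf : Integrable f) : Integrable fun x => ∫ z, rieszKernel β z * f (x - z) := by
  have := (integrable_rieszKernel h1).integrable_convolution (ContinuousLinearMap.mul ℝ ℝ) hf
  refine this.congr (Filter.Eventually.of_forall fun x => ?_)
  simp [convolution_def]

theorem Integrable.mul_of_continuous_of_hasCompactSupport {h φ : ℝ → ℝ} (hh : Integrable h)
    (hφ : Continuous φ) (hc : HasCompactSupport φ) : Integrable fun x => φ x * h x := by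
  obtain ⟨C, hC⟩ := hφ.bounded_above_of_compact_support hc
  exact hh.bdd_mul hφ.aestronglyMeasurable (Filter.Eventually.of_forall hC)

/-- The fractional derivative of order `β` of an energy function exists in `L²(Ω)`. -/
theorem exists_isWeakDeriv_fracIntLeft {β : ℝ} (h0 : 0 < β) (h1 : β < 1) :
    ∃ C : ℝ, 0 < C ∧ ∀ f : ℝ → ℝ, IsEnergyFun β f →
      ∃ W : ℝ → ℝ, MemLp W 2 (volume.restrict Ω) ∧ IsWeakDeriv Ω 1 (fracIntLeft (1 - β) f) W ∧
        eLpNorm W 2 (volume.restrict Ω) ^ 2 ≤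
          ENNReal.ofReal C * slobodeckijSq Set.univ β f := by
  set A : ℝ := 2 * Real.pi * (1 / (1 - β) + 2) with hA
  have hβ : 0 < 1 - β := by linarith
  have hA0 : 0 < A := by have := Real.pi_pos; positivity
  have hG : 0 < Real.Gamma (1 - β) := Real.Gamma_pos_of_pos hβ
  set c : ℝ := 1 / Real.Gamma (1 - β) with hc
  have hc0 : 0 < c := by positivity
  refine ⟨(c * A) ^ 2, by positivity, fun f hf => ?_⟩
  set S := slobodeckijSq Set.univ β f with hS
  set k : ℝ → ℝ := fun x => ∫ z, rieszKernel β z * f (x - z) with hk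
  have hki : Integrable k := integrable_convolution_rieszKernel h1 hf.integrable
  have hFk : ∀ x ∈ Ω, fracIntLeft (1 - β) f x = c * k x := fun x hx =>
    fracIntLeft_eq hf.eq_zero hx
  have hμ : ∀ φ : testFunctions Ω, MemLp (φ : ℝ → ℝ) 2 (volume.restrict Ω) := fun φ =>
    (φ.2.1.continuous.memLp_of_hasCompactSupport φ.2.2.1).restrict _
  have hdi : ∀ φ : testFunctions Ω, Integrable fun x => deriv (φ : ℝ → ℝ) x * k x := fun φ =>
    Integrable.mul_of_continuous_of_hasCompactSupport hki
      (contDiff_infty_iff_deriv.1 φ.2.1).2.continuous φ.2.2.1.deriv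
  have hdiff : ∀ φ : testFunctions Ω, Differentiable ℝ (φ : ℝ → ℝ) := fun φ =>
    φ.2.1.differentiable (by simp)
  let T : testFunctions Ω →ₗ[ℝ] Lp ℝ 2 (volume.restrict Ω) :=
    { toFun := fun φ => (hμ φ).toLp φ
      map_add' := fun φ ψ => MemLp.toLp_add (hμ φ) (hμ ψ)
      map_smul' := fun a φ => MemLp.toLp_const_smul a (hμ φ) }
  let L : testFunctions Ω →ₗ[ℝ] ℝ :=
    { toFun := fun φ => c * ∫ x, deriv (φ : ℝ → ℝ) x * k x
      map_add' := fun φ ψ => by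
        have : ∀ x, deriv ((φ + ψ : testFunctions Ω) : ℝ → ℝ) x * k x =
            deriv (φ : ℝ → ℝ) x * k x + deriv (ψ : ℝ → ℝ) x * k x := by
          intro x
          rw [Submodule.coe_add, deriv_add (hdiff φ x) (hdiff ψ x), add_mul]
        simp_rw [this]
        rw [integral_add (hdi φ) (hdi ψ), mul_add]
      map_smul' := fun a φ => by
        have : ∀ x, deriv ((a • φ : testFunctions Ω) : ℝ → ℝ) x * k x =
            a * (deriv (φ : ℝ → ℝ) x * k x) := by
          intro x
          rw [Submodule.coe_smul, deriv_const_smul a (hdiff φ x), smul_eq_mul, mul_assoc]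
        simp_rw [this]
        rw [integral_const_mul, RingHom.id_apply, smul_eq_mul]
        ring }
  have hST : S ≠ ⊤ := hf.lt_top.ne
  have hbound : ∀ φ, |L φ| ≤ c * A * Real.sqrt S.toReal * ‖T φ‖ := by
    intro φ
    have h2 := sq_enorm_integral_deriv_mul_convolution_le h0 h1 hf φ.2.1 φ.2.2.1
    have h3 : ∫⁻ x, ‖(φ : ℝ → ℝ) x‖ₑ ^ 2 = ENNReal.ofReal (‖T φ‖ ^ 2) := by
      have e1 : ‖T φ‖ = (eLpNorm (φ : ℝ → ℝ) 2 (volume.restrict Ω)).toReal := Lp.norm_toLp _ (hμ φ)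
      rw [e1, ENNReal.ofReal_pow ENNReal.toReal_nonneg, ENNReal.ofReal_toReal (hμ φ).eLpNorm_ne_top,
        eLpNorm_two_sq, setLIntegral_eq_of_support_subset]
      intro x hx
      refine φ.2.2.2 (subset_tsupport _ ?_)
      intro h0
      simp [h0] at hx
    rw [h3, ← hS, ← ofReal_norm, ← ENNReal.ofReal_pow (norm_nonneg _), ← ENNReal.ofReal_toReal hST,
      ← ENNReal.ofReal_mul (by positivity), ← ENNReal.ofReal_mul (by positivity),
      ENNReal.ofReal_le_ofReal_iff (by positivity)] at h2
    have h4 : |∫ x, deriv (φ : ℝ → ℝ) x * k x| ≤ A * Real.sqrt S.toReal * ‖T φ‖ := by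
      refine abs_le_of_sq_le_sq ?_ (by positivity)
      rw [mul_pow, mul_pow, Real.sq_sqrt ENNReal.toReal_nonneg]
      rw [Real.norm_eq_abs, sq_abs] at h2
      exact h2
    calc |L φ| = c * |∫ x, deriv (φ : ℝ → ℝ) x * k x| := by
          rw [show L φ = c * ∫ x, deriv (φ : ℝ → ℝ) x * k x from rfl, abs_mul, abs_of_pos hc0]
      _ ≤ c * (A * Real.sqrt S.toReal * ‖T φ‖) := mul_le_mul_of_nonneg_left h4 hc0.le
      _ = _ := by ring
  -- The representing vector satisfies c ∫ φ' k = ⟨w, φ⟩ for all test functions, so the weak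
  -- derivative is -w.
  obtain ⟨w, hw1, hw2⟩ := exists_inner_eq_of_abs_le T L (by positivity) hbound
  have hwm : MemLp (fun x => -w x) 2 (volume.restrict Ω) := (Lp.memLp w).neg
  refine ⟨fun x => -w x, hwm, ⟨?_, ?_, ?_⟩, ?_⟩
  · have : LocallyIntegrableOn (fun x => c * k x) Ω :=
      (hki.const_mul c).locallyIntegrable.locallyIntegrableOn _
    refine LocallyIntegrableOn.congr_ae this
      ((ae_restrict_iff' measurableSet_Ioo).2 (Filter.Eventually.of_forall fun x hx => ?_))
    exact (hFk x hx).symm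
  · have : Integrable (fun x => -w x) (volume.restrict Ω) := hwm.integrable (by norm_num)
    exact IntegrableOn.locallyIntegrableOn this
  · intro φ hφ hφc hφs
    set ψ : testFunctions Ω := ⟨φ, hφ, hφc, hφs⟩ with hψ
    have h2 := hw2 ψ
    rw [L2.inner_def] at h2
    have h3 : L ψ = ∫ x in Ω, fracIntLeft (1 - β) f x * iteratedDeriv 1 φ x := by
      have e1 : L ψ = c * ∫ x, deriv φ x * k x := rfl
      rw [e1, ← integral_const_mul, ← setIntegral_eq_integral_of_forall_compl_eq_zero (s := Ω)]
      · refine setIntegral_congr_fun measurableSet_Ioo fun x hx => ?_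
        simp only [hFk x hx, iteratedDeriv_one]
        ring
      · intro x hx
        have : deriv φ x = 0 := by
          by_contra h
          exact hx (hφs (support_deriv_subset h))
        simp [this]
    rw [← h3, h2]
    simp only [pow_one, neg_mul, one_mul, integral_neg, neg_neg]
    refine integral_congr_ae ?_
    filter_upwards [(hμ ψ).coeFn_toLp] with x hx
    have : (T ψ : ℝ → ℝ) x = φ x := hx
    rw [this]
    simp [mul_comm]
  · have e1 : eLpNorm (fun x => -w x) 2 (volume.restrict Ω) = eLpNorm w 2 (volume.restrict Ω) :=
      eLpNorm_neg _ _ _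
    rw [e1]
    have e2 : eLpNorm w 2 (volume.restrict Ω) = ENNReal.ofReal ‖w‖ := by
      rw [Lp.norm_def, ENNReal.ofReal_toReal (Lp.eLpNorm_ne_top w)]
    rw [e2, ← ENNReal.ofReal_pow (norm_nonneg _), ← ENNReal.ofReal_toReal hST,
      ← ENNReal.ofReal_mul (by positivity)]
    refine ENNReal.ofReal_le_ofReal ?_
    have := pow_le_pow_left₀ (norm_nonneg _) hw1 2
    rwa [mul_pow, Real.sq_sqrt ENNReal.toReal_nonneg] at this

/-! ### Weak derivatives of fractional integrals: algebra and reflection -/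

/-- Meant for ψ equal to φ or to its derivative, which explains the shape of the last hypothesis. -/
theorem integrableOn_mul_of_tsupport_subset {I : Set ℝ} {v ψ φ : ℝ → ℝ}
    (hv : LocallyIntegrableOn v I) (hψ : Continuous ψ) (hc : HasCompactSupport φ)
    (hs : tsupport φ ⊆ I) (h0 : ∀ x, φ x = 0 → x ∉ tsupport φ → ψ x = 0) :
    IntegrableOn (fun x => v x * ψ x) I := by
  have h1 : IntegrableOn v (tsupport φ) := hv.integrableOn_compact_subset hs hc
  have h2 : IntegrableOn (fun x => v x * ψ x) (tsupport φ) :=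
    h1.mul_continuousOn hψ.continuousOn hc
  refine ((integrableOn_iff_integrable_of_support_subset ?_).1 h2).integrableOn
  intro x hx
  by_contra hx'
  have : φ x = 0 := by
    by_contra h3
    exact hx' (subset_tsupport φ h3)
  exact hx (by simp [h0 x this hx'])

theorem IsWeakDeriv.linear_comb {I : Set ℝ} {u v w z : ℝ → ℝ} (h : IsWeakDeriv I 1 u w)
    (h' : IsWeakDeriv I 1 v z) (a b : ℝ) :
    IsWeakDeriv I 1 (fun x => a * u x + b * v x) (fun x => a * w x + b * z x) := by
  have sm : ∀ {f : ℝ → ℝ} (c : ℝ), LocallyIntegrableOn f I →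
      LocallyIntegrableOn (fun x => c * f x) I := by
    intro f c hf x hx
    obtain ⟨t, ht, hi⟩ := hf x hx
    exact ⟨t, ht, hi.const_mul c⟩
  refine ⟨(sm a h.1).add (sm b h'.1), (sm a h.2.1).add (sm b h'.2.1), fun φ h1 h2 h3 => ?_⟩
  have e1 := h.2.2 φ h1 h2 h3
  have e2 := h'.2.2 φ h1 h2 h3
  have hd : Continuous (deriv φ) := (contDiff_infty_iff_deriv.1 h1).2.continuous
  have k0 : ∀ x, φ x = 0 → x ∉ tsupport φ → deriv φ x = 0 := by
    intro x _ hx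
    by_contra h0
    exact hx (support_deriv_subset h0)
  simp only [iteratedDeriv_one] at e1 e2 ⊢
  have i1 := integrableOn_mul_of_tsupport_subset h.1 hd h2 h3 k0
  have i2 := integrableOn_mul_of_tsupport_subset h'.1 hd h2 h3 k0
  have i3 := integrableOn_mul_of_tsupport_subset h.2.1 h1.continuous h2 h3 fun x hx _ => hx
  have i4 := integrableOn_mul_of_tsupport_subset h'.2.1 h1.continuous h2 h3 fun x hx _ => hx
  simp_rw [add_mul, mul_assoc]
  rw [integral_add (i1.const_mul a) (i2.const_mul b), integral_add (i3.const_mul a)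
    (i4.const_mul b), integral_const_mul, integral_const_mul, integral_const_mul,
    integral_const_mul, e1, e2]
  ring

theorem preimage_one_sub_Ω : (fun x : ℝ => 1 - x) ⁻¹' Ω = Ω := by
  ext x
  simp only [Set.mem_preimage, Set.mem_Ioo]
  constructor <;> rintro ⟨h1, h2⟩ <;> constructor <;> linarith

theorem integral_Ω_comp_one_sub (f : ℝ → ℝ) : ∫ x in Ω, f (1 - x) = ∫ x in Ω, f x := by
  rw [← (Measure.measurePreserving_sub_left volume (1 : ℝ)).setIntegral_preimage_emb
    (measurableEmbedding_subLeft (1 : ℝ)) f Ω, preimage_one_sub_Ω]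

theorem ae_Ω_comp_one_sub {p : ℝ → Prop} (h : ∀ᵐ x ∂volume.restrict Ω, p x) :
    ∀ᵐ x ∂volume.restrict Ω, p (1 - x) := by
  have := ((Measure.measurePreserving_sub_left volume (1 : ℝ)).restrict_preimage_emb
    (measurableEmbedding_subLeft (1 : ℝ)) Ω).quasiMeasurePreserving.ae h
  rwa [preimage_one_sub_Ω] at this

theorem LocallyIntegrableOn.comp_one_sub {u : ℝ → ℝ} (h : LocallyIntegrableOn u Ω) :
    LocallyIntegrableOn (fun x => u (1 - x)) Ω := by
  rw [locallyIntegrableOn_iff (isOpen_Ioo.isLocallyClosed)] at h ⊢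
  intro k hk hkc
  have hp : (fun x : ℝ => 1 - x) ⁻¹' ((fun x => 1 - x) ⁻¹' k) = k := by
    ext x; simp
  rw [← hp]
  refine ((Measure.measurePreserving_sub_left volume (1 : ℝ)).integrableOn_comp_preimage
    (measurableEmbedding_subLeft (1 : ℝ))).2 (h _ ?_ ?_)
  · intro x hx
    have h1 := hk hx
    simp only [Set.mem_Ioo] at h1 ⊢
    constructor <;> linarith [h1.1, h1.2]
  · exact (Homeomorph.subLeft (1 : ℝ)).isCompact_preimage.2 hkc

theorem IsWeakDeriv.comp_one_sub {u w : ℝ → ℝ} (h : IsWeakDeriv Ω 1 u w) :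
    IsWeakDeriv Ω 1 (fun x => u (1 - x)) (fun x => -w (1 - x)) := by
  refine ⟨LocallyIntegrableOn.comp_one_sub h.1, (LocallyIntegrableOn.comp_one_sub h.2.1).neg,
    fun φ h1 h2 h3 => ?_⟩
  set ψ : ℝ → ℝ := fun x => φ (1 - x) with hψ
  have hts : tsupport ψ = (fun x : ℝ => 1 - x) ⁻¹' tsupport φ :=
    tsupport_comp_eq_preimage φ (Homeomorph.subLeft (1 : ℝ))
  have e1 := h.2.2 ψ (h1.comp (contDiff_const.sub contDiff_id))
    (h2.comp_homeomorph (Homeomorph.subLeft (1 : ℝ))) (by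
      rw [hts, ← preimage_one_sub_Ω]
      exact Set.preimage_mono h3)
  have hd : ∀ x, deriv ψ x = -deriv φ (1 - x) := fun x => deriv_comp_const_sub φ 1 x
  simp only [iteratedDeriv_one, hd] at e1 ⊢
  rw [← integral_Ω_comp_one_sub (fun x => u (1 - x) * deriv φ x),
    ← integral_Ω_comp_one_sub (fun x => -w (1 - x) * φ x)]
  simp only [sub_sub_cancel, mul_neg, integral_neg, neg_mul, hψ, pow_one, one_mul] at e1 ⊢
  linarith

/-- The reflection x ↦ 1 - x exchanges the two fractional integrals; facts about right derivatives
are deduced from those about left ones in this way. -/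
theorem fracIntRight_eq_fracIntLeft (α : ℝ) (u : ℝ → ℝ) (x : ℝ) :
    fracIntRight α u x = fracIntLeft α (fun y => u (1 - y)) (1 - x) := by
  unfold fracIntRight fracIntLeft
  congr 1
  have := intervalIntegral.integral_comp_sub_left (a := 0) (b := 1 - x)
    (fun y => (y - x) ^ (α - 1) * u y) 1
  simp only [sub_sub_cancel, sub_zero] at this
  rw [← this]
  refine intervalIntegral.integral_congr fun y _ => ?_
  simp only
  rw [sub_right_comm]

theorem fracIntLeft_congr {α : ℝ} {u v : ℝ → ℝ} (h : u =ᵐ[volume.restrict Ω] v) {x : ℝ}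
    (hx : x ∈ Ω) : fracIntLeft α u x = fracIntLeft α v x := by
  unfold fracIntLeft
  congr 1
  refine intervalIntegral.integral_congr_ae_restrict ?_
  rw [Set.uIoc_of_le hx.1.le]
  refine ae_restrict_of_ae_restrict_of_subset (fun y hy => ⟨hy.1, hy.2.trans_lt hx.2⟩) (t := Ω) ?_
  filter_upwards [h] with y hy
  rw [hy]

theorem intervalIntegrable_sub_rpow_mul {α : ℝ} (hα : 0 < α) {f : ℝ → ℝ} (hf : Continuous f)
    (x : ℝ) : IntervalIntegrable (fun y => (x - y) ^ (α - 1) * f y) volume 0 x := by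
  refine IntervalIntegrable.mul_continuousOn ?_ hf.continuousOn
  have := (intervalIntegral.intervalIntegrable_rpow' (a := x) (b := 0) (r := α - 1)
    (by linarith)).comp_sub_left x
  simpa using this

theorem fracIntLeft_linear_comb {α : ℝ} (hα : 0 < α) {f g : ℝ → ℝ} (hf : Continuous f)
    (hg : Continuous g) (a b x : ℝ) :
    fracIntLeft α (fun y => a * f y + b * g y) x =
      a * fracIntLeft α f x + b * fracIntLeft α g x := by
  unfold fracIntLeft
  have : ∀ y, (x - y) ^ (α - 1) * (a * f y + b * g y) =
      a * ((x - y) ^ (α - 1) * f y) + b * ((x - y) ^ (α - 1) * g y) := fun y => by ring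
  simp_rw [this]
  rw [intervalIntegral.integral_add ((intervalIntegrable_sub_rpow_mul hα hf x).const_mul a)
    ((intervalIntegrable_sub_rpow_mul hα hg x).const_mul b), intervalIntegral.integral_const_mul,
    intervalIntegral.integral_const_mul]
  ring

theorem IsWeakDeriv.fracIntLeft_congr {α : ℝ} {u v W : ℝ → ℝ}
    (h : IsWeakDeriv Ω 1 (fracIntLeft α u) W) (huv : u =ᵐ[volume.restrict Ω] v) :
    IsWeakDeriv Ω 1 (fracIntLeft α v) W :=
  h.congr_ae ((ae_restrict_iff' measurableSet_Ioo).2 (Filter.Eventually.of_forall fun _ hx =>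
    FracBVP.fracIntLeft_congr huv hx)) Filter.EventuallyEq.rfl

theorem isWeakDeriv_fracIntRight_of_left {α : ℝ} {u W : ℝ → ℝ}
    (h : IsWeakDeriv Ω 1 (fracIntLeft α fun y => u (1 - y)) W) :
    IsWeakDeriv Ω 1 (fracIntRight α u) (fun x => -W (1 - x)) := by
  refine h.comp_one_sub.congr_ae (Filter.Eventually.of_forall fun x => ?_)
    Filter.EventuallyEq.rfl
  exact (fracIntRight_eq_fracIntLeft α u x).symm

theorem IsWeakDeriv.fracIntRight_congr {α : ℝ} {u v W : ℝ → ℝ}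
    (h : IsWeakDeriv Ω 1 (fracIntRight α u) W) (huv : u =ᵐ[volume.restrict Ω] v) :
    IsWeakDeriv Ω 1 (fracIntRight α v) W := by
  refine h.congr_ae ((ae_restrict_iff' measurableSet_Ioo).2 (Filter.Eventually.of_forall
    fun x hx => ?_)) Filter.EventuallyEq.rfl
  rw [fracIntRight_eq_fracIntLeft, fracIntRight_eq_fracIntLeft]
  refine FracBVP.fracIntLeft_congr (ae_Ω_comp_one_sub (p := fun y => u y = v y) huv) ?_
  exact ⟨by linarith [hx.2], by linarith [hx.1]⟩

theorem IsWeakDeriv.fracIntLeft_linear_comb {α : ℝ} (hα : 0 < α) {f g W Z : ℝ → ℝ}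
    (hf : Continuous f) (hg : Continuous g) (h : IsWeakDeriv Ω 1 (fracIntLeft α f) W)
    (h' : IsWeakDeriv Ω 1 (fracIntLeft α g) Z) (a b : ℝ) :
    IsWeakDeriv Ω 1 (fracIntLeft α fun y => a * f y + b * g y) (fun x => a * W x + b * Z x) :=
  (h.linear_comb h' a b).congr_ae (Filter.Eventually.of_forall fun x =>
    (FracBVP.fracIntLeft_linear_comb hα hf hg a b x).symm) Filter.EventuallyEq.rfl

theorem IsWeakDeriv.fracIntRight_linear_comb {α : ℝ} (hα : 0 < α) {f g W Z : ℝ → ℝ}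
    (hf : Continuous f) (hg : Continuous g) (h : IsWeakDeriv Ω 1 (fracIntRight α f) W)
    (h' : IsWeakDeriv Ω 1 (fracIntRight α g) Z) (a b : ℝ) :
    IsWeakDeriv Ω 1 (fracIntRight α fun y => a * f y + b * g y) (fun x => a * W x + b * Z x) := by
  refine (h.linear_comb h' a b).congr_ae (Filter.Eventually.of_forall fun x => ?_)
    Filter.EventuallyEq.rfl
  simp only [fracIntRight_eq_fracIntLeft]
  exact (FracBVP.fracIntLeft_linear_comb hα (by fun_prop) (by fun_prop) a b (1 - x)).symm

theorem IsEnergyFun.comp_one_sub {β : ℝ} {f : ℝ → ℝ} (h : IsEnergyFun β f) :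
    IsEnergyFun β fun x => f (1 - x) := by
  refine ⟨h.continuous.comp (continuous_const.sub continuous_id), fun x hx => h.eq_zero _ ?_, ?_⟩
  · intro h'
    refine hx ?_
    rw [← preimage_one_sub_Ω]
    exact h'
  · have := slobodeckijSq_comp_sub_left Set.univ β 1 f
    rw [Set.preimage_univ] at this
    rw [this]
    exact h.lt_top

theorem exists_isWeakDeriv_fracIntRight {β : ℝ} (h0 : 0 < β) (h1 : β < 1) :
    ∃ C : ℝ, 0 < C ∧ ∀ f : ℝ → ℝ, IsEnergyFun β f →
      ∃ W : ℝ → ℝ, MemLp W 2 (volume.restrict Ω) ∧ IsWeakDeriv Ω 1 (fracIntRight (1 - β) f) W ∧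
        eLpNorm W 2 (volume.restrict Ω) ^ 2 ≤
          ENNReal.ofReal C * slobodeckijSq Set.univ β f := by
  obtain ⟨C, hC, H⟩ := exists_isWeakDeriv_fracIntLeft h0 h1
  refine ⟨C, hC, fun f hf => ?_⟩
  obtain ⟨W, hW, hd, hb⟩ := H _ hf.comp_one_sub
  have hmp := (Measure.measurePreserving_sub_left volume (1 : ℝ)).restrict_preimage_emb
    (measurableEmbedding_subLeft (1 : ℝ)) Ω
  rw [preimage_one_sub_Ω] at hmp
  refine ⟨fun x => -W (1 - x), (hW.comp_measurePreserving hmp).neg,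
    isWeakDeriv_fracIntRight_of_left hd, ?_⟩
  have e1 : eLpNorm (fun x => -W (1 - x)) 2 (volume.restrict Ω) = eLpNorm W 2 (volume.restrict Ω) :=
    (eLpNorm_neg (fun x => W (1 - x)) 2 _).trans (eLpNorm_comp_measurePreserving hW.1 hmp)
  have e2 := slobodeckijSq_comp_sub_left Set.univ β 1 f
  rw [Set.preimage_univ] at e2
  rw [e1]
  rwa [e2] at hb

/-! ### Functions with an integrable weak derivative are primitives -/

theorem intervalIntegral_indicator_Ω (W : ℝ → ℝ) {x : ℝ} (hx : x ∈ Ω) :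
    ∫ y in (0 : ℝ)..x, W y = ∫ y in Set.Iio x, Ω.indicator W y := by
  rw [intervalIntegral.integral_of_le hx.1.le, integral_Ioc_eq_integral_Ioo,
    setIntegral_indicator measurableSet_Ioo]
  congr 2
  ext y
  simp only [Set.mem_Ioo, Set.mem_inter_iff, Set.mem_Iio]
  constructor
  · rintro ⟨h1, h2⟩
    exact ⟨h2, h1, h2.trans hx.2⟩
  · rintro ⟨h1, h2, _⟩
    exact ⟨h2, h1⟩

/-- Fubini on the triangle y < x: the inner integral of φ' over (y,∞) is -φ(y). -/
theorem isWeakDeriv_primitive {W : ℝ → ℝ} (hW : IntegrableOn W Ω) :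
    IsWeakDeriv Ω 1 (fun x => ∫ y in (0 : ℝ)..x, W y) W := by
  set V : ℝ → ℝ := Ω.indicator W with hV
  have hVi : Integrable V := (integrable_indicator_iff measurableSet_Ioo).2 hW
  set P : ℝ → ℝ := fun x => ∫ y in Set.Iio x, V y with hP
  have hcont : Continuous fun x => ∫ y in (0 : ℝ)..x, V y :=
    intervalIntegral.continuous_primitive (fun a b => hVi.intervalIntegrable) 0
  have hWV : ∀ x ∈ Ω, ∫ y in (0 : ℝ)..x, W y = ∫ y in (0 : ℝ)..x, V y := by
    intro x hx
    refine intervalIntegral.integral_congr_ae (Filter.Eventually.of_forall fun y hy => ?_)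
    rw [Set.uIoc_of_le hx.1.le] at hy
    exact (Set.indicator_of_mem (show y ∈ Ω from ⟨hy.1, hy.2.trans_lt hx.2⟩) W).symm
  refine ⟨?_, hW.locallyIntegrableOn, fun φ h1 h2 h3 => ?_⟩
  · refine LocallyIntegrableOn.congr_ae (hcont.locallyIntegrable.locallyIntegrableOn Ω)
      ((ae_restrict_iff' measurableSet_Ioo).2 (Filter.Eventually.of_forall fun x hx => ?_))
    exact (hWV x hx).symm
  have hd : Continuous (deriv φ) := (contDiff_infty_iff_deriv.1 h1).2.continuous
  have hdi : Integrable (deriv φ) := hd.integrable_of_hasCompactSupport h2.deriv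
  have e1 : ∫ x in Ω, (∫ y in (0 : ℝ)..x, W y) * iteratedDeriv 1 φ x = ∫ x, P x * deriv φ x := by
    refine Eq.trans ?_ (setIntegral_eq_integral_of_forall_compl_eq_zero (s := Ω) ?_)
    · refine setIntegral_congr_fun measurableSet_Ioo fun x hx => ?_
      simp only [iteratedDeriv_one, intervalIntegral_indicator_Ω W hx, hP, hV]
    · intro x hx
      have : deriv φ x = 0 := by
        by_contra h
        exact hx (h3 (support_deriv_subset h))
      simp [this]
  have e2 : ∫ x, P x * deriv φ x =
      ∫ x, ∫ y, {p : ℝ × ℝ | p.2 < p.1}.indicator (fun p => V p.2 * deriv φ p.1) (x, y) := by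
    refine integral_congr_ae (Filter.Eventually.of_forall fun x => ?_)
    simp only [hP]
    rw [← integral_indicator measurableSet_Iio, ← integral_mul_const]
    refine integral_congr_ae (Filter.Eventually.of_forall fun y => ?_)
    by_cases hy : y < x <;> simp [Set.indicator, hy]
  have hInt : Integrable (Function.uncurry fun x y : ℝ =>
      {p : ℝ × ℝ | p.2 < p.1}.indicator (fun p => V p.2 * deriv φ p.1) (x, y))
      (volume.prod volume) := by
    have : Integrable (fun p : ℝ × ℝ => deriv φ p.1 * V p.2) (volume.prod volume) :=
      hdi.mul_prod hVi
    have h4 := this.indicator (measurableSet_lt measurable_snd measurable_fst)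
    refine h4.congr (Filter.Eventually.of_forall fun p => ?_)
    simp only [Function.uncurry, Set.indicator, mul_comm]
  have e3 : ∫ x in Ω, W x * φ x = ∫ y, V y * φ y := by
    rw [← integral_indicator measurableSet_Ioo]
    refine integral_congr_ae (Filter.Eventually.of_forall fun y => ?_)
    by_cases hy : y ∈ Ω <;> simp [hV, Set.indicator, hy]
  rw [e1, e2, integral_integral_swap hInt, e3, pow_one, neg_one_mul, ← integral_neg]
  refine integral_congr_ae (Filter.Eventually.of_forall fun y => ?_)
  have e4 := HasCompactSupport.integral_Ioi_deriv_eq (h1.of_le (by simp)) h2 y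
  have e5 : ∀ x, {p : ℝ × ℝ | p.2 < p.1}.indicator (fun p => V p.2 * deriv φ p.1) (x, y) =
      V y * (Set.Ioi y).indicator (deriv φ) x := by
    intro x
    by_cases hx : y < x <;> simp [Set.indicator, hx]
  simp_rw [e5]
  rw [integral_const_mul, integral_indicator measurableSet_Ioi, e4]
  ring

theorem exists_Icc_of_isCompact_subset_Ω {K : Set ℝ} (hK : IsCompact K) (hne : K.Nonempty)
    (hs : K ⊆ Ω) : ∃ a b : ℝ, 0 < a ∧ a ≤ b ∧ b < 1 ∧ K ⊆ Set.Icc a b := by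
  obtain ⟨a, ha⟩ := hK.exists_isLeast hne
  obtain ⟨b, hb⟩ := hK.exists_isGreatest hne
  exact ⟨a, b, (hs ha.1).1, ha.2 hb.1, (hs hb.1).2, fun x hx => ⟨ha.2 hx, hb.2 hx⟩⟩

/-- A test function of vanishing integral is the derivative of a test function. -/
theorem exists_testFunction_deriv_eq {η : ℝ → ℝ} (h1 : ContDiff ℝ ((⊤ : ℕ∞) : WithTop ℕ∞) η)
    {a b : ℝ} (ha : 0 < a) (hb : b < 1) (hsup : ∀ x ∉ Set.Icc a b, η x = 0)
    (hInt : ∫ x in a..b, η x = 0) :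
    ∃ χ : ℝ → ℝ, ContDiff ℝ ((⊤ : ℕ∞) : WithTop ℕ∞) χ ∧ HasCompactSupport χ ∧ tsupport χ ⊆ Ω ∧
      deriv χ = η := by
  set χ : ℝ → ℝ := fun x => ∫ y in a..x, η y with hχ
  have hd : ∀ x, HasDerivAt χ (η x) x := fun x =>
    intervalIntegral.integral_hasDerivAt_right (h1.continuous.intervalIntegrable _ _)
      (h1.continuous.stronglyMeasurableAtFilter _ _) h1.continuous.continuousAt
  have hderiv : deriv χ = η := funext fun x => (hd x).deriv
  have hzero : ∀ x ∉ Set.Icc a b, χ x = 0 := by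
    intro x hx
    rcases lt_or_ge x a with h | h
    · have : ∫ y in x..a, η y = 0 := by
        rw [intervalIntegral.integral_of_le h.le, integral_Ioc_eq_integral_Ioo]
        refine setIntegral_eq_zero_of_forall_eq_zero fun y hy => hsup y fun hy' => ?_
        exact absurd hy.2 (not_lt.2 hy'.1)
      rw [hχ]
      simp only
      rw [intervalIntegral.integral_symm, this, neg_zero]
    · have hbx : b < x := by
        by_contra h'
        exact hx ⟨h, not_lt.1 h'⟩
      have : ∫ y in b..x, η y = 0 := by
        rw [intervalIntegral.integral_of_le hbx.le]
        refine setIntegral_eq_zero_of_forall_eq_zero fun y hy => hsup y fun hy' => ?_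
        exact absurd hy.1 (not_lt.2 hy'.2)
      rw [hχ]
      simp only
      rw [← intervalIntegral.integral_add_adjacent_intervals (h1.continuous.intervalIntegrable a b)
        (h1.continuous.intervalIntegrable b x), hInt, this, add_zero]
  have hsub : tsupport χ ⊆ Set.Icc a b :=
    closure_minimal (fun x hx => by by_contra h; exact hx (hzero x h)) isClosed_Icc
  refine ⟨χ, contDiff_infty_iff_deriv.2 ⟨fun x => (hd x).differentiableAt, by rwa [hderiv]⟩,
    HasCompactSupport.intro isCompact_Icc hzero, fun x hx => ?_, hderiv⟩
  have := hsub hx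
  exact ⟨ha.trans_le this.1, this.2.trans_lt hb⟩

/-- A function on `(0,1)` with vanishing weak derivative is constant. -/
theorem IsWeakDeriv.exists_ae_eq_const {H : ℝ → ℝ} (hH : IsWeakDeriv Ω 1 H 0) :
    ∃ c : ℝ, ∀ᵐ x ∂volume.restrict Ω, H x = c := by
  obtain ⟨ψ, p1, p2, p3, p4⟩ : ∃ ψ : ℝ → ℝ, ContDiff ℝ ((⊤ : ℕ∞) : WithTop ℕ∞) ψ ∧
      HasCompactSupport ψ ∧ tsupport ψ ⊆ Ω ∧ ∫ x, ψ x = 1 := by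
    let B : ContDiffBump (1 / 2 : ℝ) := ⟨1 / 8, 1 / 4, by norm_num, by norm_num⟩
    refine ⟨B.normed volume, B.contDiff_normed, B.hasCompactSupport_normed, ?_, B.integral_normed⟩
    rw [B.tsupport_normed_eq, Real.closedBall_eq_Icc]
    intro x hx
    have h1 := hx.1
    have h2 := hx.2
    simp only [B] at h1 h2
    constructor <;> linarith
  have fullint : ∀ {φ : ℝ → ℝ} {a b : ℝ}, a ≤ b → (∀ x ∉ Set.Icc a b, φ x = 0) →
      ∫ x in a..b, φ x = ∫ x, φ x := by
    intro φ a b hab h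
    rw [intervalIntegral.integral_of_le hab, ← integral_Icc_eq_integral_Ioc,
      setIntegral_eq_integral_of_forall_compl_eq_zero h]
  -- For a test function φ, the combination φ - (∫φ)ψ has integral zero and is therefore the
  -- derivative of a test function. Hence ∫ Hφ = (∫φ)(∫ Hψ), which identifies the constant.
  set c : ℝ := ∫ x in Ω, H x * ψ x with hc
  refine ⟨c, ?_⟩
  have hloc : LocallyIntegrableOn (fun x => H x - c) Ω :=
    hH.1.sub (continuous_const.locallyIntegrable.locallyIntegrableOn Ω)
  have key := (isOpen_Ioo : IsOpen Ω).ae_eq_zero_of_integral_contDiff_smul_eq_zero hloc ?_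
  · refine (ae_restrict_iff' measurableSet_Ioo).2 ?_
    filter_upwards [key] with x hx hxI
    linarith [hx hxI]
  intro φ h1 h2 h3
  have hψne : ∃ x, ψ x ≠ 0 := by
    by_contra h
    push Not at h
    simp [h] at p4
  obtain ⟨x0, hx0⟩ := hψne
  obtain ⟨a, b, ha, hab, hb, hK⟩ := exists_Icc_of_isCompact_subset_Ω (K := tsupport φ ∪ tsupport ψ)
    (h2.union p2) ⟨x0, Or.inr (subset_tsupport ψ hx0)⟩ (Set.union_subset h3 p3)
  have zφ : ∀ x ∉ Set.Icc a b, φ x = 0 := fun x hx => by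
    by_contra h
    exact hx (hK (Or.inl (subset_tsupport φ h)))
  have zψ : ∀ x ∉ Set.Icc a b, ψ x = 0 := fun x hx => by
    by_contra h
    exact hx (hK (Or.inr (subset_tsupport ψ h)))
  set m : ℝ := ∫ x, φ x with hm
  obtain ⟨χ, c1, c2, c3, c4⟩ := exists_testFunction_deriv_eq (η := fun x => φ x - m * ψ x)
    (h1.sub (contDiff_const.mul p1)) ha hb (fun x hx => by simp [zφ x hx, zψ x hx]) (by
      rw [intervalIntegral.integral_sub (h1.continuous.intervalIntegrable _ _)
        ((p1.continuous.intervalIntegrable _ _).const_mul m), intervalIntegral.integral_const_mul,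
        fullint hab zφ, fullint hab zψ, p4, mul_one, sub_self])
  have e1 := hH.2.2 χ c1 c2 c3
  simp only [iteratedDeriv_one, c4, Pi.zero_apply, zero_mul, integral_zero, mul_zero] at e1
  have i1 := integrableOn_mul_of_tsupport_subset hH.1 h1.continuous h2 h3 fun x hx _ => hx
  have i2 := integrableOn_mul_of_tsupport_subset hH.1 p1.continuous p2 p3 fun x hx _ => hx
  have e2 : ∫ x in Ω, H x * φ x = m * c := by
    have : ∀ x, H x * (φ x - m * ψ x) = H x * φ x - m * (H x * ψ x) := fun x => by ring
    simp_rw [this] at e1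
    rw [integral_sub i1 (i2.const_mul m), integral_const_mul] at e1
    linarith
  have e3 : ∫ x in Ω, φ x = m :=
    setIntegral_eq_integral_of_forall_compl_eq_zero fun x hx => by
      by_contra h
      exact hx (h3 (subset_tsupport φ h))
  have hφi : IntegrableOn φ Ω :=
    (h1.continuous.integrable_of_hasCompactSupport h2).integrableOn
  rw [← setIntegral_eq_integral_of_forall_compl_eq_zero (s := Ω)]
  · have : ∀ x, φ x • (H x - c) = H x * φ x - c * φ x := fun x => by
      rw [smul_eq_mul]; ring
    simp_rw [this]
    rw [integral_sub i1 (hφi.const_mul c), integral_const_mul, e2, e3]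
    ring
  · intro x hx
    have : φ x = 0 := by
      by_contra h
      exact hx (h3 (subset_tsupport φ h))
    simp [this]

/-- A function with an integrable weak derivative is a primitive of it, up to a constant. -/
theorem IsWeakDeriv.exists_ae_eq_primitive {F W : ℝ → ℝ} (h : IsWeakDeriv Ω 1 F W)
    (hW : IntegrableOn W Ω) :
    ∃ c : ℝ, ∀ᵐ x ∂volume.restrict Ω, F x = c + ∫ y in (0 : ℝ)..x, W y := by
  have h1 := h.linear_comb (isWeakDeriv_primitive hW) 1 (-1)
  have h2 : IsWeakDeriv Ω 1 (fun x => 1 * F x + -1 * ∫ y in (0 : ℝ)..x, W y) 0 :=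
    h1.congr_ae Filter.EventuallyEq.rfl (Filter.Eventually.of_forall fun x => by simp)
  obtain ⟨c, hc⟩ := h2.exists_ae_eq_const
  refine ⟨c, ?_⟩
  filter_upwards [hc] with x hx
  linarith

/-! ### The right fractional derivative of `(1-x)^{s-1}` -/

theorem integral_sub_rpow_mul_rpow_scale (a b : ℝ) {t : ℝ} (ht : 0 < t) :
    ∫ r in (0 : ℝ)..t, (t - r) ^ (-a) * r ^ (-b) =
      t ^ (1 - a - b) * ∫ r in (0 : ℝ)..1, (1 - r) ^ (-a) * r ^ (-b) := by
  have h := intervalIntegral.mul_integral_comp_mul_left (a := 0) (b := 1) t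
    (f := fun r => (t - r) ^ (-a) * r ^ (-b))
  rw [mul_zero, mul_one] at h
  rw [← h, ← intervalIntegral.integral_const_mul, ← intervalIntegral.integral_const_mul]
  refine intervalIntegral.integral_congr fun r hr => ?_
  rw [Set.uIcc_of_le zero_le_one] at hr
  rw [show t - t * r = t * (1 - r) by ring, Real.mul_rpow ht.le (by linarith [hr.2]),
    Real.mul_rpow ht.le hr.1, show 1 - a - b = 1 + -a + -b by ring, Real.rpow_add ht,
    Real.rpow_add ht, Real.rpow_one]
  ring

theorem isWeakDeriv_of_hasDerivAt {G G' : ℝ → ℝ} (hc : ContinuousOn G (Set.Icc 0 1))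
    (hd : ∀ x ∈ Ω, HasDerivAt G (G' x) x) (hi : IntervalIntegrable G' volume 0 1) :
    IsWeakDeriv Ω 1 G G' := by
  have hio : IntegrableOn G' Ω :=
    (intervalIntegrable_iff_integrableOn_Ioo_of_le zero_le_one).1 hi
  refine ⟨?_, hio.locallyIntegrableOn, fun φ h1 h2 h3 => ?_⟩
  · exact ((hc.integrableOn_Icc).mono_set Set.Ioo_subset_Icc_self).locallyIntegrableOn
  have hdφ : Continuous (deriv φ) := (contDiff_infty_iff_deriv.1 h1).2.continuous
  have hφ0 : ∀ x ∉ Ω, φ x = 0 := fun x hx => by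
    by_contra h
    exact hx (h3 (subset_tsupport φ h))
  have i1 : IntervalIntegrable (fun x => G' x * φ x) volume 0 1 :=
    hi.mul_continuousOn h1.continuous.continuousOn
  have i2 : IntervalIntegrable (fun x => G x * deriv φ x) volume 0 1 := by
    refine ContinuousOn.intervalIntegrable ?_
    rw [Set.uIcc_of_le zero_le_one]
    exact hc.mul hdφ.continuousOn
  have key := intervalIntegral.integral_eq_sub_of_hasDerivAt_of_le zero_le_one
    (f := fun x => G x * φ x) (hc.mul h1.continuous.continuousOn)
    (fun x hx => (hd x hx).mul ((h1.differentiable (by simp)) x).hasDerivAt) (i1.add i2)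
  rw [intervalIntegral.integral_add i1 i2, hφ0 1 (by simp), hφ0 0 (by simp), mul_zero, mul_zero,
    sub_self, intervalIntegral.integral_of_le zero_le_one,
    intervalIntegral.integral_of_le zero_le_one, integral_Ioc_eq_integral_Ioo,
    integral_Ioc_eq_integral_Ioo] at key
  simp only [iteratedDeriv_one, pow_one]
  linarith

/-- After reflection, homogeneity shows that the integral of order 1-β of y^{2β-1} is a multiple of
y^β. Only the exponent β-1 of the derivative matters later, not the factor. -/
theorem exists_isWeakDeriv_fracIntRight_one_sub_rpow {β : ℝ} (h0 : 0 < β) :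
    ∃ c : ℝ, IsWeakDeriv Ω 1 (fracIntRight (1 - β) fun x => (1 - x) ^ (2 * β - 1))
      (fun x => c * (1 - x) ^ (β - 1)) := by
  set k : ℝ := 1 / Real.Gamma (1 - β) *
    ∫ r in (0 : ℝ)..1, (1 - r) ^ (-β) * r ^ (-(1 - 2 * β)) with hk
  have hw : IsWeakDeriv Ω 1 (fun x => k * x ^ β) (fun x => k * (β * x ^ (β - 1))) := by
    refine isWeakDeriv_of_hasDerivAt ?_ (fun x hx => ?_) ?_
    · exact (continuous_const.mul (Real.continuous_rpow_const h0.le)).continuousOn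
    · exact (Real.hasDerivAt_rpow_const (Or.inl hx.1.ne')).const_mul k
    · exact ((intervalIntegral.intervalIntegrable_rpow' (by linarith)).const_mul β).const_mul k
  refine ⟨-(k * β), ?_⟩
  have hl : IsWeakDeriv Ω 1 (fracIntLeft (1 - β) fun y => (1 - (1 - y)) ^ (2 * β - 1))
      (fun x => k * (β * x ^ (β - 1))) := by
    refine hw.congr_ae ((ae_restrict_iff' measurableSet_Ioo).2
      (Filter.Eventually.of_forall fun x hx => ?_)) Filter.EventuallyEq.rfl
    simp only [sub_sub_cancel, fracIntLeft]
    rw [show 1 - β - 1 = -β by ring, show 2 * β - 1 = -(1 - 2 * β) by ring,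
      integral_sub_rpow_mul_rpow_scale β (1 - 2 * β) hx.1, hk,
      show 1 - β - (1 - 2 * β) = β by ring]
    ring
  refine (isWeakDeriv_fracIntRight_of_left hl).congr_ae Filter.EventuallyEq.rfl
    (Filter.Eventually.of_forall fun x => ?_)
  simp only
  ring

/-! ### The fractional derivative of an energy function is orthogonal to `(1-x)^{β-1}` -/

/-- The semigroup law of fractional integrals, with a Beta integral as constant. From 0 < y < z < x
≤ 1 both arguments stay in (0,1), so the truncation is not felt. -/
theorem integral_rieszKernel_mul_rieszKernel {a b x y : ℝ} (hx : x ≤ 1) (hy : 0 < y) :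
    ∫ z, rieszKernel a (x - z) * rieszKernel b (z - y) =
      (Set.Iio x).indicator (fun y => (x - y) ^ (1 - a - b)) y *
        ∫ r in (0 : ℝ)..1, (1 - r) ^ (-a) * r ^ (-b) := by
  have hshift : ∫ z, rieszKernel a (x - z) * rieszKernel b (z - y) =
      ∫ r, rieszKernel a ((x - y) - r) * rieszKernel b r := by
    rw [← integral_add_left_eq_self (fun z => rieszKernel a (x - z) * rieszKernel b (z - y)) y]
    refine integral_congr_ae (Filter.Eventually.of_forall fun r => ?_)
    simp only
    rw [show x - (y + r) = x - y - r by ring, add_sub_cancel_left]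
  rw [hshift]
  by_cases hyx : y < x
  · have ht : 0 < x - y := by linarith
    rw [Set.indicator_of_mem (show y ∈ Set.Iio x from hyx),
      ← integral_sub_rpow_mul_rpow_scale a b ht, intervalIntegral.integral_of_le ht.le,
      integral_Ioc_eq_integral_Ioo, ← integral_indicator measurableSet_Ioo]
    refine integral_congr_ae (Filter.Eventually.of_forall fun r => ?_)
    by_cases hr : r ∈ Set.Ioo 0 (x - y)
    · have h1 : x - y - r ∈ Set.Ioo (0 : ℝ) 1 := ⟨by linarith [hr.2], by linarith [hr.1]⟩
      have h2 : r ∈ Set.Ioo (0 : ℝ) 1 := ⟨hr.1, by linarith [hr.2]⟩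
      simp only [rieszKernel, Set.indicator_of_mem h1, Set.indicator_of_mem h2,
        Set.indicator_of_mem hr]
    · simp only [Set.indicator_of_notMem hr, rieszKernel]
      by_cases hr0 : 0 < r
      · have h1 : x - y - r ∉ Set.Ioo (0 : ℝ) 1 := fun h => hr ⟨hr0, by linarith [h.1]⟩
        rw [Set.indicator_of_notMem h1, zero_mul]
      · have h1 : r ∉ Set.Ioo (0 : ℝ) 1 := fun h => hr0 h.1
        rw [Set.indicator_of_notMem h1, mul_zero]
  · rw [Set.indicator_of_notMem (show y ∉ Set.Iio x from hyx), zero_mul]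
    refine integral_eq_zero_of_ae (Filter.Eventually.of_forall fun r => ?_)
    simp only [rieszKernel, Pi.zero_apply]
    by_cases hr0 : 0 < r
    · have h1 : x - y - r ∉ Set.Ioo (0 : ℝ) 1 := fun h => hyx (by linarith [h.1])
      rw [Set.indicator_of_notMem h1, zero_mul]
    · have h1 : r ∉ Set.Ioo (0 : ℝ) 1 := fun h => hr0 h.1
      rw [Set.indicator_of_notMem h1, mul_zero]

theorem integral_rieszKernel_mul_convolution {a b x : ℝ} (hx : x ≤ 1) {g : ℝ → ℝ}
    (hg : ∀ y ∉ Ω, g y = 0)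
    (hInt : Integrable (fun p : ℝ × ℝ => rieszKernel a (x - p.1) *
      (rieszKernel b (p.1 - p.2) * g p.2)) (volume.prod volume)) :
    ∫ z, rieszKernel a (x - z) * ∫ y, rieszKernel b (z - y) * g y =
      (∫ r in (0 : ℝ)..1, (1 - r) ^ (-a) * r ^ (-b)) *
        ∫ y, (Set.Iio x).indicator (fun y => (x - y) ^ (1 - a - b)) y * g y := by
  simp_rw [← integral_const_mul]
  rw [integral_integral_swap hInt]
  refine integral_congr_ae (Filter.Eventually.of_forall fun y => ?_)
  simp only
  by_cases hy : y ∈ Ω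
  · simp_rw [← mul_assoc]
    rw [integral_mul_const, integral_rieszKernel_mul_rieszKernel hx hy.1]
    ring
  · simp [hg y hy]

theorem integrable_rieszKernel_triple_of_bounded {a b x : ℝ} (ha : a < 1) (hb : b < 1) {g : ℝ → ℝ}
    (hg : Continuous g) {M : ℝ} (hM : ∀ y, |g y| ≤ M) :
    Integrable (fun p : ℝ × ℝ => rieszKernel a (x - p.1) *
      (rieszKernel b (p.1 - p.2) * g p.2)) (volume.prod volume) := by
  have h1 : Integrable fun z => rieszKernel a (x - z) := (integrable_rieszKernel ha).comp_sub_left x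
  have h2 : Integrable fun r => rieszKernel b (-r) := (integrable_rieszKernel hb).comp_neg
  have h3 := (h1.convolution_integrand (ContinuousLinearMap.mul ℝ ℝ) h2).swap
  have h4 : Integrable (fun p : ℝ × ℝ => rieszKernel a (x - p.1) * rieszKernel b (p.1 - p.2))
      (volume.prod volume) := by
    refine h3.congr (Filter.Eventually.of_forall fun p => ?_)
    simp
  have h5 := h4.bdd_mul (f := fun p : ℝ × ℝ => g p.2) (c := M)
    (hg.comp continuous_snd).aestronglyMeasurable
    (Filter.Eventually.of_forall fun p => hM p.2)
  refine h5.congr (Filter.Eventually.of_forall fun p => ?_)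
  simp only
  ring

theorem integrable_rieszKernel_triple_zero {a x : ℝ} (ha : a < 1) {g : ℝ → ℝ}
    (hg : Integrable g) :
    Integrable (fun p : ℝ × ℝ => rieszKernel a (x - p.1) *
      (rieszKernel 0 (p.1 - p.2) * g p.2)) (volume.prod volume) := by
  have h1 : Integrable fun z => rieszKernel a (x - z) := (integrable_rieszKernel ha).comp_sub_left x
  have h2 : Integrable (fun p : ℝ × ℝ => rieszKernel a (x - p.1) * g p.2) (volume.prod volume) :=
    h1.mul_prod hg
  have hm : Measurable (rieszKernel 0) :=
    Measurable.indicator (by fun_prop) measurableSet_Ioo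
  have h5 := h2.bdd_mul (f := fun p : ℝ × ℝ => rieszKernel 0 (p.1 - p.2)) (c := 1)
    (by fun_prop : Measurable fun p : ℝ × ℝ => rieszKernel 0 (p.1 - p.2)).aestronglyMeasurable
    (Filter.Eventually.of_forall fun p => by
      unfold rieszKernel
      by_cases h : p.1 - p.2 ∈ Set.Ioo (0 : ℝ) 1
      · simp [Set.indicator_of_mem h]
      · simp [Set.indicator_of_notMem h])
  refine h5.congr (Filter.Eventually.of_forall fun p => ?_)
  simp only
  ring

theorem IsEnergyFun.exists_bound {β : ℝ} {f : ℝ → ℝ} (h : IsEnergyFun β f) :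
    ∃ M, 0 ≤ M ∧ ∀ x, |f x| ≤ M := by
  obtain ⟨C, hC⟩ := h.continuous.bounded_above_of_compact_support h.hasCompactSupport
  exact ⟨C, (norm_nonneg _).trans (hC 0), hC⟩

theorem abs_fracIntLeft_le {β M : ℝ} (hβ : β < 1) {f : ℝ → ℝ} (hM : ∀ x, |f x| ≤ M) {x : ℝ}
    (hx : 0 < x) :
    |fracIntLeft (1 - β) f x| ≤ 1 / Real.Gamma (1 - β) * (M / (1 - β)) * x ^ (1 - β) := by
  have hb : 0 < 1 - β := by linarith
  have hG := Real.Gamma_pos_of_pos hb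
  have h1 : ‖∫ y in (0 : ℝ)..x, (x - y) ^ (1 - β - 1) * f y‖ ≤
      ∫ y in (0 : ℝ)..x, (x - y) ^ (1 - β - 1) * M := by
    refine intervalIntegral.norm_integral_le_of_norm_le hx.le
      (Filter.Eventually.of_forall fun y hy => ?_)
      (intervalIntegrable_sub_rpow_mul hb continuous_const x)
    have : 0 ≤ (x - y) ^ (1 - β - 1) := Real.rpow_nonneg (by linarith [hy.2]) _
    rw [norm_mul, Real.norm_of_nonneg this]
    exact mul_le_mul_of_nonneg_left (hM y) this
  have h2 : ∫ y in (0 : ℝ)..x, (x - y) ^ (1 - β - 1) * M = M / (1 - β) * x ^ (1 - β) := by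
    rw [intervalIntegral.integral_mul_const,
      intervalIntegral.integral_comp_sub_left (fun y => y ^ (1 - β - 1)) x, sub_self, sub_zero,
      integral_rpow (Or.inl (by linarith)), sub_add_cancel, Real.zero_rpow hb.ne']
    ring
  rw [fracIntLeft, abs_mul, abs_of_pos (by positivity : 0 < 1 / Real.Gamma (1 - β)), mul_assoc]
  exact mul_le_mul_of_nonneg_left (h1.trans_eq h2) (by positivity)

/-- The fractional integral of an energy function is the primitive, vanishing at `0`, of its
fractional derivative. -/
theorem IsEnergyFun.fracIntLeft_ae_eq_primitive {β : ℝ} (hβ : β < 1) {f W : ℝ → ℝ}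
    (hf : IsEnergyFun β f) (hW : IsWeakDeriv Ω 1 (fracIntLeft (1 - β) f) W)
    (hWi : IntegrableOn W Ω) :
    ∀ᵐ x ∂volume.restrict Ω, fracIntLeft (1 - β) f x = ∫ y in (0 : ℝ)..x, W y := by
  obtain ⟨c, hc⟩ := hW.exists_ae_eq_primitive hWi
  obtain ⟨M, hM0, hM⟩ := hf.exists_bound
  have hb : 0 < 1 - β := by linarith
  set A : ℝ := 1 / Real.Gamma (1 - β) * (M / (1 - β)) with hA
  set V : ℝ → ℝ := Ω.indicator W with hV
  have hVi : Integrable V := (integrable_indicator_iff measurableSet_Ioo).2 hWi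
  have hWV : ∀ x ∈ Ω, ∫ y in (0 : ℝ)..x, W y = ∫ y in (0 : ℝ)..x, V y := by
    intro x hx
    refine intervalIntegral.integral_congr_ae (Filter.Eventually.of_forall fun y hy => ?_)
    rw [Set.uIoc_of_le hx.1.le] at hy
    exact (Set.indicator_of_mem (show y ∈ Ω from ⟨hy.1, hy.2.trans_lt hx.2⟩) W).symm
  -- For bounded f the fractional integral is O(x^{1-β}). Thus `q` is a continuous majorant of |c|
  -- that vanishes at 0, which forces the constant of integration to be zero.
  set q : ℝ → ℝ := fun x => A * x ^ (1 - β) + |∫ y in (0 : ℝ)..x, V y| with hq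
  have hqc : Continuous q := by
    have h1 : Continuous fun x => ∫ y in (0 : ℝ)..x, V y :=
      intervalIntegral.continuous_primitive (fun a b => hVi.intervalIntegrable) 0
    exact (continuous_const.mul (Real.continuous_rpow_const hb.le)).add h1.abs
  have hq0 : q 0 = 0 := by simp [hq, Real.zero_rpow hb.ne']
  have hle : ∀ᵐ x, x ∈ Ω → |c| ≤ q x := by
    rw [← ae_restrict_iff' measurableSet_Ioo]
    filter_upwards [hc, ae_restrict_mem measurableSet_Ioo] with x hx hxΩ
    have h1 := abs_fracIntLeft_le hβ hM hxΩ.1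
    rw [hWV x hxΩ] at hx
    have h2 : c = fracIntLeft (1 - β) f x - ∫ y in (0 : ℝ)..x, V y := by linarith
    rw [h2]
    exact (abs_sub _ _).trans (add_le_add_left h1 _)
  have hc0 : c = 0 := by
    by_contra hne
    have hpos : 0 < |c| := abs_pos.2 hne
    have hev : ∀ᶠ x in nhds 0, q x < |c| := by
      have := hqc.tendsto 0
      rw [hq0] at this
      exact this.eventually (gt_mem_nhds hpos)
    obtain ⟨δ, hδ, hball⟩ := Metric.eventually_nhds_iff.1 hev
    obtain ⟨x, hx1, hx2⟩ := (Measure.dense_of_ae hle).exists_between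
      (lt_min hδ one_pos : 0 < min δ 1)
    have h1 := hx1 ⟨hx2.1, hx2.2.trans_le (min_le_right _ _)⟩
    have h2 := hball (y := x) (by
      rw [Real.dist_eq, sub_zero, abs_of_pos hx2.1]
      exact hx2.2.trans_le (min_le_left _ _))
    linarith
  filter_upwards [hc] with x hx
  rw [hx, hc0, zero_add]

/-- Division by a^β reduces the claim to 1 - r ≤ (1 - r)^β with r = δ/a ≤ 1. It supplies the
majorant for the difference quotients in `IsEnergyFun.integral_mul_one_sub_rpow_eq_zero`. -/
theorem rpow_sub_rpow_le_mul {β a δ : ℝ} (h0 : 0 < β) (h1 : β < 1) (ha : 0 < a) (hδ : 0 < δ) :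
    a ^ β - (max (a - δ) 0) ^ β ≤ δ * a ^ (β - 1) := by
  have e1 : δ * a ^ (β - 1) = a ^ β * (δ / a) := by
    rw [Real.rpow_sub_one ha.ne']; ring
  have hp : 0 < a ^ β := Real.rpow_pos_of_pos ha _
  rcases le_total a δ with h | h
  · rw [max_eq_right (by linarith), Real.zero_rpow h0.ne', sub_zero, e1]
    have : 1 ≤ δ / a := (one_le_div ha).2 h
    nlinarith
  · rw [max_eq_left (by linarith), e1]
    have e2 : a - δ = a * (1 - δ / a) := by field_simp
    have hd1 : 0 ≤ 1 - δ / a := by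
      rw [sub_nonneg, div_le_one ha]; exact h
    have hd2 : 1 - δ / a ≤ 1 := by
      have : 0 < δ / a := by positivity
      linarith
    have h3 : 1 - δ / a ≤ (1 - δ / a) ^ β := by
      rcases hd1.eq_or_lt with h4 | h4
      · rw [← h4, Real.zero_rpow h0.ne']
      · have := Real.rpow_le_rpow_of_exponent_ge h4 hd2 h1.le
        rwa [Real.rpow_one] at this
    rw [e2, Real.mul_rpow ha.le hd1]
    nlinarith

/-- Apply the integral of order β to both sides of I^{1-β} f = I^1 W. The semigroup law yields a
multiple of the primitive of f on one side and of ∫ (x-y)^β W on the other. The kernel with exponent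
0 is the indicator of (0,1) and stands for I^1. -/
theorem IsEnergyFun.integral_indicator_rpow_mul_eq {β : ℝ} (h0 : 0 < β) (h1 : β < 1) {f W : ℝ → ℝ}
    (hf : IsEnergyFun β f) (hW : IsWeakDeriv Ω 1 (fracIntLeft (1 - β) f) W)
    (hWi : IntegrableOn W Ω) :
    ∃ K : ℝ, ∀ x ≤ 1, ∫ y, (Set.Iio x).indicator (fun y => (x - y) ^ β) y * Ω.indicator W y =
      K * ∫ y in Set.Iio x, f y := by
  set V : ℝ → ℝ := Ω.indicator W with hV
  have hVi : Integrable V := (integrable_indicator_iff measurableSet_Ioo).2 hWi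
  have hV0 : ∀ y ∉ Ω, V y = 0 := fun y hy => Set.indicator_of_notMem hy _
  obtain ⟨M, hM0, hM⟩ := hf.exists_bound
  have hG := Real.Gamma_pos_of_pos (by linarith : 0 < 1 - β)
  set G := Real.Gamma (1 - β) with hGdef
  set B1 : ℝ := ∫ r in (0 : ℝ)..1, (1 - r) ^ (-(1 - β)) * r ^ (-(0 : ℝ)) with hB1
  set B2 : ℝ := ∫ r in (0 : ℝ)..1, (1 - r) ^ (-(1 - β)) * r ^ (-β) with hB2
  have hB1v : B1 = 1 / β := by
    have e1 : B1 = ∫ r in (0 : ℝ)..1, (1 - r) ^ (β - 1) := by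
      rw [hB1]
      refine intervalIntegral.integral_congr fun r _ => ?_
      simp
    rw [e1, intervalIntegral.integral_comp_sub_left (fun y => y ^ (β - 1)) 1, sub_self, sub_zero,
      integral_rpow (Or.inl (by linarith)), sub_add_cancel, Real.zero_rpow h0.ne', Real.one_rpow,
      sub_zero]
  refine ⟨β * (B2 / G), fun x hx => ?_⟩
  have e1 := integral_rieszKernel_mul_convolution (a := 1 - β) (b := 0) hx hV0
    (integrable_rieszKernel_triple_zero (by linarith) hVi)
  have e2 := integral_rieszKernel_mul_convolution (a := 1 - β) (b := β) hx hf.eq_zero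
    (integrable_rieszKernel_triple_of_bounded (by linarith) h1 hf.continuous hM)
  have hprim := hf.fracIntLeft_ae_eq_primitive h1 hW hWi
  rw [ae_restrict_iff' measurableSet_Ioo] at hprim
  have hconv : ∀ᵐ z : ℝ, z < 1 → ∫ y, rieszKernel β (z - y) * f y =
      G * ∫ y, rieszKernel 0 (z - y) * V y := by
    filter_upwards [hprim] with z hz hz1
    by_cases hz0 : 0 < z
    · have hzΩ : z ∈ Ω := ⟨hz0, hz1⟩
      have h3 := hz hzΩ
      have h4 : ∫ y, rieszKernel β (z - y) * f y = ∫ y, rieszKernel β y * f (z - y) := by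
        rw [← integral_sub_left_eq_self (fun y => rieszKernel β y * f (z - y)) volume z]
        simp
      have h5 : ∫ y, rieszKernel 0 (z - y) * V y = ∫ y in (0 : ℝ)..z, W y := by
        rw [intervalIntegral_indicator_Ω W hzΩ, ← integral_indicator measurableSet_Iio]
        refine integral_congr_ae (Filter.Eventually.of_forall fun y => ?_)
        simp only [rieszKernel]
        by_cases hy : y ∈ Ω
        · by_cases hyz : y < z
          · have h6 : z - y ∈ Set.Ioo (0 : ℝ) 1 := ⟨by linarith, by linarith [hy.1]⟩
            rw [Set.indicator_of_mem h6, Set.indicator_of_mem (show y ∈ Set.Iio z from hyz),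
              neg_zero, Real.rpow_zero, one_mul]
          · have h6 : z - y ∉ Set.Ioo (0 : ℝ) 1 := fun h => hyz (by linarith [h.1])
            rw [Set.indicator_of_notMem h6, Set.indicator_of_notMem
              (show y ∉ Set.Iio z from hyz), zero_mul]
        · have h7 := hV0 y hy
          simp only [Set.indicator_apply, ← hV, h7, mul_zero, ite_self]
      rw [h4, h5, ← h3, fracIntLeft_eq hf.eq_zero hzΩ, ← hGdef]
      field_simp
    · have h6 : ∀ (b : ℝ) (g : ℝ → ℝ), (∀ y ∉ Ω, g y = 0) →
          ∫ y, rieszKernel b (z - y) * g y = 0 := by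
        intro b g hg
        refine integral_eq_zero_of_ae (Filter.Eventually.of_forall fun y => ?_)
        simp only [rieszKernel, Pi.zero_apply]
        by_cases hy : y ∈ Ω
        · have : z - y ∉ Set.Ioo (0 : ℝ) 1 := fun h => hz0 (by linarith [h.1, hy.1])
          rw [Set.indicator_of_notMem this, zero_mul]
        · rw [hg y hy, mul_zero]
      rw [h6 β f hf.eq_zero, h6 0 V hV0, mul_zero]
  have e3 : ∫ z, rieszKernel (1 - β) (x - z) * ∫ y, rieszKernel β (z - y) * f y =
      G * ∫ z, rieszKernel (1 - β) (x - z) * ∫ y, rieszKernel 0 (z - y) * V y := by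
    rw [← integral_const_mul]
    refine integral_congr_ae ?_
    filter_upwards [hconv] with z hz
    by_cases hzx : z < x
    · rw [hz (hzx.trans_le hx)]
      ring
    · have : x - z ∉ Set.Ioo (0 : ℝ) 1 := fun h => hzx (by linarith [h.1])
      simp only [rieszKernel, Set.indicator_of_notMem this, zero_mul, mul_zero]
  rw [e1, e2, show 1 - (1 - β) - 0 = β by ring, show 1 - (1 - β) - β = 0 by ring, ← hB1, ← hB2,
    hB1v] at e3
  have e4 : ∫ y, (Set.Iio x).indicator (fun y => (x - y) ^ (0 : ℝ)) y * f y =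
      ∫ y in Set.Iio x, f y := by
    rw [← integral_indicator measurableSet_Iio]
    refine integral_congr_ae (Filter.Eventually.of_forall fun y => ?_)
    by_cases hy : y < x <;> simp [Set.indicator, hy]
  rw [e4] at e3
  have h8 : G ≠ 0 := hG.ne'
  field_simp at e3 ⊢
  linarith

/-- The fractional derivative of an energy function is orthogonal to `(1-x)^{β-1}`:
this is `f(1) = 0`. -/
theorem IsEnergyFun.integral_mul_one_sub_rpow_eq_zero {β : ℝ} (h0 : 1 / 2 < β) (h1 : β < 1)
    {f W : ℝ → ℝ} (hf : IsEnergyFun β f) (hW : IsWeakDeriv Ω 1 (fracIntLeft (1 - β) f) W)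
    (hW2 : MemLp W 2 (volume.restrict Ω)) :
    ∫ y in Ω, W y * (1 - y) ^ (β - 1) = 0 := by
  have hβ : 0 < β := by linarith
  have hWi : IntegrableOn W Ω := hW2.integrable (by norm_num)
  obtain ⟨K, hK⟩ := hf.integral_indicator_rpow_mul_eq hβ h1 hW hWi
  have hk2 : MemLp (fun y : ℝ => (1 - y) ^ (β - 1)) 2 (volume.restrict Ω) := by
    rw [memLp_two_iff_integrable_sq (by fun_prop : Measurable fun y : ℝ =>
      (1 - y) ^ (β - 1)).aestronglyMeasurable]
    have := (intervalIntegral.intervalIntegrable_rpow' (a := 1) (b := 0) (r := 2 * (β - 1))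
      (by linarith)).comp_sub_left 1
    simp only [sub_self, sub_zero] at this
    rw [intervalIntegrable_iff_integrableOn_Ioo_of_le zero_le_one] at this
    refine (integrableOn_congr_fun (fun y hy => ?_) measurableSet_Ioo).1 this
    rw [← Real.rpow_natCast, ← Real.rpow_mul (by linarith [hy.2] : 0 ≤ 1 - y)]
    congr 1
    push_cast
    ring
  have hprod : IntegrableOn (fun y => W y * (1 - y) ^ (β - 1)) Ω := hW2.integrable_mul hk2
  -- The identity of `IsEnergyFun.integral_indicator_rpow_mul_eq` is differentiated at x = 1 along 1
  -- - δ n. One side tends to β ∫ W (1-y)^{β-1} by dominated convergence, as (1-y)^{β-1} is in L²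
  -- for β > 1/2; the other tends to K f(1) = 0.
  set δ : ℕ → ℝ := fun n => 1 / ((n : ℝ) + 1) with hδ
  have hδ0 : ∀ n, 0 < δ n := fun n => by positivity
  have hδlim : Filter.Tendsto δ Filter.atTop (nhds 0) := tendsto_one_div_add_atTop_nhds_zero_nat
  set Q : ℕ → ℝ → ℝ := fun n y =>
    W y * (((1 - y) ^ β - (max (1 - y - δ n) 0) ^ β) / δ n) with hQ
  have hQlim : Filter.Tendsto (fun n => ∫ y in Ω, Q n y) Filter.atTop
      (nhds (∫ y in Ω, W y * (β * (1 - y) ^ (β - 1)))) := by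
    refine tendsto_integral_of_dominated_convergence
      (fun y => |W y * (1 - y) ^ (β - 1)|) (fun n => ?_) hprod.abs (fun n => ?_) ?_
    · refine hW2.1.mul (Measurable.aestronglyMeasurable ?_)
      fun_prop
    · filter_upwards [ae_restrict_mem measurableSet_Ioo] with y hy
      have ha : 0 < 1 - y := by linarith [hy.2]
      have h3 := rpow_sub_rpow_le_mul hβ h1 ha (hδ0 n)
      have h4 : 0 ≤ (1 - y) ^ β - (max (1 - y - δ n) 0) ^ β := by
        rw [sub_nonneg]
        exact Real.rpow_le_rpow (le_max_right _ _) (max_le (by linarith [hδ0 n]) ha.le) hβ.le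
      rw [hQ, norm_mul, abs_mul, Real.norm_eq_abs]
      refine mul_le_mul_of_nonneg_left ?_ (abs_nonneg _)
      rw [Real.norm_of_nonneg (div_nonneg h4 (hδ0 n).le), div_le_iff₀ (hδ0 n),
        abs_of_nonneg (Real.rpow_nonneg ha.le _)]
      linarith
    · filter_upwards [ae_restrict_mem measurableSet_Ioo] with y hy
      have ha : 0 < 1 - y := by linarith [hy.2]
      refine Filter.Tendsto.const_mul _ ?_
      have hd : HasDerivAt (fun t : ℝ => t ^ β) (β * (1 - y) ^ (β - 1)) (1 - y) :=
        Real.hasDerivAt_rpow_const (Or.inl ha.ne')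
      have hs := hd.tendsto_slope
      have hl : Filter.Tendsto (fun n => 1 - y - δ n) Filter.atTop
          (nhdsWithin (1 - y) {1 - y}ᶜ) := by
        refine tendsto_nhdsWithin_iff.2 ⟨?_, Filter.Eventually.of_forall fun n => ?_⟩
        · have := hδlim.const_sub (1 - y)
          rwa [sub_zero] at this
        · have := (hδ0 n).ne'
          simp [this]
      refine (hs.comp hl).congr' ?_
      filter_upwards [hδlim.eventually (gt_mem_nhds ha)] with n hn
      have hn' : 0 ≤ 1 - y - δ n := by linarith
      simp only [Function.comp_apply, slope_def_field]
      rw [max_eq_left hn']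
      have : δ n ≠ 0 := (hδ0 n).ne'
      rw [show 1 - y - δ n - (1 - y) = -δ n by ring]
      field_simp
      ring
  have hQval : ∀ n, ∫ y in Ω, Q n y =
      K * ((∫ y in Set.Iio (1 : ℝ), f y) - ∫ y in Set.Iio (1 - δ n), f y) / δ n := by
    intro n
    have k1 := hK 1 le_rfl
    have k2 := hK (1 - δ n) (by linarith [hδ0 n])
    have hcont : ∀ x : ℝ, Continuous fun y : ℝ => (max (x - y) 0) ^ β := fun x =>
      (Real.continuous_rpow_const hβ.le).comp ((continuous_const.sub continuous_id).max
        continuous_const)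
    have j1 : ∀ x : ℝ, ∫ y, (Set.Iio x).indicator (fun y => (x - y) ^ β) y * Ω.indicator W y =
        ∫ y in Ω, W y * (max (x - y) 0) ^ β := by
      intro x
      rw [← integral_indicator measurableSet_Ioo]
      refine integral_congr_ae (Filter.Eventually.of_forall fun y => ?_)
      by_cases hy : y ∈ Ω
      · simp only [Set.indicator_of_mem hy]
        by_cases hyx : y < x
        · rw [Set.indicator_of_mem (show y ∈ Set.Iio x from hyx), max_eq_left (by linarith),
            mul_comm]
        · rw [Set.indicator_of_notMem (show y ∉ Set.Iio x from hyx),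
            max_eq_right (by linarith), Real.zero_rpow hβ.ne', zero_mul, mul_zero]
      · simp [Set.indicator_of_notMem hy]
    have j2 : ∀ x : ℝ, IntegrableOn (fun y => W y * (max (x - y) 0) ^ β) Ω := by
      intro x
      have h5 : IntegrableOn (fun y : ℝ => (max (x - y) 0) ^ β) (Set.Icc 0 1) :=
        (hcont x).integrableOn_Icc
      obtain ⟨C, hC⟩ := (isCompact_Icc (a := (0 : ℝ)) (b := 1)).exists_bound_of_continuousOn
        (hcont x).continuousOn
      have := hWi.bdd_mul (f := fun y : ℝ => (max (x - y) 0) ^ β) (c := C)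
        (hcont x).aestronglyMeasurable (by
          filter_upwards [ae_restrict_mem measurableSet_Ioo] with y hy
          exact hC y (Set.Ioo_subset_Icc_self hy))
      refine this.congr (Filter.Eventually.of_forall fun y => ?_)
      exact mul_comm _ _
    rw [j1] at k1 k2
    rw [mul_sub, ← k1, ← k2, ← integral_sub (j2 1) (j2 (1 - δ n)), ← integral_div]
    refine setIntegral_congr_fun measurableSet_Ioo fun y hy => ?_
    simp only [hQ]
    rw [max_eq_left (by linarith [hy.2] : (0 : ℝ) ≤ 1 - y), show 1 - δ n - y = 1 - y - δ n by ring]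
    ring
  have hlim0 : Filter.Tendsto (fun n => ∫ y in Ω, Q n y) Filter.atTop (nhds 0) := by
    have hd : HasDerivAt (fun x => ∫ y in (0 : ℝ)..x, f y) (f 1) 1 :=
      intervalIntegral.integral_hasDerivAt_right (hf.continuous.intervalIntegrable _ _)
        (hf.continuous.stronglyMeasurableAtFilter _ _) hf.continuous.continuousAt
    rw [hf.eq_zero 1 (by simp)] at hd
    have hl : Filter.Tendsto (fun n => 1 - δ n) Filter.atTop (nhdsWithin 1 {1}ᶜ) := by
      refine tendsto_nhdsWithin_iff.2 ⟨?_, Filter.Eventually.of_forall fun n => ?_⟩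
      · have := hδlim.const_sub 1
        rwa [sub_zero] at this
      · have := (hδ0 n).ne'
        simp [this]
    have h6 := (hd.tendsto_slope.comp hl).const_mul K
    rw [mul_zero] at h6
    refine h6.congr fun n => ?_
    rw [hQval]
    simp only [Function.comp_apply, slope_def_field]
    have j3 : ∀ x : ℝ, 0 ≤ x → ∫ y in Set.Iio x, f y = ∫ y in (0 : ℝ)..x, f y := by
      intro x hx
      have h7 := intervalIntegral.integral_Iic_sub_Iic (f := f) (a := 0) (b := x)
        hf.integrable.integrableOn hf.integrable.integrableOn
      have h8 : ∫ y in Set.Iic (0 : ℝ), f y = 0 :=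
        setIntegral_eq_zero_of_forall_eq_zero fun y hy => hf.eq_zero y fun h => by
          exact absurd h.1 (not_lt.2 hy)
      rw [← h7, h8, sub_zero, integral_Iic_eq_integral_Iio]
    have h9 : δ n ≤ 1 := by
      rw [hδ]
      simp only
      rw [div_le_one (by positivity)]
      linarith [(Nat.cast_nonneg n : (0 : ℝ) ≤ n)]
    rw [j3 1 zero_le_one, j3 (1 - δ n) (by linarith)]
    have : δ n ≠ 0 := (hδ0 n).ne'
    rw [show 1 - δ n - 1 = -δ n by ring]
    field_simp
    ring
  have := tendsto_nhds_unique hQlim hlim0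
  simp_rw [mul_left_comm _ β] at this
  rw [integral_const_mul] at this
  exact (mul_eq_zero.1 this).resolve_left (ne_of_gt hβ)

/-! ### Localization of the Slobodeckij energy to the cells of a mesh -/

theorem lintegral_Ioi_rpow {s c : ℝ} (hs : 0 < s) (hc : 0 < c) :
    ∫⁻ t in Set.Ioi c, ENNReal.ofReal (1 / t ^ (1 + s)) = ENNReal.ofReal (c ^ (-s) / s) := by
  have h1 : ∀ t ∈ Set.Ioi c, ENNReal.ofReal (1 / t ^ (1 + s)) =
      ENNReal.ofReal (t ^ (-(1 + s))) := by
    intro t ht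
    have : 0 < t := hc.trans ht
    rw [Real.rpow_neg this.le, one_div]
  rw [setLIntegral_congr_fun measurableSet_Ioi h1, ← ofReal_integral_eq_lintegral_ofReal
    (integrableOn_Ioi_rpow_of_lt (by linarith) hc), integral_Ioi_rpow_of_lt (by linarith) hc]
  · rw [show -(1 + s) + 1 = -s by ring, neg_div_neg_eq]
  · filter_upwards [ae_restrict_mem measurableSet_Ioi] with t ht
    exact Real.rpow_nonneg (hc.trans ht).le _

theorem lintegral_Iic_one_div_abs_sub_rpow {s a x : ℝ} (hs : 0 < s) (hx : a < x) :
    ∫⁻ y in Set.Iic a, ENNReal.ofReal (1 / |x - y| ^ (1 + s)) =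
      ENNReal.ofReal ((x - a) ^ (-s) / s) := by
  rw [← lintegral_Ioi_rpow hs (sub_pos.2 hx), setLIntegral_congr Iio_ae_eq_Iic.symm,
    ← (Measure.measurePreserving_sub_left volume x).setLIntegral_comp_preimage_emb
      (measurableEmbedding_subLeft x)]
  have : (fun y => x - y) ⁻¹' Set.Iio a = Set.Ioi (x - a) := by
    ext y
    simp only [Set.mem_preimage, Set.mem_Iio, Set.mem_Ioi]
    constructor <;> intro h <;> linarith
  rw [this]
  refine setLIntegral_congr_fun measurableSet_Ioi fun t ht => ?_
  have ht0 : 0 < t := (sub_pos.2 hx).trans ht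
  simp only [sub_sub_cancel, abs_of_pos ht0]

theorem lintegral_Ioi_one_div_abs_sub_rpow {s b x : ℝ} (hs : 0 < s) (hx : x < b) :
    ∫⁻ y in Set.Ioi b, ENNReal.ofReal (1 / |x - y| ^ (1 + s)) =
      ENNReal.ofReal ((b - x) ^ (-s) / s) := by
  rw [← lintegral_Ioi_rpow hs (sub_pos.2 hx),
    ← (measurePreserving_add_left volume x).setLIntegral_comp_preimage_emb
      (measurableEmbedding_addLeft x)]
  have : (fun y => x + y) ⁻¹' Set.Ioi b = Set.Ioi (b - x) := by
    ext y
    simp only [Set.mem_preimage, Set.mem_Ioi]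
    constructor <;> intro h <;> linarith
  rw [this]
  refine setLIntegral_congr_fun measurableSet_Ioi fun t ht => ?_
  have ht0 : 0 < t := (sub_pos.2 hx).trans ht
  simp only [sub_add_cancel_left, abs_neg, abs_of_pos ht0]

theorem lintegral_compl_Ioc_one_div_abs_sub_rpow {s a b x : ℝ} (hs : 0 < s)
    (hx : x ∈ Set.Ioo a b) :
    ∫⁻ y in (Set.Ioc a b)ᶜ, ENNReal.ofReal (1 / |x - y| ^ (1 + s)) =
      ENNReal.ofReal ((x - a) ^ (-s) / s) + ENNReal.ofReal ((b - x) ^ (-s) / s) := by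
  have hc : (Set.Ioc a b)ᶜ = Set.Iic a ∪ Set.Ioi b := by
    ext y
    simp only [Set.mem_compl_iff, Set.mem_Ioc, not_and_or, not_lt, not_le, Set.mem_union,
      Set.mem_Iic, Set.mem_Ioi]
  rw [hc, lintegral_union measurableSet_Ioi, lintegral_Iic_one_div_abs_sub_rpow hs hx.1,
    lintegral_Ioi_one_div_abs_sub_rpow hs hx.2]
  rw [Set.disjoint_left]
  intro y h1 h2
  have h3 := hx.1.trans hx.2
  simp only [Set.mem_Iic, Set.mem_Ioi] at h1 h2
  linarith

/-- The interaction of a cell with its complement, for a function vanishing at its ends,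
is given by the two Hardy integrals. -/
theorem lintegral_cell_exterior {s a b : ℝ} (hs : 0 < s) {w : ℝ → ℝ} (hw : Measurable w)
    (ha : w a = 0) (hb : w b = 0) :
    ∫⁻ x in Set.Ioc a b, ∫⁻ y in (Set.Ioc a b)ᶜ, ENNReal.ofReal (w x ^ 2 / |x - y| ^ (1 + s)) =
      ENNReal.ofReal (1 / s) * (hardyLeft s w a b + hardyRight s w a b) := by
  unfold hardyLeft hardyRight
  rw [setLIntegral_congr Ioo_ae_eq_Ioc.symm, ← lintegral_add_left (by fun_prop),
    ← lintegral_const_mul' _ _ ENNReal.ofReal_ne_top]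
  refine setLIntegral_congr_fun measurableSet_Ioo fun x hx => ?_
  have h1 : ∀ y, ENNReal.ofReal (w x ^ 2 / |x - y| ^ (1 + s)) =
      ENNReal.ofReal (w x ^ 2) * ENNReal.ofReal (1 / |x - y| ^ (1 + s)) := by
    intro y
    rw [← ENNReal.ofReal_mul (sq_nonneg _)]
    congr 1
    ring
  have hpa : 0 ≤ (x - a) ^ (-s) := Real.rpow_nonneg (by linarith [hx.1]) _
  have hpb : 0 ≤ (b - x) ^ (-s) := Real.rpow_nonneg (by linarith [hx.2]) _
  simp only [ha, hb, sub_zero]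
  simp_rw [h1]
  rw [lintegral_const_mul' _ _ ENNReal.ofReal_ne_top,
    lintegral_compl_Ioc_one_div_abs_sub_rpow hs hx, ← ENNReal.ofReal_add (by positivity)
    (by positivity), ← ENNReal.ofReal_add (by positivity) (by positivity),
    ← ENNReal.ofReal_mul (by positivity), ← ENNReal.ofReal_mul (by positivity)]
  congr 1
  ring

/-- The cells of the uniform mesh, half open so as to form a partition of `(0,1]`. -/
def cell (N i : ℕ) : Set ℝ := Set.Ioc ((i : ℝ) / N) (((i : ℝ) + 1) / N)

theorem exists_mem_cell {N : ℕ} (hN : 0 < N) {x : ℝ} (hx : x ∈ Set.Ioc (0 : ℝ) 1) :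
    ∃ i ∈ Finset.range N, x ∈ cell N i := by
  have hN' : (0 : ℝ) < N := by exact_mod_cast hN
  have hpos : 0 < x * N := mul_pos hx.1 hN'
  have hc : 0 < ⌈x * N⌉₊ := Nat.ceil_pos.2 hpos
  refine ⟨⌈x * N⌉₊ - 1, ?_, ?_, ?_⟩
  · rw [Finset.mem_range]
    have : ⌈x * N⌉₊ ≤ N := Nat.ceil_le.2 (by nlinarith [hx.2])
    omega
  · rw [div_lt_iff₀ hN']
    have h1 : ((⌈x * N⌉₊ - 1 : ℕ) : ℝ) = (⌈x * N⌉₊ : ℝ) - 1 := by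
      rw [Nat.cast_sub hc]; simp
    rw [h1]
    linarith [Nat.ceil_lt_add_one hpos.le]
  · rw [le_div_iff₀ hN']
    have h1 : ((⌈x * N⌉₊ - 1 : ℕ) : ℝ) = (⌈x * N⌉₊ : ℝ) - 1 := by
      rw [Nat.cast_sub hc]; simp
    rw [h1]
    linarith [Nat.le_ceil (x * N)]

theorem disjoint_cell {N i j : ℕ} (hN : 0 < N) (hij : i ≠ j) : Disjoint (cell N i) (cell N j) := by
  have hN' : (0 : ℝ) < N := by exact_mod_cast hN
  have key : ∀ {i j : ℕ}, i < j → Disjoint (cell N i) (cell N j) := by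
    intro i j h
    rw [Set.disjoint_left]
    intro x h1 h2
    have h3 : ((i : ℝ) + 1) / N ≤ (j : ℝ) / N := by
      gcongr
      exact_mod_cast h
    linarith [h1.2, h2.1]
  rcases lt_or_gt_of_ne hij with h | h
  · exact key h
  · exact (key h).symm

theorem slobodeckijSq_eq_lintegral_prod {I : Set ℝ} {s : ℝ} {w : ℝ → ℝ} (hw : Measurable w) :
    slobodeckijSq I (s / 2) w = ∫⁻ p in I ×ˢ I, ENNReal.ofReal
      ((w p.1 - w p.2) ^ 2 / |p.1 - p.2| ^ (1 + s)) ∂(volume.prod volume) := by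
  rw [slobodeckijSq_half, ← Measure.prod_restrict, lintegral_prod _
    (measurable_slobodeckij_kernel hw (1 + s)).aemeasurable]
  rfl

/-- The Slobodeckij energy on the line of a function vanishing at the nodes of the mesh and outside
`(0,1)` is bounded by the energies in the cells and the Hardy integrals. -/
theorem slobodeckijSq_univ_le_sum {s : ℝ} (hs : 0 < s) {N : ℕ} (hN : 0 < N) {w : ℝ → ℝ}
    (hw : Measurable w) (h0 : ∀ x ∉ Ω, w x = 0) (hnode : ∀ i ≤ N, w ((i : ℝ) / N) = 0) :
    slobodeckijSq Set.univ (s / 2) w ≤ ∑ i ∈ Finset.range N,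
      (slobodeckijSq (Set.Ioo ((i : ℝ) / N) (((i : ℝ) + 1) / N)) (s / 2) w +
        ENNReal.ofReal (4 / s) * (hardyLeft s w ((i : ℝ) / N) (((i : ℝ) + 1) / N) +
          hardyRight s w ((i : ℝ) / N) (((i : ℝ) + 1) / N))) := by
  set κ : ℝ × ℝ → ℝ≥0∞ := fun p =>
    ENNReal.ofReal ((w p.1 - w p.2) ^ 2 / |p.1 - p.2| ^ (1 + s)) with hκ
  have hκm : Measurable κ := measurable_slobodeckij_kernel hw (1 + s)
  set A : ℝ × ℝ → ℝ≥0∞ := fun p => ENNReal.ofReal (w p.1 ^ 2 / |p.1 - p.2| ^ (1 + s)) with hA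
  have hAm : Measurable A := by
    have h1 : Measurable fun p : ℝ × ℝ => |p.1 - p.2| := (measurable_fst.sub measurable_snd).abs
    exact ((hw.comp measurable_fst).pow_const 2 |>.div (h1.pow_const _)).ennreal_ofReal
  set B : ℝ × ℝ → ℝ≥0∞ := fun p => A (p.2, p.1) with hB
  have hBm : Measurable B := hAm.comp measurable_swap
  have hcm : ∀ i, MeasurableSet (cell N i) := fun i => measurableSet_Ioc
  -- `F1` takes the pairs in a common cell. For all other pairs (w(x) - w(y))² ≤ 2w(x)² + 2w(y)²,
  -- and `F2`, `F3` charge each square to the cell of its own point; together they give the factor 2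
  -- · 2 · (1/s).
  set F1 : ℕ → ℝ × ℝ → ℝ≥0∞ := fun i => (cell N i ×ˢ cell N i).indicator κ with hF1
  set F2 : ℕ → ℝ × ℝ → ℝ≥0∞ := fun i => (cell N i ×ˢ (cell N i)ᶜ).indicator A with hF2
  set F3 : ℕ → ℝ × ℝ → ℝ≥0∞ := fun i => ((cell N i)ᶜ ×ˢ cell N i).indicator B with hF3
  have hm1 : ∀ i, Measurable (F1 i) := fun i => hκm.indicator ((hcm i).prod (hcm i))
  have hm2 : ∀ i, Measurable (F2 i) := fun i => hAm.indicator ((hcm i).prod (hcm i).compl)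
  have hm3 : ∀ i, Measurable (F3 i) := fun i => hBm.indicator ((hcm i).compl.prod (hcm i))
  have hΩc : ∀ x, w x ≠ 0 → ∃ i ∈ Finset.range N, x ∈ cell N i := by
    intro x hx
    have : x ∈ Ω := by
      by_contra h
      exact hx (h0 x h)
    exact exists_mem_cell hN ⟨this.1, this.2.le⟩
  have hpt : ∀ p, κ p ≤ ∑ i ∈ Finset.range N, (F1 i p + (2 * F2 i p + 2 * F3 i p)) := by
    rintro ⟨x, y⟩
    by_cases hsame : ∃ i ∈ Finset.range N, x ∈ cell N i ∧ y ∈ cell N i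
    · obtain ⟨i, hi, hxi, hyi⟩ := hsame
      refine le_trans ?_ (Finset.single_le_sum (fun j _ => zero_le) hi)
      refine le_trans (le_of_eq ?_) le_self_add
      rw [hF1]
      exact (Set.indicator_of_mem (show (x, y) ∈ cell N i ×ˢ cell N i from ⟨hxi, hyi⟩) κ).symm
    · have hk : κ (x, y) ≤ 2 * A (x, y) + 2 * B (x, y) := by
        have := ofReal_sq_div_le_two_mul_add (a := w x) (b := -w y) (p := |x - y| ^ (1 + s))
          (Real.rpow_nonneg (abs_nonneg _) _)
        simp only [hκ, hA, hB]
        rw [abs_sub_comm y x]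
        rwa [← sub_eq_add_neg, neg_sq] at this
      have h2 : A (x, y) ≤ ∑ i ∈ Finset.range N, F2 i (x, y) := by
        by_cases hx : w x = 0
        · simp [hA, hx]
        · obtain ⟨i, hi, hxi⟩ := hΩc x hx
          have hyi : y ∉ cell N i := fun h => hsame ⟨i, hi, hxi, h⟩
          refine le_trans (le_of_eq ?_) (Finset.single_le_sum (fun j _ => zero_le) hi)
          exact (Set.indicator_of_mem
            (show (x, y) ∈ cell N i ×ˢ (cell N i)ᶜ from ⟨hxi, hyi⟩) A).symm
      have h3 : B (x, y) ≤ ∑ i ∈ Finset.range N, F3 i (x, y) := by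
        by_cases hy : w y = 0
        · simp [hB, hA, hy]
        · obtain ⟨i, hi, hyi⟩ := hΩc y hy
          have hxi : x ∉ cell N i := fun h => hsame ⟨i, hi, h, hyi⟩
          refine le_trans (le_of_eq ?_) (Finset.single_le_sum (fun j _ => zero_le) hi)
          exact (Set.indicator_of_mem
            (show (x, y) ∈ (cell N i)ᶜ ×ˢ cell N i from ⟨hxi, hyi⟩) B).symm
      refine hk.trans ?_
      rw [Finset.sum_add_distrib, Finset.sum_add_distrib, ← Finset.mul_sum, ← Finset.mul_sum]
      exact (add_le_add (mul_le_mul_right h2 _) (mul_le_mul_right h3 _)).trans le_add_self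
  have hone : slobodeckijSq Set.univ (s / 2) w = ∫⁻ p, κ p ∂(volume.prod volume) := by
    rw [slobodeckijSq_eq_lintegral_prod hw, Set.univ_prod_univ, Measure.restrict_univ]
  rw [hone]
  refine (lintegral_mono hpt).trans ?_
  rw [lintegral_finsetSum _ (fun i _ =>
    (show Measurable fun p => F1 i p + (2 * F2 i p + 2 * F3 i p) from
      (hm1 i).add (((hm2 i).const_mul 2).add ((hm3 i).const_mul 2))))]
  refine Finset.sum_le_sum fun i hi => ?_
  rw [lintegral_add_left (hm1 i), lintegral_add_left ((hm2 i).const_mul 2),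
    lintegral_const_mul _ (hm2 i), lintegral_const_mul _ (hm3 i)]
  have hiN : i < N := Finset.mem_range.1 hi
  have ha : w ((i : ℝ) / N) = 0 := hnode i hiN.le
  have hb : w (((i : ℝ) + 1) / N) = 0 := by
    have := hnode (i + 1) hiN
    push_cast at this
    exact this
  have e1 : ∫⁻ p, F1 i p ∂(volume.prod volume) =
      slobodeckijSq (Set.Ioo ((i : ℝ) / N) (((i : ℝ) + 1) / N)) (s / 2) w := by
    rw [hF1, lintegral_indicator ((hcm i).prod (hcm i)), ← slobodeckijSq_eq_lintegral_prod hw]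
    unfold slobodeckijSq cell
    rw [restrict_Ioo_eq_restrict_Ioc]
  have e2 : ∫⁻ p, F2 i p ∂(volume.prod volume) = ENNReal.ofReal (1 / s) *
      (hardyLeft s w ((i : ℝ) / N) (((i : ℝ) + 1) / N) +
          hardyRight s w ((i : ℝ) / N) (((i : ℝ) + 1) / N)) := by
    rw [hF2, lintegral_indicator ((hcm i).prod (hcm i).compl), ← Measure.prod_restrict,
      lintegral_prod _ hAm.aemeasurable, ← lintegral_cell_exterior hs hw ha hb]
    rfl
  have e3 : ∫⁻ p, F3 i p ∂(volume.prod volume) = ENNReal.ofReal (1 / s) *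
      (hardyLeft s w ((i : ℝ) / N) (((i : ℝ) + 1) / N) +
          hardyRight s w ((i : ℝ) / N) (((i : ℝ) + 1) / N)) := by
    rw [hF3, lintegral_indicator ((hcm i).compl.prod (hcm i)), ← Measure.prod_restrict,
      lintegral_prod_symm _ hBm.aemeasurable, ← lintegral_cell_exterior hs hw ha hb]
    rfl
  rw [e1, e2, e3]
  refine le_of_eq ?_
  congr 1
  rw [← mul_add, ← two_mul, ← mul_assoc, ← mul_assoc, show (2 : ℝ≥0∞) = ENNReal.ofReal 2 by simp,
    ← ENNReal.ofReal_mul zero_le_two, ← ENNReal.ofReal_mul (by norm_num)]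
  congr 2
  ring

/-! ### Estimates for the linear interpolant on one cell -/

theorem lintegral_Ioo_zero_rpow {c h : ℝ} (hc : -1 < c) (hh : 0 ≤ h) :
    ∫⁻ t in Set.Ioo 0 h, ENNReal.ofReal (t ^ c) = ENNReal.ofReal (h ^ (c + 1) / (c + 1)) := by
  rw [← ofReal_integral_eq_lintegral_ofReal, ← integral_Ioc_eq_integral_Ioo,
    ← intervalIntegral.integral_of_le hh, integral_rpow (Or.inl hc),
    Real.zero_rpow (by linarith), sub_zero]
  · have := (intervalIntegral.intervalIntegrable_rpow' hc (a := 0) (b := h))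
    rw [intervalIntegrable_iff_integrableOn_Ioo_of_le hh] at this
    exact this
  · filter_upwards [ae_restrict_mem measurableSet_Ioo] with t ht
    exact Real.rpow_nonneg ht.1.le _

theorem lintegral_Ioo_abs_sub_rpow_le {c a b x : ℝ} (hc : -1 < c) (hx : x ∈ Set.Ioo a b) :
    ∫⁻ y in Set.Ioo a b, ENNReal.ofReal (|x - y| ^ c) ≤
      ENNReal.ofReal (2 * (b - a) ^ (c + 1) / (c + 1)) := by
  have hh : 0 ≤ b - a := by linarith [hx.1, hx.2]
  have hsub : Set.Ioo a b ⊆ Set.Ioo (x - (b - a)) x ∪ ({x} ∪ Set.Ioo x (x + (b - a))) := by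
    intro y hy
    rcases lt_trichotomy y x with h | h | h
    · exact Or.inl ⟨by linarith [hx.2, hy.1], h⟩
    · exact Or.inr (Or.inl h)
    · exact Or.inr (Or.inr ⟨h, by linarith [hx.1, hy.2]⟩)
  have e1 : ∫⁻ y in Set.Ioo (x - (b - a)) x, ENNReal.ofReal (|x - y| ^ c) =
      ENNReal.ofReal ((b - a) ^ (c + 1) / (c + 1)) := by
    rw [← lintegral_Ioo_zero_rpow hc hh,
      ← (Measure.measurePreserving_sub_left volume x).setLIntegral_comp_preimage_emb
      (measurableEmbedding_subLeft x)]
    have : (fun y => x - y) ⁻¹' Set.Ioo (x - (b - a)) x = Set.Ioo 0 (b - a) := by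
      ext y
      simp only [Set.mem_preimage, Set.mem_Ioo]
      constructor <;> rintro ⟨h1, h2⟩ <;> constructor <;> linarith
    rw [this]
    refine setLIntegral_congr_fun measurableSet_Ioo fun t ht => ?_
    simp only [sub_sub_cancel, abs_of_pos ht.1]
  have e2 : ∫⁻ y in Set.Ioo x (x + (b - a)), ENNReal.ofReal (|x - y| ^ c) =
      ENNReal.ofReal ((b - a) ^ (c + 1) / (c + 1)) := by
    rw [← lintegral_Ioo_zero_rpow hc hh,
      ← (measurePreserving_add_left volume x).setLIntegral_comp_preimage_emb
      (measurableEmbedding_addLeft x)]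
    have : (fun y => x + y) ⁻¹' Set.Ioo x (x + (b - a)) = Set.Ioo 0 (b - a) := by
      ext y
      simp only [Set.mem_preimage, Set.mem_Ioo]
      constructor <;> rintro ⟨h1, h2⟩ <;> constructor <;> linarith
    rw [this]
    refine setLIntegral_congr_fun measurableSet_Ioo fun t ht => ?_
    simp only [sub_add_cancel_left, abs_neg, abs_of_pos ht.1]
  have hpos : 0 ≤ (b - a) ^ (c + 1) / (c + 1) :=
    div_nonneg (Real.rpow_nonneg hh _) (by linarith)
  calc _ ≤ _ := lintegral_mono_set hsub
    _ ≤ _ := lintegral_union_le _ _ _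
    _ ≤ _ := add_le_add_right (lintegral_union_le _ _ _) _
    _ = ENNReal.ofReal (2 * (b - a) ^ (c + 1) / (c + 1)) := by
      rw [e1, e2, Measure.restrict_eq_zero.2 (measure_singleton x), lintegral_zero_measure,
        zero_add, ← ENNReal.ofReal_add hpos hpos]
      congr 1
      ring

theorem slobodeckijSq_le_of_lipschitz {s : ℝ} (hs₂ : s < 2) {a b m : ℝ} (hab : a ≤ b)
    {g : ℝ → ℝ} (hg : ∀ x ∈ Set.Ioo a b, ∀ y ∈ Set.Ioo a b, |g x - g y| ≤ m * |x - y|) :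
    slobodeckijSq (Set.Ioo a b) (s / 2) g ≤
      ENNReal.ofReal (m ^ 2 * (2 * (b - a) ^ (3 - s) / (2 - s))) := by
  have hh : 0 ≤ b - a := by linarith
  rw [slobodeckijSq_half]
  have hpt : ∀ x ∈ Set.Ioo a b, slobodeckijAt (Set.Ioo a b) s g x ≤
      ENNReal.ofReal (m ^ 2 * (2 * (b - a) ^ (2 - s) / (2 - s))) := by
    intro x hx
    have hb := lintegral_Ioo_abs_sub_rpow_le (c := 1 - s) (by linarith) hx
    rw [show 1 - s + 1 = 2 - s by ring] at hb
    rw [ENNReal.ofReal_mul (sq_nonneg m)]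
    refine le_trans ?_ (mul_le_mul_right hb _)
    rw [← lintegral_const_mul' _ _ ENNReal.ofReal_ne_top]
    refine setLIntegral_mono' measurableSet_Ioo fun y hy => ?_
    rw [← ENNReal.ofReal_mul (sq_nonneg m)]
    refine ENNReal.ofReal_le_ofReal ?_
    rcases eq_or_ne x y with rfl | hne
    · rw [sub_self]
      simp only [ne_eq, OfNat.ofNat_ne_zero, not_false_eq_true, zero_pow, zero_div]
      positivity
    · have hp : 0 < |x - y| := abs_pos.2 (sub_ne_zero.2 hne)
      have h1 := hg x hx y hy
      have h2 : (g x - g y) ^ 2 ≤ m ^ 2 * |x - y| ^ 2 := by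
        rw [← sq_abs (g x - g y), ← mul_pow]
        exact pow_le_pow_left₀ (abs_nonneg _) h1 2
      rw [div_le_iff₀ (Real.rpow_pos_of_pos hp _), mul_assoc, ← Real.rpow_add hp]
      rw [show 1 - s + (1 + s) = ((2 : ℕ) : ℝ) by push_cast; ring, Real.rpow_natCast]
      exact h2
  refine (setLIntegral_mono' measurableSet_Ioo hpt).trans_eq ?_
  rw [setLIntegral_const, Real.volume_Ioo, ← ENNReal.ofReal_mul]
  · rcases hh.eq_or_lt with h | h
    · rw [← h, Real.zero_rpow (show 2 - s ≠ 0 by linarith),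
        Real.zero_rpow (show 3 - s ≠ 0 by linarith)]
      simp
    · rw [show (3 - s) = 2 - s + 1 by ring, Real.rpow_add h, Real.rpow_one]
      congr 1
      ring
  · have : 0 ≤ (b - a) ^ (2 - s) := Real.rpow_nonneg hh _
    have : 0 < 2 - s := by linarith
    positivity

theorem slobodeckijSq_half_le_of_le {s γ a b : ℝ} (hγ : s / 2 ≤ γ) (f : ℝ → ℝ) :
    slobodeckijSq (Set.Ioo a b) (s / 2) f ≤
      ENNReal.ofReal ((b - a) ^ (2 * γ - s)) * slobodeckijSq (Set.Ioo a b) γ f := by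
  unfold slobodeckijSq
  rw [← lintegral_const_mul' _ _ ENNReal.ofReal_ne_top]
  refine setLIntegral_mono' measurableSet_Ioo fun x hx => ?_
  rw [← lintegral_const_mul' _ _ ENNReal.ofReal_ne_top]
  refine setLIntegral_mono' measurableSet_Ioo fun y hy => ?_
  have hh : 0 < b - a := by linarith [hx.1, hx.2]
  rw [← ENNReal.ofReal_mul (Real.rpow_nonneg hh.le _)]
  refine ENNReal.ofReal_le_ofReal ?_
  rcases eq_or_ne x y with rfl | hne
  · simp
  have hp : 0 < |x - y| := abs_pos.2 (sub_ne_zero.2 hne)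
  have hle : |x - y| ≤ b - a := by
    rw [abs_le]
    constructor <;> linarith [hx.1, hx.2, hy.1, hy.2]
  have h1 : |x - y| ^ (2 * γ - s) ≤ (b - a) ^ (2 * γ - s) :=
    Real.rpow_le_rpow hp.le hle (by linarith)
  rw [← mul_div_assoc ((b - a) ^ (2 * γ - s)), div_le_div_iff₀ (Real.rpow_pos_of_pos hp _) (Real.rpow_pos_of_pos hp _),
    show 1 + 2 * γ = (1 + 2 * (s / 2)) + (2 * γ - s) by ring, Real.rpow_add hp]
  have h2 : 0 ≤ (f x - f y) ^ 2 * |x - y| ^ (1 + 2 * (s / 2)) := by positivity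
  nlinarith [mul_le_mul_of_nonneg_left h1 h2]

/-- The error of linear interpolation at the end points of `(a,b)`. -/
def interpError (f : ℝ → ℝ) (a b x : ℝ) : ℝ :=
  f x - (f a + (f b - f a) / (b - a) * (x - a))

/-- The local Hölder estimate bounds the slope of the interpolant, and its power (b-a)^{s-1} cancels
the (b-a)^{1-s} in the energy of an affine function. Interpolation is thus stable uniformly in the
cell size. -/
theorem IsHardyConst.slobodeckijSq_interpError_le {s K : ℝ} (hs : 1 < s) (hs₂ : s < 2)
    (hK0 : 0 < K) (hK : IsHardyConst s K) {f : ℝ → ℝ} (hf : Continuous f) {a b : ℝ}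
    (hab : a < b) :
    slobodeckijSq (Set.Ioo a b) (s / 2) (interpError f a b) ≤
      ENNReal.ofReal (2 + 16 * K / (2 - s)) * slobodeckijSq (Set.Ioo a b) (s / 2) f := by
  have hh : 0 < b - a := by linarith
  have hs2 : 0 < 2 - s := by linarith
  set m := (f b - f a) / (b - a) with hm
  have h1 := slobodeckijSq_add_le (Set.Ioo a b) (s / 2) (v := f)
    (w := fun x => -(f a + m * (x - a))) hf.measurable
  have h2 : slobodeckijSq (Set.Ioo a b) (s / 2) (fun x => -(f a + m * (x - a))) ≤
      ENNReal.ofReal (m ^ 2 * (2 * (b - a) ^ (3 - s) / (2 - s))) := by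
    rw [← sq_abs m]
    refine slobodeckijSq_le_of_lipschitz hs₂ hab.le fun x _ y _ => ?_
    rw [← abs_mul, ← abs_neg]
    refine le_of_eq ?_
    congr 1
    ring
  have h3 := hK.ofReal_sq_sub_le_of_continuous hs hK0 hf hab
  have h4 : ENNReal.ofReal (m ^ 2 * (2 * (b - a) ^ (3 - s) / (2 - s))) ≤
      ENNReal.ofReal (8 * K / (2 - s)) * slobodeckijSq (Set.Ioo a b) (s / 2) f := by
    have e : m ^ 2 * (2 * (b - a) ^ (3 - s) / (2 - s)) =
        (2 * (b - a) ^ (1 - s) / (2 - s)) * (f b - f a) ^ 2 := by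
      rw [hm, show 3 - s = 1 - s + ((2 : ℕ) : ℝ) by push_cast; ring, Real.rpow_add hh,
        Real.rpow_natCast]
      field_simp
    rw [e, ENNReal.ofReal_mul (by positivity)]
    refine (mul_le_mul_right h3 _).trans_eq ?_
    rw [← mul_assoc, ← ENNReal.ofReal_mul (by positivity)]
    congr 2
    have : (b - a) ^ (1 - s) * (b - a) ^ (s - 1) = 1 := by
      rw [← Real.rpow_add hh]
      simp
    calc _ = 8 * K / (2 - s) * ((b - a) ^ (1 - s) * (b - a) ^ (s - 1)) := by ring
      _ = _ := by rw [this, mul_one]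
  have h5 : slobodeckijSq (Set.Ioo a b) (s / 2) (interpError f a b) =
      slobodeckijSq (Set.Ioo a b) (s / 2) (fun x => f x + -(f a + m * (x - a))) := by
    congr 1
  rw [h5]
  refine h1.trans ((add_le_add_right (mul_le_mul_right (h2.trans h4) _) _).trans_eq ?_)
  rw [← mul_assoc, ← add_mul, show (2 : ℝ≥0∞) = ENNReal.ofReal 2 by simp,
    ← ENNReal.ofReal_mul zero_le_two, ← ENNReal.ofReal_add zero_le_two (by positivity)]
  congr 2
  ring

-- The points y separated from x by t lie in a half-line whose end has distance |t - x| from x; s >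
-- 1 makes the integral converge there.
open Classical in
theorem lintegral_separated_le {s : ℝ} (hs : 1 < s) {x t : ℝ} (hxt : x ≠ t) :
    ∫⁻ y, (if t ∈ Set.uIoc x y then ENNReal.ofReal (|x - y| ^ (-s)) else 0) ≤
      ENNReal.ofReal (1 / (s - 1)) * ENNReal.ofReal (|t - x| ^ (1 - s)) := by
  have hs1 : 0 < s - 1 := by linarith
  have hpow : ∀ y, ENNReal.ofReal (|x - y| ^ (-s)) =
      ENNReal.ofReal (1 / |x - y| ^ (1 + (s - 1))) := by
    intro y
    rw [Real.rpow_neg (abs_nonneg _), one_div, show 1 + (s - 1) = s by ring]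
  rw [← ENNReal.ofReal_mul (by positivity)]
  rcases lt_or_gt_of_ne hxt with h | h
  · have e := lintegral_Ioi_one_div_abs_sub_rpow hs1 h
    rw [← setLIntegral_congr Ioi_ae_eq_Ici.symm, ← lintegral_indicator measurableSet_Ici] at e
    rw [abs_of_pos (sub_pos.2 h)]
    refine le_trans (lintegral_mono fun y => ?_) (e.le.trans_eq ?_)
    · by_cases hy : t ∈ Set.uIoc x y
      · have : y ∈ Set.Ici t := by
          rw [Set.mem_uIoc] at hy
          rcases hy with hy | hy
          · exact hy.2
          · exact absurd h (not_lt.2 hy.2)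
        rw [if_pos hy, Set.indicator_of_mem this, hpow]
      · rw [if_neg hy]
        exact zero_le
    · rw [show -(s - 1) = 1 - s by ring]
      congr 1
      ring
  · have e := lintegral_Iic_one_div_abs_sub_rpow hs1 h
    rw [← lintegral_indicator measurableSet_Iic] at e
    rw [abs_sub_comm, abs_of_pos (sub_pos.2 h)]
    refine le_trans (lintegral_mono fun y => ?_) (e.le.trans_eq ?_)
    · by_cases hy : t ∈ Set.uIoc x y
      · have : y ∈ Set.Iic t := by
          rw [Set.mem_uIoc] at hy
          rcases hy with hy | hy
          · exact absurd hy.1 (not_lt.2 h.le)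
          · exact hy.1.le
        rw [if_pos hy, Set.indicator_of_mem this, hpow]
      · rw [if_neg hy]
        exact zero_le
    · rw [show -(s - 1) = 1 - s by ring]
      congr 1
      ring

open Classical in
/-- The Slobodeckij energy of order `s/2` of a primitive of `q` is bounded by the `L²` norm
of `q`. -/
theorem slobodeckijSq_le_of_primitive {s : ℝ} (hs : 1 < s) (hs₂ : s < 2) {a b : ℝ}
    {w q : ℝ → ℝ} (hq : Measurable q)
    (hw : ∀ x ∈ Set.Ioo a b, ∀ y ∈ Set.Ioo a b, w x - w y = ∫ t in x..y, q t) :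
    slobodeckijSq (Set.Ioo a b) (s / 2) w ≤
      ENNReal.ofReal (2 / ((s - 1) * (2 - s)) * (b - a) ^ (2 - s)) *
        ∫⁻ t in Set.Ioo a b, ENNReal.ofReal (q t ^ 2) := by
  have hs1 : 0 < s - 1 := by linarith
  have hs2 : 0 < 2 - s := by linarith
  set I := Set.Ioo a b with hI
  -- Cauchy-Schwarz gives (w(x) - w(y))² ≤ |x-y| ∫ q² over the segment between x and y, which leaves
  -- the kernel |x-y|^{-s}. Tonelli brings t outside; the integral over the pairs separated by t
  -- converges in y because s > 1 and in x because s < 2.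
  set k : (ℝ × ℝ) → ℝ → ℝ≥0∞ := fun p t =>
    if t ∈ Set.uIoc p.1 p.2 then ENNReal.ofReal (|p.1 - p.2| ^ (-s)) else 0 with hk
  have hkm : Measurable (Function.uncurry k) := by
    have hset : MeasurableSet {z : (ℝ × ℝ) × ℝ | z.2 ∈ Set.uIoc z.1.1 z.1.2} := by
      have : {z : (ℝ × ℝ) × ℝ | z.2 ∈ Set.uIoc z.1.1 z.1.2} =
          {z | min z.1.1 z.1.2 < z.2} ∩ {z | z.2 ≤ max z.1.1 z.1.2} := by
        ext z
        simp [Set.uIoc]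
      rw [this]
      exact (measurableSet_lt (by fun_prop) (by fun_prop)).inter
        (measurableSet_le (by fun_prop) (by fun_prop))
    refine Measurable.ite hset ?_ measurable_const
    exact (Measurable.pow_const (by fun_prop) _).ennreal_ofReal
  have hQm : Measurable fun t => ENNReal.ofReal (q t ^ 2) := (hq.pow_const 2).ennreal_ofReal
  have hpt : ∀ x ∈ I, ∀ y ∈ I, ENNReal.ofReal ((w x - w y) ^ 2 / |x - y| ^ (1 + s)) ≤
      ∫⁻ t in I, k (x, y) t * ENNReal.ofReal (q t ^ 2) := by
    intro x hx y hy
    rcases eq_or_ne x y with rfl | hne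
    · simp
    have hp : 0 < |x - y| := abs_pos.2 (sub_ne_zero.2 hne)
    have hsub : Set.uIoc x y ⊆ I := by
      intro t ht
      rw [Set.mem_uIoc] at ht
      rcases ht with ht | ht
      · exact ⟨hx.1.trans ht.1, ht.2.trans_lt hy.2⟩
      · exact ⟨hy.1.trans ht.1, ht.2.trans_lt hx.2⟩
    have h1 : ENNReal.ofReal ((w x - w y) ^ 2) ≤
        ENNReal.ofReal |x - y| * ∫⁻ t in Set.uIoc x y, ENNReal.ofReal (q t ^ 2) := by
      rw [hw x hx y hy]
      have h2 : ‖∫ t in x..y, q t‖ₑ ≤ ∫⁻ t in Set.uIoc x y, 1 * ‖q t‖ₑ := by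
        rw [← ofReal_norm, intervalIntegral.norm_intervalIntegral_eq, ofReal_norm]
        simp only [one_mul]
        exact enorm_integral_le_lintegral_enorm _
      have h3 := sq_lintegral_mul_le (μ := volume.restrict (Set.uIoc x y)) (F := fun _ => 1)
        (G := fun t => ‖q t‖ₑ) aemeasurable_const hq.enorm.aemeasurable
      have e1 : ENNReal.ofReal ((∫ t in x..y, q t) ^ 2) = ‖∫ t in x..y, q t‖ₑ ^ 2 := by
        rw [← ofReal_norm, ← ENNReal.ofReal_pow (norm_nonneg _), Real.norm_eq_abs, sq_abs]
      have e2 : ∀ t, ‖q t‖ₑ ^ 2 = ENNReal.ofReal (q t ^ 2) := by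
        intro t
        rw [← ofReal_norm, ← ENNReal.ofReal_pow (norm_nonneg _), Real.norm_eq_abs, sq_abs]
      rw [e1]
      refine (pow_le_pow_left₀ zero_le h2 2).trans (h3.trans_eq ?_)
      simp only [e2, one_pow]
      rw [setLIntegral_one, Set.uIoc, Real.volume_Ioc, max_sub_min_eq_abs]
      rw [abs_sub_comm]
    have h4 : ∫⁻ t in I, k (x, y) t * ENNReal.ofReal (q t ^ 2) =
        ENNReal.ofReal (|x - y| ^ (-s)) *
          ∫⁻ t in Set.uIoc x y, ENNReal.ofReal (q t ^ 2) := by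
      rw [← lintegral_const_mul' _ _ ENNReal.ofReal_ne_top]
      have : (Set.uIoc x y) = I ∩ Set.uIoc x y := (Set.inter_eq_right.2 hsub).symm
      rw [this, Set.inter_comm, ← Measure.restrict_restrict measurableSet_uIoc,
        ← lintegral_indicator measurableSet_uIoc]
      refine lintegral_congr fun t => ?_
      by_cases ht : t ∈ Set.uIoc x y <;> simp [hk, ht]
    rw [h4]
    have e5 : (w x - w y) ^ 2 / |x - y| ^ (1 + s) =
        (|x - y| ^ (-s) * |x - y|⁻¹) * (w x - w y) ^ 2 := by
      rw [Real.rpow_add hp, Real.rpow_one, Real.rpow_neg hp.le]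
      field_simp
    rw [e5, ENNReal.ofReal_mul (by positivity)]
    refine (mul_le_mul_right h1 _).trans_eq ?_
    rw [← mul_assoc, ← ENNReal.ofReal_mul (by positivity), mul_assoc (|x - y| ^ (-s)),
      inv_mul_cancel₀ hp.ne', mul_one]
  rw [slobodeckijSq_half]
  have hFm : Measurable fun z : (ℝ × ℝ) × ℝ => k z.1 z.2 * ENNReal.ofReal (q z.2 ^ 2) :=
    hkm.mul (hQm.comp measurable_snd)
  have hinner : ∀ t ∈ I, ∫⁻ x in I, ∫⁻ y in I, k (x, y) t ≤
      ENNReal.ofReal (2 / ((s - 1) * (2 - s)) * (b - a) ^ (2 - s)) := by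
    intro t ht
    have hb := lintegral_Ioo_abs_sub_rpow_le (c := 1 - s) (by linarith) ht
    rw [show 1 - s + 1 = 2 - s by ring] at hb
    calc _ ≤ ∫⁻ x in I, ENNReal.ofReal (1 / (s - 1)) * ENNReal.ofReal (|t - x| ^ (1 - s)) := by
          refine lintegral_mono_ae (ae_restrict_of_ae ?_)
          filter_upwards [Measure.ae_ne volume t] with x hx
          exact (setLIntegral_le_lintegral _ _).trans (lintegral_separated_le hs hx)
      _ = _ := lintegral_const_mul' _ _ ENNReal.ofReal_ne_top
      _ ≤ _ := mul_le_mul_right hb _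
      _ = _ := by
        rw [← ENNReal.ofReal_mul (by positivity)]
        congr 1
        field_simp
  calc ∫⁻ x in I, slobodeckijAt I s w x
      ≤ ∫⁻ x in I, ∫⁻ y in I, ∫⁻ t in I, k (x, y) t * ENNReal.ofReal (q t ^ 2) :=
        setLIntegral_mono' measurableSet_Ioo fun x hx =>
          setLIntegral_mono' measurableSet_Ioo fun y hy => hpt x hx y hy
    _ = ∫⁻ p, (∫⁻ t in I, k p t * ENNReal.ofReal (q t ^ 2))
          ∂((volume.restrict I).prod (volume.restrict I)) := by
        rw [lintegral_prod _ (Measurable.lintegral_prod_right' hFm).aemeasurable]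
    _ = ∫⁻ t in I, (∫⁻ p, k p t * ENNReal.ofReal (q t ^ 2)
          ∂((volume.restrict I).prod (volume.restrict I))) :=
        lintegral_lintegral_swap hFm.aemeasurable
    _ = ∫⁻ t in I, (∫⁻ x in I, ∫⁻ y in I, k (x, y) t) * ENNReal.ofReal (q t ^ 2) := by
        refine lintegral_congr fun t => ?_
        have hkt : Measurable fun p => k p t := hkm.of_uncurry_right
        rw [lintegral_mul_const _ hkt, lintegral_prod _ hkt.aemeasurable]
    _ ≤ ∫⁻ t in I, ENNReal.ofReal (2 / ((s - 1) * (2 - s)) * (b - a) ^ (2 - s)) *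
          ENNReal.ofReal (q t ^ 2) :=
        setLIntegral_mono' measurableSet_Ioo fun t ht => mul_le_mul_left (hinner t ht) _
    _ = _ := lintegral_const_mul' _ _ ENNReal.ofReal_ne_top

/-- The deviation p(t) - mean is the average over y of p(t) - p(y), so Cauchy-Schwarz applies. -/
theorem lintegral_sq_sub_mean_le {a b : ℝ} (hab : a < b) {p : ℝ → ℝ} (hp : Measurable p)
    (hpi : IntegrableOn p (Set.Ioo a b)) :
    ∫⁻ t in Set.Ioo a b, ENNReal.ofReal ((p t - (∫ y in Set.Ioo a b, p y) / (b - a)) ^ 2) ≤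
      ENNReal.ofReal (1 / (b - a)) *
        ∫⁻ t in Set.Ioo a b, ∫⁻ y in Set.Ioo a b, ENNReal.ofReal ((p t - p y) ^ 2) := by
  have hh : 0 < b - a := by linarith
  rw [← lintegral_const_mul' _ _ ENNReal.ofReal_ne_top]
  refine lintegral_mono fun t => ?_
  have e0 : p t - (∫ y in Set.Ioo a b, p y) / (b - a) =
      (b - a)⁻¹ * ∫ y in Set.Ioo a b, (p t - p y) := by
    rw [integral_sub (integrable_const _) hpi, integral_const]
    simp only [measureReal_restrict_apply_univ, Real.volume_real_Ioo_of_le hab.le, smul_eq_mul]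
    field_simp
  have e2 : ∀ z : ℝ, ‖z‖ₑ ^ 2 = ENNReal.ofReal (z ^ 2) := by
    intro z
    rw [← ofReal_norm, ← ENNReal.ofReal_pow (norm_nonneg _), Real.norm_eq_abs, sq_abs]
  have h3 := sq_lintegral_mul_le (μ := volume.restrict (Set.Ioo a b)) (F := fun _ => 1)
    (G := fun y => ‖p t - p y‖ₑ) aemeasurable_const
    (measurable_const.sub hp).enorm.aemeasurable
  simp only [one_mul, one_pow, e2] at h3
  rw [setLIntegral_one, Real.volume_Ioo] at h3
  have h4 : ENNReal.ofReal ((∫ y in Set.Ioo a b, (p t - p y)) ^ 2) ≤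
      ENNReal.ofReal (b - a) * ∫⁻ y in Set.Ioo a b, ENNReal.ofReal ((p t - p y) ^ 2) := by
    refine le_trans ?_ h3
    rw [← e2]
    exact pow_le_pow_left₀ zero_le (enorm_integral_le_lintegral_enorm _) 2
  rw [e0, mul_pow, ENNReal.ofReal_mul (by positivity)]
  refine (mul_le_mul_right h4 _).trans_eq ?_
  rw [← mul_assoc, ← ENNReal.ofReal_mul (by positivity)]
  congr 2
  field_simp

theorem lintegral_sq_sub_le_slobodeckijSq {a b lam : ℝ} (hl : 0 ≤ lam) (p : ℝ → ℝ) :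
    ∫⁻ t in Set.Ioo a b, ∫⁻ y in Set.Ioo a b, ENNReal.ofReal ((p t - p y) ^ 2) ≤
      ENNReal.ofReal ((b - a) ^ (1 + 2 * lam)) * slobodeckijSq (Set.Ioo a b) lam p := by
  unfold slobodeckijSq
  rw [← lintegral_const_mul' _ _ ENNReal.ofReal_ne_top]
  refine setLIntegral_mono' measurableSet_Ioo fun x hx => ?_
  rw [← lintegral_const_mul' _ _ ENNReal.ofReal_ne_top]
  refine setLIntegral_mono' measurableSet_Ioo fun y hy => ?_
  have hh : 0 < b - a := by linarith [hx.1, hx.2]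
  rw [← ENNReal.ofReal_mul (Real.rpow_nonneg hh.le _)]
  refine ENNReal.ofReal_le_ofReal ?_
  rcases eq_or_ne x y with rfl | hne
  · simp
  have hp : 0 < |x - y| := abs_pos.2 (sub_ne_zero.2 hne)
  have hle : |x - y| ≤ b - a := by
    rw [abs_le]
    constructor <;> linarith [hx.1, hx.2, hy.1, hy.2]
  have h1 : |x - y| ^ (1 + 2 * lam) ≤ (b - a) ^ (1 + 2 * lam) :=
    Real.rpow_le_rpow hp.le hle (by linarith)
  rw [mul_div_assoc', le_div_iff₀ (Real.rpow_pos_of_pos hp _), mul_comm]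
  exact mul_le_mul_of_nonneg_right h1 (sq_nonneg _)

/-- Replaces the Slobodeckij bound when γ = 1, where the Sobolev norm of u only offers the L² norm
of the derivative. -/
theorem lintegral_sq_sub_le_lintegral_sq {a b : ℝ} {p : ℝ → ℝ} (hp : Measurable p) :
    ∫⁻ t in Set.Ioo a b, ∫⁻ y in Set.Ioo a b, ENNReal.ofReal ((p t - p y) ^ 2) ≤
      ENNReal.ofReal (4 * (b - a)) * ∫⁻ t in Set.Ioo a b, ENNReal.ofReal (p t ^ 2) := by
  have hQm : Measurable fun t => ENNReal.ofReal (p t ^ 2) := (hp.pow_const 2).ennreal_ofReal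
  have hin : ∀ t, ∫⁻ y in Set.Ioo a b, ENNReal.ofReal ((p t - p y) ^ 2) ≤
      2 * (ENNReal.ofReal (b - a) * ENNReal.ofReal (p t ^ 2)) +
        2 * ∫⁻ y in Set.Ioo a b, ENNReal.ofReal (p y ^ 2) := by
    intro t
    refine (lintegral_le_two_mul_add (g := fun _ => ENNReal.ofReal (p t ^ 2))
      (h := fun y => ENNReal.ofReal (p y ^ 2)) measurable_const fun y => ?_).trans_eq ?_
    · have := ofReal_sq_div_le_two_mul_add (a := p t) (b := -p y) (p := 1) zero_le_one
      simpa only [div_one, ← sub_eq_add_neg, neg_sq] using this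
    · rw [setLIntegral_const, Real.volume_Ioo, mul_comm (ENNReal.ofReal (p t ^ 2))]
  refine (lintegral_le_two_mul_add (hQm.const_mul _) hin).trans_eq ?_
  rw [lintegral_const_mul' _ _ ENNReal.ofReal_ne_top, setLIntegral_const, Real.volume_Ioo,
    ENNReal.ofReal_mul (by norm_num), mul_comm _ (ENNReal.ofReal (b - a)), ← two_mul, ← mul_assoc,
    ← mul_assoc]
  congr 2
  rw [show (4 : ℝ) = 2 * 2 by norm_num, ENNReal.ofReal_mul zero_le_two]
  simp

/-- The slope of the interpolant is the mean of p over the cell, so the derivative of the error is p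
minus its mean. -/
theorem slobodeckijSq_interpError_le_of_primitive {s : ℝ} (hs : 1 < s) (hs₂ : s < 2) {a b : ℝ}
    (hab : a < b) {f p : ℝ → ℝ} (hp : Measurable p) (hpi : IntegrableOn p (Set.Icc a b))
    (hf : ∀ x ∈ Set.Icc a b, ∀ y ∈ Set.Icc a b, f y - f x = ∫ t in x..y, p t) :
    slobodeckijSq (Set.Ioo a b) (s / 2) (interpError f a b) ≤
      ENNReal.ofReal (2 / ((s - 1) * (2 - s)) * (b - a) ^ (1 - s)) *
        ∫⁻ t in Set.Ioo a b, ∫⁻ y in Set.Ioo a b, ENNReal.ofReal ((p t - p y) ^ 2) := by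
  have hh : 0 < b - a := by linarith
  have hs1 : 0 < s - 1 := by linarith
  have hs2 : 0 < 2 - s := by linarith
  set m := (∫ y in Set.Ioo a b, p y) / (b - a) with hm
  have hfm : (f b - f a) / (b - a) = m := by
    rw [hf a ⟨le_rfl, hab.le⟩ b ⟨hab.le, le_rfl⟩, intervalIntegral.integral_of_le hab.le,
      integral_Ioc_eq_integral_Ioo]
  have hw : ∀ x ∈ Set.Ioo a b, ∀ y ∈ Set.Ioo a b,
      interpError f a b x - interpError f a b y = ∫ t in x..y, (m - p t) := by
    intro x hx y hy
    have hii : IntervalIntegrable p volume x y :=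
      (hpi.mono_set (Set.uIcc_subset_Icc (Set.Ioo_subset_Icc_self hx)
        (Set.Ioo_subset_Icc_self hy))).intervalIntegrable
    rw [intervalIntegral.integral_sub intervalIntegrable_const hii,
      ← hf x (Set.Ioo_subset_Icc_self hx) y (Set.Ioo_subset_Icc_self hy),
      intervalIntegral.integral_const, smul_eq_mul]
    simp only [interpError, hfm]
    ring
  refine (slobodeckijSq_le_of_primitive hs hs₂
    (q := fun t => m - p t) (measurable_const.sub hp) hw).trans ?_
  have h1 := lintegral_sq_sub_mean_le hab hp (hpi.mono_set Set.Ioo_subset_Icc_self)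
  have h2 : ∫⁻ t in Set.Ioo a b, ENNReal.ofReal ((m - p t) ^ 2) =
      ∫⁻ t in Set.Ioo a b, ENNReal.ofReal ((p t - m) ^ 2) := by
    refine lintegral_congr fun t => ?_
    rw [← neg_sub, neg_sq]
  rw [h2]
  refine (mul_le_mul_right h1 _).trans_eq ?_
  rw [← mul_assoc, ← ENNReal.ofReal_mul (by positivity)]
  congr 2
  rw [show 2 - s = 1 - s + 1 by ring, Real.rpow_add hh, Real.rpow_one]
  field_simp

/-! ### The piecewise linear nodal interpolant -/

/-- The square of the `H^{s/2}(ℝ)` norm. -/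
def energySq (s : ℝ) (f : ℝ → ℝ) : ℝ≥0∞ :=
  (∫⁻ x, ‖f x‖ₑ ^ 2) + slobodeckijSq Set.univ (s / 2) f

theorem enorm_sq_eq_ofReal (z : ℝ) : ‖z‖ₑ ^ 2 = ENNReal.ofReal (z ^ 2) := by
  rw [← ofReal_norm, ← ENNReal.ofReal_pow (norm_nonneg _), Real.norm_eq_abs, sq_abs]

theorem sum_lintegral_cell {N : ℕ} (hN : 0 < N) (F : ℝ → ℝ≥0∞) :
    ∑ i ∈ Finset.range N, ∫⁻ x in Set.Ioo ((i : ℝ) / N) (((i : ℝ) + 1) / N), F x =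
      ∫⁻ x in Ω, F x := by
  have hN' : (0 : ℝ) < N := by exact_mod_cast hN
  have hU : ⋃ i ∈ Finset.range N, cell N i = Set.Ioc (0 : ℝ) 1 := by
    ext x
    simp only [Set.mem_iUnion, exists_prop]
    constructor
    · rintro ⟨i, hi, hx⟩
      have hi' : (i : ℝ) + 1 ≤ N := by exact_mod_cast Finset.mem_range.1 hi
      refine ⟨lt_of_le_of_lt (by positivity) hx.1, hx.2.trans ?_⟩
      rw [div_le_one hN']
      exact hi'
    · intro hx
      exact exists_mem_cell hN hx
  have h := lintegral_biUnion_finset (μ := volume) (s := Finset.range N) (t := cell N)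
    (fun i _ j _ hij => disjoint_cell hN hij) (fun i _ => measurableSet_Ioc) F
  rw [hU, ← restrict_Ioo_eq_restrict_Ioc] at h
  rw [h]
  refine Finset.sum_congr rfl fun i _ => ?_
  rw [restrict_Ioo_eq_restrict_Ioc, cell]

theorem cell_subset_Ω {N i : ℕ} (hN : 0 < N) (hi : i < N) :
    Set.Ioo ((i : ℝ) / N) (((i : ℝ) + 1) / N) ⊆ Ω := by
  have hN' : (0 : ℝ) < N := by exact_mod_cast hN
  have hi' : (i : ℝ) + 1 ≤ N := by exact_mod_cast hi
  intro x hx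
  refine ⟨lt_of_le_of_lt (by positivity) hx.1, hx.2.trans_le ?_⟩
  rw [div_le_one hN']
  exact hi'

theorem sum_slobodeckijSq_cell_le {N : ℕ} (hN : 0 < N) (lam : ℝ) (p : ℝ → ℝ) :
    ∑ i ∈ Finset.range N, slobodeckijSq (Set.Ioo ((i : ℝ) / N) (((i : ℝ) + 1) / N)) lam p ≤
      slobodeckijSq Ω lam p := by
  unfold slobodeckijSq
  rw [← sum_lintegral_cell hN]
  exact Finset.sum_le_sum fun i hi => lintegral_mono fun x =>
    lintegral_mono_set (cell_subset_Ω hN (Finset.mem_range.1 hi))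

/-- Since w vanishes at the nodes, the interaction between cells reduces to Hardy integrals, which
the energies of the cells control. The L² part is included because the Hardy weight is at least 1 on
a cell of length at most 1. Scale invariance of the Hardy constant makes C independent of N. -/
theorem exists_energySq_le_sum {s : ℝ} (hs : 1 < s) : ∃ C : ℝ, 0 < C ∧
    ∀ (N : ℕ) (w : ℝ → ℝ), 0 < N → Continuous w → (∀ x ∉ Ω, w x = 0) →
      (∀ i ≤ N, w ((i : ℝ) / N) = 0) → energySq s w ≤ ENNReal.ofReal C *
        ∑ i ∈ Finset.range N,
          slobodeckijSq (Set.Ioo ((i : ℝ) / N) (((i : ℝ) + 1) / N)) (s / 2) w := by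
  obtain ⟨K, hK0, hK⟩ := exists_isHardyConst hs
  have hs0 : 0 < s := by linarith
  refine ⟨1 + (1 + 4 / s) * (2 * K), by positivity, fun N w hN hw h0 hnode => ?_⟩
  have hN' : (0 : ℝ) < N := by exact_mod_cast hN
  have hN1 : (1 : ℝ) ≤ N := by exact_mod_cast hN
  have h1 : ∫⁻ x, ‖w x‖ₑ ^ 2 ≤ ∑ i ∈ Finset.range N,
      (hardyLeft s w ((i : ℝ) / N) (((i : ℝ) + 1) / N) +
          hardyRight s w ((i : ℝ) / N) (((i : ℝ) + 1) / N)) := by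
    have e1 : ∫⁻ x, ‖w x‖ₑ ^ 2 = ∫⁻ x in Ω, ‖w x‖ₑ ^ 2 := by
      rw [← lintegral_indicator measurableSet_Ioo]
      refine lintegral_congr fun x => ?_
      by_cases hx : x ∈ Ω
      · rw [Set.indicator_of_mem hx]
      · rw [Set.indicator_of_notMem hx, h0 x hx]
        simp
    rw [e1, ← sum_lintegral_cell hN]
    refine Finset.sum_le_sum fun i hi => le_trans ?_ le_self_add
    refine setLIntegral_mono' measurableSet_Ioo fun x hx => ?_
    rw [hnode i (Finset.mem_range.1 hi).le, sub_zero, enorm_sq_eq_ofReal]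
    refine ENNReal.ofReal_le_ofReal (le_mul_of_one_le_right (sq_nonneg _) ?_)
    have hxp : 0 < x - (i : ℝ) / N := sub_pos.2 hx.1
    have hx1 : x - (i : ℝ) / N ≤ 1 := by
      have h2 := hx.2
      rw [add_div] at h2
      have : (1 : ℝ) / N ≤ 1 := by
        rw [div_le_one hN']
        exact hN1
      linarith
    exact Real.one_le_rpow_of_pos_of_le_one_of_nonpos hxp hx1 (by linarith)
  have h2 := slobodeckijSq_univ_le_sum hs0 hN hw.measurable h0 hnode
  have h3 : ∀ i ∈ Finset.range N, (hardyLeft s w ((i : ℝ) / N) (((i : ℝ) + 1) / N) +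
          hardyRight s w ((i : ℝ) / N) (((i : ℝ) + 1) / N)) ≤ ENNReal.ofReal (2 * K) *
        slobodeckijSq (Set.Ioo ((i : ℝ) / N) (((i : ℝ) + 1) / N)) (s / 2) w := by
    intro i _
    have hab : (i : ℝ) / N < ((i : ℝ) + 1) / N := by
      gcongr
      linarith
    refine (add_le_add (hK.left_of_continuous hK0 hw hab)
      (hK.right_of_continuous hK0 hw hab)).trans_eq ?_
    rw [← two_mul, ← mul_assoc, ENNReal.ofReal_mul zero_le_two]
    simp
  rw [energySq]
  refine (add_le_add h1 h2).trans ?_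
  rw [← Finset.sum_add_distrib, Finset.mul_sum]
  refine Finset.sum_le_sum fun i hi => ?_
  refine (add_le_add (h3 i hi) (add_le_add_right (mul_le_mul_right (h3 i hi) _) _)).trans_eq ?_
  rw [ENNReal.ofReal_add zero_le_one (by positivity), ENNReal.ofReal_mul (p := 1 + 4 / s)
    (by positivity), ENNReal.ofReal_add zero_le_one (by positivity)]
  simp only [ENNReal.ofReal_one]
  ring

/-- The piecewise linear nodal interpolant of `f` on the uniform mesh with `N` cells. -/
def nodalInterp (N : ℕ) (f : ℝ → ℝ) (x : ℝ) : ℝ :=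
  ∑ j ∈ Finset.range (N + 1), f ((j : ℝ) / N) * max 0 (1 - |N * x - j|)

theorem continuous_nodalInterp (N : ℕ) (f : ℝ → ℝ) : Continuous (nodalInterp N f) := by
  unfold nodalInterp
  fun_prop

theorem nodalInterp_eq_zero {N : ℕ} (hN : 0 < N) {f : ℝ → ℝ} (hf : ∀ x ∉ Ω, f x = 0) {x : ℝ}
    (hx : x ∉ Ω) : nodalInterp N f x = 0 := by
  have hN' : (0 : ℝ) < N := by exact_mod_cast hN
  refine Finset.sum_eq_zero fun j hj => ?_
  by_cases hjΩ : (j : ℝ) / N ∈ Ω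
  · have hj1 : (1 : ℝ) ≤ j := by
      have h := hjΩ.1
      have : 0 < j := by
        rcases Nat.eq_zero_or_pos j with h0 | h0
        · simp [h0] at h
        · exact h0
      exact_mod_cast this
    have hj2 : (j : ℝ) + 1 ≤ N := by
      have h := hjΩ.2
      rw [div_lt_one hN'] at h
      have : j < N := by exact_mod_cast h
      exact_mod_cast this
    have : 1 ≤ |N * x - j| := by
      rcases le_or_gt x 0 with h | h
      · rw [le_abs]
        right
        nlinarith
      · have : 1 ≤ x := by
          by_contra hc
          exact hx ⟨h, not_le.1 hc⟩
        rw [le_abs]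
        left
        nlinarith
    rw [max_eq_left (by linarith), mul_zero]
  · rw [hf _ hjΩ, zero_mul]

theorem nodalInterp_eq {N i : ℕ} (hN : 0 < N) (hi : i < N) (f : ℝ → ℝ) {x : ℝ}
    (hx : x ∈ Set.Icc ((i : ℝ) / N) (((i : ℝ) + 1) / N)) :
    nodalInterp N f x = f ((i : ℝ) / N) + (f (((i : ℝ) + 1) / N) - f ((i : ℝ) / N)) /
      (((i : ℝ) + 1) / N - (i : ℝ) / N) * (x - (i : ℝ) / N) := by
  have hN' : (0 : ℝ) < N := by exact_mod_cast hN
  have hx1 : (i : ℝ) ≤ N * x := by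
    have := hx.1
    rw [div_le_iff₀ hN'] at this
    linarith
  have hx2 : N * x ≤ (i : ℝ) + 1 := by
    have := hx.2
    rw [le_div_iff₀ hN'] at this
    linarith
  unfold nodalInterp
  rw [Finset.sum_eq_add i (i + 1) (by omega)]
  · push_cast
    rw [abs_of_nonneg (show 0 ≤ N * x - i by linarith),
      abs_of_nonpos (show N * x - (i + 1) ≤ 0 by linarith), max_eq_right (by linarith),
      max_eq_right (by linarith)]
    field_simp
    ring
  · rintro j hj ⟨h1, h2⟩
    have : 1 ≤ |N * x - j| := by
      rcases lt_or_gt_of_ne h1 with h | h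
      · have : (j : ℝ) + 1 ≤ i := by exact_mod_cast h
        rw [le_abs]
        left
        linarith
      · have : (i : ℝ) + 1 + 1 ≤ j := by
          have : i + 1 + 1 ≤ j := by omega
          exact_mod_cast this
        rw [le_abs]
        right
        linarith
    rw [max_eq_left (by linarith), mul_zero]
  · intro h
    exact absurd (Finset.mem_range.2 (by omega)) h
  · intro h
    exact absurd (Finset.mem_range.2 (by omega)) h

theorem nodalInterp_mem_feSpace {r N : ℕ} (hr : 1 ≤ r) (hN : 0 < N) {f : ℝ → ℝ}
    (hf : ∀ x ∉ Ω, f x = 0) : nodalInterp N f ∈ feSpace r N := by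
  refine ⟨(continuous_nodalInterp N f).continuousOn, nodalInterp_eq_zero hN hf (by simp),
    nodalInterp_eq_zero hN hf (by simp), fun i hi => ?_⟩
  refine ⟨Polynomial.C (f ((i : ℝ) / N)) + Polynomial.C ((f (((i : ℝ) + 1) / N) - f ((i : ℝ) / N)) /
      (((i : ℝ) + 1) / N - (i : ℝ) / N)) * (Polynomial.X - Polynomial.C ((i : ℝ) / N)), ?_, ?_⟩
  · refine le_trans ?_ hr
    compute_degree
  · intro x hx
    rw [nodalInterp_eq hN hi f hx]
    simp

/-- `E i` is the local quantity to be summed and `d` carries the power of the mesh size. Leaving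
both free lets the regimes γ < 1, γ = 1 and γ > 1 share one summation. -/
theorem exists_energySq_sub_nodalInterp_le {s : ℝ} (hs : 1 < s) : ∃ C : ℝ, 0 < C ∧
    ∀ (N : ℕ) (f : ℝ → ℝ) (d : ℝ) (E : ℕ → ℝ≥0∞) (T : ℝ≥0∞), 0 < N → Continuous f →
      (∀ x ∉ Ω, f x = 0) → (∑ i ∈ Finset.range N, E i ≤ T) → 0 ≤ d →
      (∀ i < N, slobodeckijSq (Set.Ioo ((i : ℝ) / N) (((i : ℝ) + 1) / N)) (s / 2)
        (interpError f ((i : ℝ) / N) (((i : ℝ) + 1) / N)) ≤ ENNReal.ofReal d * E i) →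
      energySq s (fun x => f x - nodalInterp N f x) ≤ ENNReal.ofReal (C * d) * T := by
  obtain ⟨C, hC0, hC⟩ := exists_energySq_le_sum hs
  refine ⟨C, hC0, fun N f d E T hN hf h0 hE hd hcell => ?_⟩
  have hN' : (0 : ℝ) < N := by exact_mod_cast hN
  have hw0 : ∀ x ∉ Ω, f x - nodalInterp N f x = 0 := fun x hx => by
    rw [h0 x hx, nodalInterp_eq_zero hN h0 hx, sub_zero]
  have hnode : ∀ i ≤ N, f ((i : ℝ) / N) - nodalInterp N f ((i : ℝ) / N) = 0 := by
    intro i hi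
    rcases hi.eq_or_lt with rfl | hi
    · refine hw0 _ ?_
      rw [div_self hN'.ne']
      simp
    · rw [nodalInterp_eq hN hi f ⟨le_rfl, by gcongr; linarith⟩]
      ring
  refine (hC N _ hN (hf.sub (continuous_nodalInterp N f)) hw0 hnode).trans ?_
  rw [ENNReal.ofReal_mul hC0.le, mul_assoc]
  refine mul_le_mul_right ?_ _
  refine le_trans ?_ (mul_le_mul_right hE _)
  rw [Finset.mul_sum]
  refine Finset.sum_le_sum fun i hi => ?_
  refine le_trans (le_of_eq ?_) (hcell i (Finset.mem_range.1 hi))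
  refine slobodeckijSq_congr measurableSet_Ioo fun x hx => ?_
  rw [Pi.sub_apply, nodalInterp_eq hN (Finset.mem_range.1 hi) f (Set.Ioo_subset_Icc_self hx), interpError]

/-! ### Convergence rate of the interpolant from Sobolev regularity. -/

theorem sq_rpow_half (a : ℝ≥0∞) : (a ^ (1 / 2 : ℝ)) ^ 2 = a := by
  rw [← ENNReal.rpow_natCast, ← ENNReal.rpow_mul]
  norm_num

/-- Here ⌊γ⌋ = 1. At γ = 1 the norm contains no double integral, hence the proviso in the last
clause. -/
theorem exists_weakDeriv_of_sobolevNorm_lt_top {γ : ℝ} (h1 : 1 ≤ γ) (h2 : γ < 2) {u : ℝ → ℝ}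
    (hu : sobolevNorm Ω γ u < ⊤) :
    ∃ W, IsWeakDeriv Ω 1 u W ∧ MemLp W 2 (volume.restrict Ω) ∧
      ∫⁻ x in Ω, ENNReal.ofReal (W x ^ 2) ≤ sobolevNorm Ω γ u ^ 2 ∧
      (γ ≠ 1 → slobodeckijSq Ω (γ - 1) W ≤ sobolevNorm Ω γ u ^ 2) := by
  have hfl : ⌊γ⌋₊ = 1 := by
    rw [Nat.floor_eq_iff (by linarith)]
    norm_num
    exact ⟨h1, h2⟩
  have hd : ∀ j ≤ ⌊γ⌋₊, ∃ w, IsWeakDeriv Ω j u w := by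
    by_contra h
    rw [sobolevNorm, if_neg h] at hu
    exact lt_irrefl _ hu
  obtain ⟨w, hw⟩ := hd 1 hfl.ge
  have hW := isWeakDeriv_weakDeriv hw
  set S := sobolevNorm Ω γ u with hS
  have hSq : S ^ 2 = ∑ j ∈ Finset.range (⌊γ⌋₊ + 1),
      eLpNorm (weakDeriv Ω j u) 2 (volume.restrict Ω) ^ 2 +
      if γ = ⌊γ⌋₊ then 0 else slobodeckijSq Ω (γ - ⌊γ⌋₊) (weakDeriv Ω ⌊γ⌋₊ u) := by
    rw [hS, sobolevNorm, if_pos hd, sq_rpow_half]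
  rw [hfl] at hSq
  rw [Finset.sum_range_succ] at hSq
  have hle : eLpNorm (weakDeriv Ω 1 u) 2 (volume.restrict Ω) ^ 2 ≤ S ^ 2 := by
    rw [hSq]
    exact le_add_self.trans le_self_add
  refine ⟨weakDeriv Ω 1 u, hW, ⟨hW.2.1.aestronglyMeasurable, ?_⟩, ?_, ?_⟩
  · have : eLpNorm (weakDeriv Ω 1 u) 2 (volume.restrict Ω) ≤ S :=
      (ENNReal.pow_le_pow_left_iff two_ne_zero).1 hle
    exact this.trans_lt hu
  · rw [eLpNorm_two_sq] at hle
    simpa only [enorm_sq_eq_ofReal] using hle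
  · intro hne
    rw [hSq, if_neg (by simpa using hne)]
    simp

/-- Continuity of f upgrades the primitive identity from almost every point of Ω to all of [0,1], in
particular to the nodes, where the interpolant is evaluated. -/
theorem exists_measurable_primitive {f u W : ℝ → ℝ} (hf : Continuous f)
    (hfu : f =ᵐ[volume.restrict Ω] u) (hW : IsWeakDeriv Ω 1 u W) (hWi : IntegrableOn W Ω) :
    ∃ p : ℝ → ℝ, Measurable p ∧ Integrable p ∧ p =ᵐ[volume.restrict Ω] W ∧
      ∀ x ∈ Set.Icc (0 : ℝ) 1, ∀ y ∈ Set.Icc (0 : ℝ) 1, f y - f x = ∫ t in x..y, p t := by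
  have hVi : Integrable (Ω.indicator W) := (integrable_indicator_iff measurableSet_Ioo).2 hWi
  obtain ⟨p, hpm, hpe⟩ := hVi.aestronglyMeasurable
  have hpi : Integrable p := hVi.congr hpe
  have hpW : p =ᵐ[volume.restrict Ω] W := by
    have := ae_restrict_of_ae (s := Ω) hpe
    filter_upwards [this, ae_restrict_mem measurableSet_Ioo] with x hx hxΩ
    rw [← hx, Set.indicator_of_mem hxΩ]
  have hWu := hW.congr_ae hfu.symm hpW.symm
  obtain ⟨c, hc⟩ := hWu.exists_ae_eq_primitive hpi.integrableOn
  have hcont : Continuous fun x => c + ∫ y in (0 : ℝ)..x, p y :=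
    continuous_const.add (intervalIntegral.continuous_primitive
      (fun a b => hpi.intervalIntegrable) 0)
  have heq : Set.EqOn f (fun x => c + ∫ y in (0 : ℝ)..x, p y) Ω :=
    Measure.eqOn_open_of_ae_eq hc isOpen_Ioo hf.continuousOn hcont.continuousOn
  have heq' : Set.EqOn f (fun x => c + ∫ y in (0 : ℝ)..x, p y) (Set.Icc 0 1) := by
    have := heq.closure hf hcont
    rwa [closure_Ioo (by norm_num)] at this
  refine ⟨p, hpm.measurable, hpi, hpW, fun x hx y hy => ?_⟩
  rw [heq' hx, heq' hy]
  simp only [add_sub_add_left_eq_sub]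
  exact intervalIntegral.integral_interval_sub_left hpi.intervalIntegrable hpi.intervalIntegrable

/-- The nodal interpolant approximates with the optimal order. -/
theorem exists_nodalInterp_error_le {s γ : ℝ} (hs : 1 < s) (hs₂ : s < 2) (hγ : s / 2 ≤ γ)
    (hγ₂ : γ < 2) : ∃ C : ℝ, 0 < C ∧ ∀ (N : ℕ) (f u : ℝ → ℝ), 0 < N → Continuous f →
      (∀ x ∉ Ω, f x = 0) → f =ᵐ[volume.restrict Ω] u →
      energySq s (fun x => f x - nodalInterp N f x) ≤
        ENNReal.ofReal (C * (1 / (N : ℝ)) ^ (2 * γ - s)) * sobolevNorm Ω γ u ^ 2 := by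
  obtain ⟨C₁, hC₁, hmain⟩ := exists_energySq_sub_nodalInterp_le hs
  obtain ⟨K, hK0, hK⟩ := exists_isHardyConst hs
  have hs1 : 0 < s - 1 := by linarith
  have hs2 : 0 < 2 - s := by linarith
  -- Dominates the local constants of all three regimes of γ.
  set D : ℝ := (2 + 16 * K / (2 - s)) + 8 / ((s - 1) * (2 - s)) with hD
  have hD1 : 0 ≤ 2 + 16 * K / (2 - s) := by positivity
  have hD2 : 0 ≤ 8 / ((s - 1) * (2 - s)) := by positivity
  have hD0 : 0 < D := by positivity
  refine ⟨C₁ * D, by positivity, fun N f u hN hf h0 hfu => ?_⟩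
  have hN' : (0 : ℝ) < N := by exact_mod_cast hN
  have hh : (0 : ℝ) < 1 / N := by positivity
  rcases eq_or_ne (sobolevNorm Ω γ u) ⊤ with htop | htop
  · rw [htop, ENNReal.top_pow two_ne_zero, ENNReal.mul_top]
    · exact le_top
    · rw [ne_eq, ENNReal.ofReal_eq_zero, not_le]
      positivity
  have hfin : sobolevNorm Ω γ u < ⊤ := lt_top_iff_ne_top.2 htop
  have hlen : ∀ i : ℕ, ((i : ℝ) + 1) / N - (i : ℝ) / N = 1 / N := fun i => by ring
  have hlt : ∀ i : ℕ, (i : ℝ) / N < ((i : ℝ) + 1) / N := fun i => by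
    gcongr
    linarith
  rw [mul_assoc]
  -- For γ < 1 stability of interpolation is enough, and the power of h comes from comparing |x-y|
  -- with the cell diameter. For γ ≥ 1 it comes from the oscillation of the derivative within a
  -- cell.
  rcases lt_or_ge γ 1 with hγ1 | hγ1
  · refine hmain N f _ (fun i => slobodeckijSq (Set.Ioo ((i : ℝ) / N) (((i : ℝ) + 1) / N)) γ f)
      _ hN hf h0 ?_ (by positivity) fun i hi => ?_
    · refine (sum_slobodeckijSq_cell_le hN γ f).trans ?_
      rw [sobolevNorm_eq_of_lt_one isOpen_Ioo (by linarith) hγ1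
        (locallyIntegrableOn_of_sobolevNorm_lt_top hfin), sq_rpow_half,
        slobodeckijSq_congr_ae hfu]
      exact le_add_self
    · refine (hK.slobodeckijSq_interpError_le hs hs₂ hK0 hf (hlt i)).trans ?_
      refine (mul_le_mul_right (slobodeckijSq_half_le_of_le hγ f) _).trans ?_
      rw [hlen, ← mul_assoc, ← ENNReal.ofReal_mul hD1]
      refine mul_le_mul_left (ENNReal.ofReal_le_ofReal ?_) _
      exact mul_le_mul_of_nonneg_right (by linarith) (Real.rpow_nonneg hh.le _)
  · obtain ⟨W, hW, hW2, hWS, hWslob⟩ := exists_weakDeriv_of_sobolevNorm_lt_top hγ1 hγ₂ hfin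
    obtain ⟨p, hpm, hpi, hpW, hpf⟩ := exists_measurable_primitive hf hfu hW
      (hW2.integrable one_le_two)
    have hcell : ∀ i < N, slobodeckijSq (Set.Ioo ((i : ℝ) / N) (((i : ℝ) + 1) / N)) (s / 2)
        (interpError f ((i : ℝ) / N) (((i : ℝ) + 1) / N)) ≤
        ENNReal.ofReal (2 / ((s - 1) * (2 - s)) * (1 / N) ^ (1 - s)) *
          ∫⁻ t in Set.Ioo ((i : ℝ) / N) (((i : ℝ) + 1) / N),
            ∫⁻ y in Set.Ioo ((i : ℝ) / N) (((i : ℝ) + 1) / N), ENNReal.ofReal ((p t - p y) ^ 2) := by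
      intro i hi
      have hsub : Set.Icc ((i : ℝ) / N) (((i : ℝ) + 1) / N) ⊆ Set.Icc 0 1 := by
        have := closure_mono (cell_subset_Ω hN hi)
        rwa [closure_Ioo (hlt i).ne, closure_Ioo (by norm_num)] at this
      have := slobodeckijSq_interpError_le_of_primitive hs hs₂ (hlt i) hpm hpi.integrableOn
        fun x hx y hy => hpf x (hsub hx) y (hsub hy)
      rwa [hlen] at this
    rcases eq_or_ne γ 1 with hγe | hγne
    · refine hmain N f _ (fun i => ∫⁻ t in Set.Ioo ((i : ℝ) / N) (((i : ℝ) + 1) / N),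
        ENNReal.ofReal (p t ^ 2)) _ hN hf h0 ?_ (by positivity) fun i hi => ?_
      · rw [sum_lintegral_cell hN]
        refine le_trans (le_of_eq ?_) hWS
        refine lintegral_congr_ae ?_
        filter_upwards [hpW] with x hx
        rw [hx]
      · refine (hcell i hi).trans ?_
        refine (mul_le_mul_right (lintegral_sq_sub_le_lintegral_sq hpm) _).trans ?_
        rw [hlen, ← mul_assoc, ← ENNReal.ofReal_mul (by positivity)]
        refine mul_le_mul_left (ENNReal.ofReal_le_ofReal ?_) _
        have e : 2 / ((s - 1) * (2 - s)) * (1 / (N : ℝ)) ^ (1 - s) * (4 * (1 / N)) =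
            8 / ((s - 1) * (2 - s)) * (1 / (N : ℝ)) ^ (2 * γ - s) := by
          rw [hγe, show 2 * 1 - s = 1 - s + 1 by ring, Real.rpow_add hh, Real.rpow_one]
          ring
        rw [e]
        exact mul_le_mul_of_nonneg_right (by linarith) (Real.rpow_nonneg hh.le _)
    · refine hmain N f _ (fun i => slobodeckijSq (Set.Ioo ((i : ℝ) / N) (((i : ℝ) + 1) / N))
        (γ - 1) p) _ hN hf h0 ?_ (by positivity) fun i hi => ?_
      · refine (sum_slobodeckijSq_cell_le hN (γ - 1) p).trans ?_
        rw [slobodeckijSq_congr_ae hpW]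
        exact hWslob hγne
      · refine (hcell i hi).trans ?_
        refine (mul_le_mul_right (lintegral_sq_sub_le_slobodeckijSq (lam := γ - 1)
          (by linarith) p) _).trans ?_
        rw [hlen, ← mul_assoc, ← ENNReal.ofReal_mul (by positivity)]
        refine mul_le_mul_left (ENNReal.ofReal_le_ofReal ?_) _
        rw [mul_assoc, ← Real.rpow_add hh, show 1 - s + (1 + 2 * (γ - 1)) = 2 * γ - s by ring]
        refine mul_le_mul_of_nonneg_right ?_ (Real.rpow_nonneg hh.le _)
        have : 2 / ((s - 1) * (2 - s)) ≤ 8 / ((s - 1) * (2 - s)) := by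
          gcongr
          norm_num
        linarith

/-! ### Continuous representatives -/

theorem indicator_Ω_ae_eq {f u : ℝ → ℝ} (h0 : ∀ x ∉ Ω, f x = 0)
    (hfu : f =ᵐ[volume.restrict Ω] u) : Ω.indicator u =ᵐ[volume] f := by
  filter_upwards [(ae_restrict_iff' measurableSet_Ioo).1 hfu] with x hx
  by_cases hxΩ : x ∈ Ω
  · rw [Set.indicator_of_mem hxΩ, hx hxΩ]
  · rw [Set.indicator_of_notMem hxΩ, h0 x hxΩ]

theorem energySq_congr_ae {s : ℝ} {f g : ℝ → ℝ} (h : f =ᵐ[volume] g) :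
    energySq s f = energySq s g := by
  unfold energySq
  congr 1
  · refine lintegral_congr_ae ?_
    filter_upwards [h] with x hx
    rw [hx]
  · refine slobodeckijSq_congr_ae ?_
    rwa [Measure.restrict_univ]

theorem tildeNorm_eq {s : ℝ} (hs : 0 < s) (hs₂ : s < 2) {f u : ℝ → ℝ} (hf : Continuous f)
    (h0 : ∀ x ∉ Ω, f x = 0) (hfu : f =ᵐ[volume.restrict Ω] u) :
    tildeNorm (s / 2) u = energySq s f ^ (1 / 2 : ℝ) := by
  have hae := indicator_Ω_ae_eq h0 hfu
  have hloc : LocallyIntegrableOn (Ω.indicator u) Set.univ := by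
    refine LocallyIntegrableOn.congr_ae (u := f) (hf.locallyIntegrable.locallyIntegrableOn _) ?_
    rw [Measure.restrict_univ]
    exact hae.symm
  rw [tildeNorm, sobolevNorm_eq_of_lt_one isOpen_univ (by linarith) (by linarith) hloc,
    ← energySq_congr_ae hae, energySq, Measure.restrict_univ, eLpNorm_two_sq]

/-- The continuous representative of the extension by zero vanishes almost everywhere outside [0,1],
hence everywhere on (-∞,0] and [1,∞). This is the source of the boundary values u(0) = u(1) = 0. -/
theorem MemTilde.exists_isEnergyFun {s : ℝ} (hs : 1 < s) (hs₂ : s < 2) {u : ℝ → ℝ}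
    (hu : MemTilde (s / 2) u) :
    ∃ f, IsEnergyFun (s / 2) f ∧ f =ᵐ[volume.restrict Ω] u := by
  have hloc := locallyIntegrableOn_of_sobolevNorm_lt_top hu
  have hfin : slobodeckijSq Set.univ (s / 2) (Ω.indicator u) < ⊤ := by
    have h1 := hu
    rw [MemTilde, tildeNorm, sobolevNorm_eq_of_lt_one isOpen_univ (by linarith) (by linarith)
      hloc] at h1
    have h2 := (ENNReal.rpow_lt_top_iff_of_pos (by norm_num)).1 h1
    exact lt_of_le_of_lt le_add_self h2
  have hm := hloc.aestronglyMeasurable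
  rw [Measure.restrict_univ] at hm
  obtain ⟨U, hUm, hUe⟩ := hm
  have hUfin : slobodeckijSq Set.univ (s / 2) U < ⊤ := by
    rwa [slobodeckijSq_congr_ae (w' := Ω.indicator u)]
    rw [Measure.restrict_univ]
    exact hUe.symm
  obtain ⟨f, hf, hfU⟩ := exists_continuous_ae_eq hs hUm.measurable hUfin
  have hfu : f =ᵐ[volume] Ω.indicator u := hfU.trans hUe.symm
  have hzero : ∀ V : Set ℝ, IsOpen V → Disjoint V Ω → ∀ x ∈ closure V, f x = 0 := by
    intro V hV hd
    have h1 : f =ᵐ[volume.restrict V] fun _ => 0 := by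
      filter_upwards [ae_restrict_of_ae hfu, ae_restrict_mem hV.measurableSet] with x hx hxV
      rw [hx, Set.indicator_of_notMem (Set.disjoint_left.1 hd hxV)]
    have h2 := Measure.eqOn_open_of_ae_eq h1 hV hf.continuousOn continuousOn_const
    exact fun x hx => h2.closure hf continuous_const hx
  have hl := hzero (Set.Iio 0) isOpen_Iio
    (Set.disjoint_left.2 fun x h1 h2 => lt_asymm h1 h2.1)
  have hr := hzero (Set.Ioi 1) isOpen_Ioi
    (Set.disjoint_left.2 fun x h1 h2 => lt_asymm h1 h2.2)
  rw [closure_Iio] at hl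
  rw [closure_Ioi] at hr
  refine ⟨f, ⟨hf, fun x hx => ?_, ?_⟩, ?_⟩
  · rcases le_or_gt x 0 with h | h
    · exact hl x h
    · refine hr x ?_
      by_contra hc
      exact hx ⟨h, not_le.1 hc⟩
  · rwa [slobodeckijSq_congr_ae (w' := U)]
    rwa [Measure.restrict_univ]
  · filter_upwards [ae_restrict_of_ae hfu, ae_restrict_mem measurableSet_Ioo] with x hx hxΩ
    rw [hx, Set.indicator_of_mem hxΩ]

theorem IsEnergyFun.energySq_lt_top {s : ℝ} {f : ℝ → ℝ} (hf : IsEnergyFun (s / 2) f) :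
    energySq s f < ⊤ := by
  have h := (hf.memLp 2).2
  rw [energySq, ← eLpNorm_two_sq]
  exact ENNReal.add_lt_top.2 ⟨ENNReal.pow_lt_top h, hf.lt_top⟩

theorem IsEnergyFun.linear_comb {β : ℝ} {f g : ℝ → ℝ} (hf : IsEnergyFun β f)
    (hg : IsEnergyFun β g) (a b : ℝ) : IsEnergyFun β fun x => a * f x + b * g x := by
  refine ⟨(hf.continuous.const_mul a).add (hg.continuous.const_mul b), fun x hx => ?_, ?_⟩
  · rw [hf.eq_zero x hx, hg.eq_zero x hx]
    simp
  · refine lt_of_le_of_lt (slobodeckijSq_add_le _ _ (hf.continuous.const_mul a).measurable) ?_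
    rw [slobodeckijSq_const_mul, slobodeckijSq_const_mul]
    exact ENNReal.add_lt_top.2
      ⟨ENNReal.mul_lt_top ENNReal.ofNat_lt_top (ENNReal.mul_lt_top ENNReal.ofReal_lt_top hf.lt_top),
      ENNReal.mul_lt_top ENNReal.ofNat_lt_top (ENNReal.mul_lt_top ENNReal.ofReal_lt_top hg.lt_top)⟩

theorem IsEnergyFun.sub {β : ℝ} {f g : ℝ → ℝ} (hf : IsEnergyFun β f) (hg : IsEnergyFun β g) :
    IsEnergyFun β fun x => f x - g x := by
  have := hf.linear_comb hg 1 (-1)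
  simpa only [one_mul, neg_one_mul, ← sub_eq_add_neg] using this

theorem IsEnergyFun.memTilde {s : ℝ} (hs : 0 < s) (hs₂ : s < 2) {f u : ℝ → ℝ}
    (hf : IsEnergyFun (s / 2) f) (hfu : f =ᵐ[volume.restrict Ω] u) : MemTilde (s / 2) u := by
  rw [MemTilde, tildeNorm_eq hs hs₂ hf.continuous hf.eq_zero hfu]
  exact ENNReal.rpow_lt_top_of_nonneg (by norm_num) hf.energySq_lt_top.ne

theorem sobolevNorm_Ω_le {s : ℝ} (hs : 0 < s) (hs₂ : s < 2) {f u : ℝ → ℝ} (hf : Continuous f)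
    (hfu : f =ᵐ[volume.restrict Ω] u) :
    sobolevNorm Ω (s / 2) u ≤ energySq s f ^ (1 / 2 : ℝ) := by
  have hloc : LocallyIntegrableOn u Ω :=
    LocallyIntegrableOn.congr_ae (hf.locallyIntegrable.locallyIntegrableOn _) hfu
  rw [sobolevNorm_eq_of_lt_one isOpen_Ioo (by linarith) (by linarith) hloc]
  refine ENNReal.rpow_le_rpow ?_ (by norm_num)
  rw [← slobodeckijSq_congr_ae hfu, ← eLpNorm_congr_ae hfu, eLpNorm_two_sq, energySq]
  exact add_le_add (setLIntegral_le_lintegral _ _) (slobodeckijSq_mono (Set.subset_univ _) _ _)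

/-! ### Finite element functions -/

theorem exists_abs_eval_sub_le (p : Polynomial ℝ) : ∃ L : ℝ, 0 ≤ L ∧
    ∀ x ∈ Set.Icc (0 : ℝ) 1, ∀ y ∈ Set.Icc (0 : ℝ) 1, |p.eval y - p.eval x| ≤ L * |y - x| := by
  obtain ⟨C, hC⟩ := (isCompact_Icc (a := (0 : ℝ)) (b := 1)).exists_bound_of_continuousOn
    p.derivative.continuous.continuousOn
  refine ⟨C, (norm_nonneg _).trans (hC 0 (by simp)), fun x hx y hy => ?_⟩
  exact (convex_Icc (0 : ℝ) 1).norm_image_sub_le_of_norm_hasDerivWithin_le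
    (fun z _ => (p.hasDerivAt z).hasDerivWithinAt) hC hx hy

/-- Polynomials are Lipschitz on each cell, and the cells are chained through the nodes by
induction. The constant depends on v; it serves only to show that the energy is finite. -/
theorem exists_lipschitz_of_mem_feSpace {r N : ℕ} (hN : 0 < N) {v : ℝ → ℝ}
    (hv : v ∈ feSpace r N) : ∃ L : ℝ, 0 ≤ L ∧
    ∀ x ∈ Set.Icc (0 : ℝ) 1, ∀ y ∈ Set.Icc (0 : ℝ) 1, |v x - v y| ≤ L * |x - y| := by
  have hN' : (0 : ℝ) < N := by exact_mod_cast hN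
  obtain ⟨-, -, -, hp⟩ := hv
  have hcell : ∀ i : ℕ, ∃ L : ℝ, 0 ≤ L ∧ (i < N → ∀ x y : ℝ, (i : ℝ) / N ≤ x → x ≤ y →
      y ≤ ((i : ℝ) + 1) / N → |v y - v x| ≤ L * (y - x)) := by
    intro i
    by_cases hi : i < N
    · obtain ⟨p, -, hpe⟩ := hp i hi
      obtain ⟨L, hL0, hL⟩ := exists_abs_eval_sub_le p
      refine ⟨L, hL0, fun _ x y h1 h2 h3 => ?_⟩
      have hi' : ((i : ℝ) + 1) / N ≤ 1 := by
        rw [div_le_one hN']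
        exact_mod_cast hi
      have h0 : 0 ≤ (i : ℝ) / N := by positivity
      rw [hpe x ⟨h1, h2.trans h3⟩, hpe y ⟨h1.trans h2, h3⟩]
      have := hL x ⟨by linarith, by linarith⟩ y ⟨by linarith, by linarith⟩
      rwa [abs_of_nonneg (sub_nonneg.2 h2)] at this
    · exact ⟨0, le_rfl, fun h => absurd h hi⟩
  choose L hL0 hL using hcell
  set M := ∑ i ∈ Finset.range N, L i with hM
  have hLM : ∀ i < N, L i ≤ M := fun i hi =>
    Finset.single_le_sum (fun j _ => hL0 j) (Finset.mem_range.2 hi)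
  have key : ∀ k : ℕ, k ≤ N → ∀ x y : ℝ, 0 ≤ x → x ≤ y → y ≤ (k : ℝ) / N →
      |v y - v x| ≤ M * (y - x) := by
    intro k
    induction k with
    | zero =>
      intro _ x y h1 h2 h3
      simp only [Nat.cast_zero, zero_div] at h3
      have : x = y := by linarith
      simp [this]
    | succ k ih =>
      intro hk x y h1 h2 h3
      push_cast at h3
      have hstep : ∀ x y : ℝ, (k : ℝ) / N ≤ x → x ≤ y → y ≤ ((k : ℝ) + 1) / N →
          |v y - v x| ≤ M * (y - x) := fun x y h1 h2 h3 =>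
        (hL k hk x y h1 h2 h3).trans
          (mul_le_mul_of_nonneg_right (hLM k hk) (by linarith))
      rcases le_total y ((k : ℝ) / N) with hy | hy
      · exact ih (by omega) x y h1 h2 hy
      rcases le_total ((k : ℝ) / N) x with hx | hx
      · exact hstep x y hx h2 h3
      · have e1 := ih (by omega) x _ h1 hx le_rfl
        have e2 := hstep _ y le_rfl hy h3
        have e3 := abs_sub_le (v y) (v ((k : ℝ) / N)) (v x)
        nlinarith
  refine ⟨M, Finset.sum_nonneg fun i _ => hL0 i, fun x hx y hy => ?_⟩
  have hNN : (N : ℝ) / N = 1 := div_self hN'.ne'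
  rcases le_total x y with h | h
  · rw [abs_sub_comm, abs_sub_comm x y, abs_of_nonneg (sub_nonneg.2 h)]
    exact key N le_rfl x y hx.1 h (by rw [hNN]; exact hy.2)
  · rw [abs_of_nonneg (sub_nonneg.2 h)]
    exact key N le_rfl y x hy.1 h (by rw [hNN]; exact hx.2)

theorem continuous_indicator_Ω {v : ℝ → ℝ} (hv : ContinuousOn v (Set.Icc 0 1)) (h0 : v 0 = 0)
    (h1 : v 1 = 0) : Continuous (Ω.indicator v) := by
  have hp : Continuous fun x : ℝ => v (max 0 (min 1 x)) :=
    hv.comp_continuous (by fun_prop) fun x => ⟨le_max_left _ _, max_le zero_le_one (min_le_left _ _)⟩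
  convert hp using 1
  ext x
  by_cases hx : x ∈ Ω
  · rw [Set.indicator_of_mem hx, min_eq_right hx.2.le, max_eq_right hx.1.le]
  · rw [Set.indicator_of_notMem hx]
    rcases le_or_gt x 0 with h | h
    · rw [min_eq_right (by linarith), max_eq_left h, h0]
    · have : 1 ≤ x := by
        by_contra hc
        exact hx ⟨h, not_le.1 hc⟩
      rw [min_eq_left this, max_eq_right zero_le_one, h1]

theorem isEnergyFun_of_mem_feSpace {s : ℝ} (hs : 1 < s) (hs₂ : s < 2) {r N : ℕ} (hN : 0 < N)
    {v : ℝ → ℝ} (hv : v ∈ feSpace r N) : IsEnergyFun (s / 2) (Ω.indicator v) := by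
  have hc : Continuous (Ω.indicator v) := continuous_indicator_Ω hv.1 hv.2.1 hv.2.2.1
  have hz : ∀ x ∉ Ω, Ω.indicator v x = 0 := fun x hx => Set.indicator_of_notMem hx _
  refine ⟨hc, hz, ?_⟩
  obtain ⟨C, -, hC⟩ := exists_energySq_le_sum hs
  obtain ⟨L, -, hL⟩ := exists_lipschitz_of_mem_feSpace hN hv
  -- On the mesh with one cell the nodes are 0 and 1, so this bounds the energy on the line by the
  -- energy on (0,1).
  have h1 := hC 1 (Ω.indicator v) one_pos hc hz (by
    intro i hi
    interval_cases i <;> simp)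
  have h2 : slobodeckijSq (Set.Ioo 0 1) (s / 2) (Ω.indicator v) < ⊤ := by
    refine lt_of_le_of_lt (slobodeckijSq_le_of_lipschitz hs₂ zero_le_one (m := L)
      fun x hx y hy => ?_) ENNReal.ofReal_lt_top
    rw [Set.indicator_of_mem hx, Set.indicator_of_mem hy]
    exact hL x (Set.Ioo_subset_Icc_self hx) y (Set.Ioo_subset_Icc_self hy)
  refine lt_of_le_of_lt (le_trans le_add_self h1) ?_
  rw [Finset.sum_range_one]
  simp only [Nat.cast_zero, Nat.cast_one, zero_add, div_one]
  exact ENNReal.mul_lt_top ENNReal.ofReal_lt_top h2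

theorem feSpace.sub_mem {r N : ℕ} {v w : ℝ → ℝ} (hv : v ∈ feSpace r N) (hw : w ∈ feSpace r N) :
    v - w ∈ feSpace r N := by
  obtain ⟨v1, v2, v3, v4⟩ := hv
  obtain ⟨w1, w2, w3, w4⟩ := hw
  refine ⟨v1.sub w1, by simp [v2, w2], by simp [v3, w3], fun i hi => ?_⟩
  obtain ⟨p, hp, hpe⟩ := v4 i hi
  obtain ⟨q, hq, hqe⟩ := w4 i hi
  refine ⟨p - q, (Polynomial.natDegree_sub_le p q).trans (max_le hp hq), fun x hx => ?_⟩
  rw [Pi.sub_apply, hpe x hx, hqe x hx, Polynomial.eval_sub]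

/-! ### The bilinear form -/

/-- The sign in the form and the sign in the right derivative cancel. -/
theorem formA_eq {s : ℝ} (hs₂ : s < 2) {u v WL WR : ℝ → ℝ}
    (hL : IsWeakDeriv Ω 1 (fracIntLeft (1 - s / 2) u) WL)
    (hR : IsWeakDeriv Ω 1 (fracIntRight (1 - s / 2) v) WR) :
    formA s u v = ∫ x in Ω, WL x * WR x := by
  have hfl : ⌊s / 2⌋₊ = 0 := Nat.floor_eq_zero.2 (by linarith)
  unfold formA rlDerivLeft rlDerivRight
  rw [hfl]
  simp only [Nat.cast_zero, zero_add, pow_one, neg_one_mul, mul_neg]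
  rw [integral_neg, neg_neg]
  refine integral_congr_ae ?_
  filter_upwards [hL.weakDeriv_ae_eq isOpen_Ioo, hR.weakDeriv_ae_eq isOpen_Ioo] with x h1 h2
  rw [h1, h2]

/-- The Cauchy-Schwarz inequality with explicit bounds. -/
theorem integral_abs_mul_le_sqrt {α : Type*} [MeasurableSpace α] {μ : Measure α} {F G : α → ℝ}
    {A B : ℝ} (hF : AEStronglyMeasurable F μ) (hG : AEStronglyMeasurable G μ)
    (hA : ∫⁻ x, ENNReal.ofReal (F x ^ 2) ∂μ ≤ ENNReal.ofReal A)
    (hB : ∫⁻ x, ENNReal.ofReal (G x ^ 2) ∂μ ≤ ENNReal.ofReal B) :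
    Integrable (fun x => F x * G x) μ ∧ ∫ x, |F x * G x| ∂μ ≤ √A * √B := by
  have h1 := sq_lintegral_mul_le hF.enorm hG.enorm
  simp only [enorm_sq_eq_ofReal] at h1
  have hsq : ∀ A : ℝ, ENNReal.ofReal A = ENNReal.ofReal (√A) ^ 2 := by
    intro A
    rw [← ENNReal.ofReal_pow (Real.sqrt_nonneg _)]
    rcases le_total 0 A with h | h
    · rw [Real.sq_sqrt h]
    · rw [Real.sqrt_eq_zero_of_nonpos h, ENNReal.ofReal_of_nonpos h]
      simp
  have h2 : ∫⁻ x, ‖F x * G x‖ₑ ∂μ ≤ ENNReal.ofReal (√A * √B) := by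
    have h3 := h1.trans (mul_le_mul' hA hB)
    rw [hsq A, hsq B, ← mul_pow, ENNReal.pow_le_pow_left_iff two_ne_zero,
      ← ENNReal.ofReal_mul (Real.sqrt_nonneg _)] at h3
    simpa only [enorm_mul] using h3
  refine ⟨⟨hF.mul hG, h2.trans_lt ENNReal.ofReal_lt_top⟩, ?_⟩
  have h4 := (ofReal_integral_norm_eq_lintegral_enorm
    (⟨hF.mul hG, h2.trans_lt ENNReal.ofReal_lt_top⟩ : Integrable (fun x => F x * G x) μ))
  rw [← h4, ENNReal.ofReal_le_ofReal_iff (by positivity)] at h2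
  exact h2

/-- The `H^{s/2}(ℝ)` norm as a real number. -/
def energyNorm (s : ℝ) (f : ℝ → ℝ) : ℝ := √(energySq s f).toReal

theorem energyNorm_nonneg (s : ℝ) (f : ℝ → ℝ) : 0 ≤ energyNorm s f := Real.sqrt_nonneg _

theorem IsEnergyFun.energySq_toReal {s : ℝ} {f : ℝ → ℝ} (hf : IsEnergyFun (s / 2) f) :
    (energySq s f).toReal = (∫⁻ x, ‖f x‖ₑ ^ 2).toReal +
      (slobodeckijSq Set.univ (s / 2) f).toReal := by
  have h := hf.energySq_lt_top
  rw [energySq, ENNReal.add_lt_top] at h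
  rw [energySq, ENNReal.toReal_add h.1.ne h.2.ne]

theorem IsEnergyFun.sqrt_slobodeckijSq_le {s : ℝ} {f : ℝ → ℝ} (hf : IsEnergyFun (s / 2) f) :
    √(slobodeckijSq Set.univ (s / 2) f).toReal ≤ energyNorm s f := by
  refine Real.sqrt_le_sqrt ?_
  rw [hf.energySq_toReal]
  linarith [ENNReal.toReal_nonneg (a := ∫⁻ x, ‖f x‖ₑ ^ 2)]

theorem toReal_tildeNorm {s : ℝ} (hs : 0 < s) (hs₂ : s < 2) {f u : ℝ → ℝ} (hf : Continuous f)
    (h0 : ∀ x ∉ Ω, f x = 0) (hfu : f =ᵐ[volume.restrict Ω] u) :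
    (tildeNorm (s / 2) u).toReal = energyNorm s f := by
  rw [tildeNorm_eq hs hs₂ hf h0 hfu, energyNorm, Real.sqrt_eq_rpow, ENNReal.toReal_rpow]

theorem exists_abs_formA_le {s : ℝ} (hs : 0 < s) (hs₂ : s < 2) : ∃ C : ℝ, 0 < C ∧
    ∀ f g : ℝ → ℝ, IsEnergyFun (s / 2) f → IsEnergyFun (s / 2) g →
      |formA s f g| ≤ C * energyNorm s f * energyNorm s g := by
  obtain ⟨C₁, hC₁, H₁⟩ := exists_isWeakDeriv_fracIntLeft (β := s / 2) (by linarith) (by linarith)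
  obtain ⟨C₂, hC₂, H₂⟩ := exists_isWeakDeriv_fracIntRight (β := s / 2) (by linarith) (by linarith)
  refine ⟨√C₁ * √C₂, by positivity, fun f g hf hg => ?_⟩
  obtain ⟨WL, hL2, hL, hLb⟩ := H₁ f hf
  obtain ⟨WR, hR2, hR, hRb⟩ := H₂ g hg
  have hconv : ∀ {W h : ℝ → ℝ} {C : ℝ}, 0 < C → IsEnergyFun (s / 2) h →
      eLpNorm W 2 (volume.restrict Ω) ^ 2 ≤
          ENNReal.ofReal C * slobodeckijSq Set.univ (s / 2) h →
      ∫⁻ x in Ω, ENNReal.ofReal (W x ^ 2) ≤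
        ENNReal.ofReal (C * (slobodeckijSq Set.univ (s / 2) h).toReal) := by
    intro W h C hC hh hb
    rw [eLpNorm_two_sq] at hb
    simp only [enorm_sq_eq_ofReal] at hb
    rwa [ENNReal.ofReal_mul hC.le, ENNReal.ofReal_toReal hh.lt_top.ne]
  have hcs := (integral_abs_mul_le_sqrt hL2.1 hR2.1 (hconv hC₁ hf hLb) (hconv hC₂ hg hRb)).2
  rw [formA_eq hs₂ hL hR]
  refine (abs_integral_le_integral_abs).trans (hcs.trans ?_)
  rw [Real.sqrt_mul hC₁.le, Real.sqrt_mul hC₂.le]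
  have h1 := hf.sqrt_slobodeckijSq_le
  have h2 := hg.sqrt_slobodeckijSq_le
  calc _ = √C₁ * √C₂ * (√(slobodeckijSq Set.univ (s / 2) f).toReal *
        √(slobodeckijSq Set.univ (s / 2) g).toReal) := by ring
    _ ≤ √C₁ * √C₂ * (energyNorm s f * energyNorm s g) := by
        gcongr
        exact energyNorm_nonneg s f
    _ = _ := by ring

theorem formA_congr {s : ℝ} (hs : 0 < s) (hs₂ : s < 2) {f g u v : ℝ → ℝ}
    (hf : IsEnergyFun (s / 2) f) (hg : IsEnergyFun (s / 2) g) (hfu : f =ᵐ[volume.restrict Ω] u)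
    (hgv : g =ᵐ[volume.restrict Ω] v) : formA s u v = formA s f g := by
  obtain ⟨C₁, -, H₁⟩ := exists_isWeakDeriv_fracIntLeft (β := s / 2) (by linarith) (by linarith)
  obtain ⟨C₂, -, H₂⟩ := exists_isWeakDeriv_fracIntRight (β := s / 2) (by linarith) (by linarith)
  obtain ⟨WL, -, hL, -⟩ := H₁ f hf
  obtain ⟨WR, -, hR, -⟩ := H₂ g hg
  rw [formA_eq hs₂ hL hR, formA_eq hs₂ (hL.fracIntLeft_congr hfu) (hR.fracIntRight_congr hgv)]

theorem formA_linear_comb_left {s : ℝ} (hs : 0 < s) (hs₂ : s < 2) {f g h : ℝ → ℝ}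
    (hf : IsEnergyFun (s / 2) f) (hg : IsEnergyFun (s / 2) g) (hh : IsEnergyFun (s / 2) h)
    (a b : ℝ) :
    formA s (fun x => a * f x + b * g x) h = a * formA s f h + b * formA s g h := by
  obtain ⟨C₁, -, H₁⟩ := exists_isWeakDeriv_fracIntLeft (β := s / 2) (by linarith) (by linarith)
  obtain ⟨C₂, -, H₂⟩ := exists_isWeakDeriv_fracIntRight (β := s / 2) (by linarith) (by linarith)
  obtain ⟨W, hW2, hW, -⟩ := H₁ f hf
  obtain ⟨Z, hZ2, hZ, -⟩ := H₁ g hg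
  obtain ⟨V, hV2, hV, -⟩ := H₂ h hh
  rw [formA_eq hs₂ hW hV, formA_eq hs₂ hZ hV, formA_eq hs₂
    (IsWeakDeriv.fracIntLeft_linear_comb (by linarith) hf.continuous hg.continuous hW hZ a b) hV,
    ← integral_const_mul, ← integral_const_mul, ← integral_add]
  · refine integral_congr_ae (Filter.Eventually.of_forall fun x => ?_)
    ring
  · exact (hW2.integrable_mul hV2).const_mul a
  · exact (hZ2.integrable_mul hV2).const_mul b

theorem formA_linear_comb_right {s : ℝ} (hs : 0 < s) (hs₂ : s < 2) {f g h : ℝ → ℝ}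
    (hf : IsEnergyFun (s / 2) f) (hg : IsEnergyFun (s / 2) g) (hh : IsEnergyFun (s / 2) h)
    (a b : ℝ) :
    formA s h (fun x => a * f x + b * g x) = a * formA s h f + b * formA s h g := by
  obtain ⟨C₁, -, H₁⟩ := exists_isWeakDeriv_fracIntLeft (β := s / 2) (by linarith) (by linarith)
  obtain ⟨C₂, -, H₂⟩ := exists_isWeakDeriv_fracIntRight (β := s / 2) (by linarith) (by linarith)
  obtain ⟨W, hW2, hW, -⟩ := H₂ f hf
  obtain ⟨Z, hZ2, hZ, -⟩ := H₂ g hg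
  obtain ⟨V, hV2, hV, -⟩ := H₁ h hh
  rw [formA_eq hs₂ hV hW, formA_eq hs₂ hV hZ, formA_eq hs₂ hV
    (IsWeakDeriv.fracIntRight_linear_comb (by linarith) hf.continuous hg.continuous hW hZ a b),
    ← integral_const_mul, ← integral_const_mul, ← integral_add]
  · refine integral_congr_ae (Filter.Eventually.of_forall fun x => ?_)
    ring
  · exact (hV2.integrable_mul hW2).const_mul a
  · exact (hV2.integrable_mul hZ2).const_mul b

/-! ### The Caputo test functions -/

theorem lintegral_Ω_rpow {c : ℝ} (hc : -1 < c) :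
    ∫⁻ x in Ω, ENNReal.ofReal (x ^ c) = ENNReal.ofReal (1 / (c + 1)) := by
  rw [lintegral_Ioo_zero_rpow hc zero_le_one, Real.one_rpow]

theorem lintegral_Ω_one_sub_rpow {c : ℝ} (hc : -1 < c) :
    ∫⁻ x in Ω, ENNReal.ofReal ((1 - x) ^ c) = ENNReal.ofReal (1 / (c + 1)) := by
  rw [← lintegral_Ω_rpow hc,
    ← (Measure.measurePreserving_sub_left volume (1 : ℝ)).setLIntegral_comp_preimage_emb
      (measurableEmbedding_subLeft (1 : ℝ))]
  have : (fun y : ℝ => 1 - y) ⁻¹' Ω = Ω := by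
    ext y
    simp only [Set.mem_preimage, Set.mem_Ioo]
    constructor <;> rintro ⟨h1, h2⟩ <;> constructor <;> linarith
  rw [this]
  simp only [sub_sub_cancel]

theorem caputoTest_congr {s : ℝ} {φ ψ : ℝ → ℝ} (h : φ =ᵐ[volume.restrict Ω] ψ) :
    caputoTest s φ =ᵐ[volume.restrict Ω] caputoTest s ψ := by
  have e : ∫ y in Ω, y ^ (1 - s) * φ y = ∫ y in Ω, y ^ (1 - s) * ψ y := by
    refine integral_congr_ae ?_
    filter_upwards [h] with x hx
    rw [hx]
  filter_upwards [h] with x hx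
  rw [caputoTest, caputoTest, e, hx]

theorem continuous_one_sub_rpow {c : ℝ} (hc : 0 < c) : Continuous fun x : ℝ => (1 - x) ^ c :=
  (continuous_const.sub continuous_id).rpow_const fun _ => Or.inr hc.le

theorem continuous_caputoTest {s : ℝ} (hs : 1 < s) {φ : ℝ → ℝ} (hφ : Continuous φ) :
    Continuous (caputoTest s φ) :=
  hφ.sub ((continuous_one_sub_rpow (by linarith)).const_mul _)

/-- The right derivative of (1-x)^{s-1} is a multiple of (1-x)^{s/2-1}, which is orthogonal to the
left derivative of f by `IsEnergyFun.integral_mul_one_sub_rpow_eq_zero`. -/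
theorem formA_caputoTest {s : ℝ} (hs : 1 < s) (hs₂ : s < 2) {f g u φ : ℝ → ℝ}
    (hf : IsEnergyFun (s / 2) f) (hg : IsEnergyFun (s / 2) g) (hfu : f =ᵐ[volume.restrict Ω] u)
    (hgφ : g =ᵐ[volume.restrict Ω] φ) : formA s u (caputoTest s φ) = formA s f g := by
  obtain ⟨C₁, -, H₁⟩ := exists_isWeakDeriv_fracIntLeft (β := s / 2) (by linarith) (by linarith)
  obtain ⟨C₂, -, H₂⟩ := exists_isWeakDeriv_fracIntRight (β := s / 2) (by linarith) (by linarith)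
  obtain ⟨W, hW2, hW, -⟩ := H₁ f hf
  obtain ⟨Z, hZ2, hZ, -⟩ := H₂ g hg
  obtain ⟨c, hc⟩ := exists_isWeakDeriv_fracIntRight_one_sub_rpow (β := s / 2) (by linarith)
  rw [show 2 * (s / 2) - 1 = s - 1 by ring] at hc
  set k := (∫ y in Ω, y ^ (1 - s) * g y) / ∫ y in Ω, y ^ (1 - s) * (1 - y) ^ (s - 1) with hk
  have hR := IsWeakDeriv.fracIntRight_linear_comb (by linarith) hg.continuous
    (continuous_one_sub_rpow (c := s - 1) (by linarith)) hZ hc 1 (-k)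
  have e : (fun y => 1 * g y + -k * (1 - y) ^ (s - 1)) = caputoTest s g := by
    ext y
    rw [caputoTest]
    ring
  rw [e] at hR
  have horth := hf.integral_mul_one_sub_rpow_eq_zero (by linarith) (by linarith) hW hW2
  have hp2 : ∫⁻ x in Ω, ENNReal.ofReal (((1 - x) ^ (s / 2 - 1)) ^ 2) ≤
      ENNReal.ofReal (1 / (s - 1)) := by
    have := lintegral_Ω_one_sub_rpow (c := s - 2) (by linarith)
    rw [show s - 2 + 1 = s - 1 by ring] at this
    rw [← this]
    refine setLIntegral_mono' measurableSet_Ioo fun x hx => ?_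
    rw [← Real.rpow_natCast, ← Real.rpow_mul (by linarith [hx.2])]
    refine le_of_eq ?_
    congr 2
    push_cast
    ring
  have hWb : ∫⁻ x in Ω, ENNReal.ofReal (W x ^ 2) ≤
      ENNReal.ofReal (eLpNorm W 2 (volume.restrict Ω) ^ 2).toReal := by
    rw [ENNReal.ofReal_toReal (ENNReal.pow_ne_top hW2.2.ne), eLpNorm_two_sq]
    simp only [enorm_sq_eq_ofReal]
    exact le_rfl
  have hmeas : Measurable fun x : ℝ => (1 - x) ^ (s / 2 - 1) := by fun_prop
  have hInt := (integral_abs_mul_le_sqrt hW2.1 hmeas.aestronglyMeasurable hWb hp2).1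
  rw [formA_eq hs₂ (hW.fracIntLeft_congr hfu) (hR.fracIntRight_congr (caputoTest_congr hgφ)),
    formA_eq hs₂ hW hZ]
  have hsplit : ∀ x, W x * (1 * Z x + -k * (c * (1 - x) ^ (s / 2 - 1))) =
      W x * Z x + (-k * c) * (W x * (1 - x) ^ (s / 2 - 1)) := fun x => by ring
  simp only [hsplit]
  have hi : Integrable (fun x => W x * Z x) (volume.restrict Ω) := hW2.integrable_mul hZ2
  rw [integral_add hi (hInt.const_mul _), integral_const_mul, horth, mul_zero, add_zero]

/-- Pairs with one point in (0,1] and one outside contribute to the energy on the line twice, by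
symmetry. As w vanishes outside, each contribution is 1/s times the sum of the two Hardy integrals.
The explicit constant is needed later to reach constant 1 in the Caputo case. -/
theorem IsEnergyFun.hardy_le {s : ℝ} (hs : 0 < s) {w : ℝ → ℝ} (hw : IsEnergyFun (s / 2) w) :
    hardyLeft s w 0 1 + hardyRight s w 0 1 ≤
      ENNReal.ofReal (s / 2) * slobodeckijSq Set.univ (s / 2) w := by
  have hwm := hw.continuous.measurable
  have hkm := measurable_slobodeckij_kernel hwm (1 + s)
  have h0 : w 0 = 0 := hw.eq_zero 0 (by simp)
  have h1 : w 1 = 0 := hw.eq_zero 1 (by simp)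
  have hext := lintegral_cell_exterior hs hwm h0 h1
  set I : Set ℝ := Set.Ioc 0 1 with hI
  have hIm : MeasurableSet I := measurableSet_Ioc
  have hwc : ∀ y ∈ Iᶜ, w y = 0 := fun y hy => hw.eq_zero y fun h => hy ⟨h.1, h.2.le⟩
  have e1 : ∫⁻ x in I, ∫⁻ y in Iᶜ, ENNReal.ofReal (w x ^ 2 / |x - y| ^ (1 + s)) ≤
      ∫⁻ x in I, slobodeckijAt Set.univ s w x := by
    refine lintegral_mono fun x => ?_
    unfold slobodeckijAt
    rw [Measure.restrict_univ]
    refine le_trans (le_of_eq ?_) (setLIntegral_le_lintegral Iᶜ _)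
    refine setLIntegral_congr_fun hIm.compl fun y hy => ?_
    simp only [hwc y hy, sub_zero]
  have e2 : ∫⁻ x in I, ∫⁻ y in Iᶜ, ENNReal.ofReal (w x ^ 2 / |x - y| ^ (1 + s)) ≤
      ∫⁻ x in Iᶜ, slobodeckijAt Set.univ s w x := by
    have hsw : ∫⁻ x in I, ∫⁻ y in Iᶜ, ENNReal.ofReal ((w x - w y) ^ 2 / |x - y| ^ (1 + s)) =
        ∫⁻ y in Iᶜ, ∫⁻ x in I, ENNReal.ofReal ((w x - w y) ^ 2 / |x - y| ^ (1 + s)) :=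
      lintegral_lintegral_swap hkm.aemeasurable
    have hl : ∫⁻ x in I, ∫⁻ y in Iᶜ, ENNReal.ofReal (w x ^ 2 / |x - y| ^ (1 + s)) =
        ∫⁻ x in I, ∫⁻ y in Iᶜ, ENNReal.ofReal ((w x - w y) ^ 2 / |x - y| ^ (1 + s)) := by
      refine lintegral_congr fun x => setLIntegral_congr_fun hIm.compl fun y hy => ?_
      simp only [hwc y hy, sub_zero]
    rw [hl, hsw]
    refine lintegral_mono fun y => ?_
    unfold slobodeckijAt
    rw [Measure.restrict_univ]
    refine le_trans (le_of_eq ?_) (setLIntegral_le_lintegral I _)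
    refine lintegral_congr fun x => ?_
    rw [abs_sub_comm, ← neg_sub (w y), neg_sq]
  have e3 : 2 * (ENNReal.ofReal (1 / s) * (hardyLeft s w 0 1 + hardyRight s w 0 1)) ≤
      slobodeckijSq Set.univ (s / 2) w := by
    rw [← hext, two_mul, slobodeckijSq_half, Measure.restrict_univ,
      ← lintegral_add_compl (slobodeckijAt Set.univ s w) hIm]
    exact add_le_add e1 e2
  refine le_trans (le_of_eq ?_) (mul_le_mul_right e3 _)
  rw [show (2 : ℝ≥0∞) = ENNReal.ofReal 2 by simp, ← mul_assoc, ← mul_assoc,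
    ← ENNReal.ofReal_mul (by positivity), ← ENNReal.ofReal_mul (by positivity),
    show s / 2 * 2 * (1 / s) = 1 by field_simp, ENNReal.ofReal_one, one_mul]

/-- Cauchy-Schwarz with the factors x^{-s/2} w and x^{1-s/2}: the first is a Hardy integral at 0,
and the square of the second integrates to 1/(3-s). -/
theorem IsEnergyFun.integral_rpow_mul_le {s : ℝ} (hs : 1 < s) (hs₂ : s < 2) {w : ℝ → ℝ}
    (hw : IsEnergyFun (s / 2) w) :
    |∫ x in Ω, x ^ (1 - s) * w x| ≤
      √(s / 2 * (slobodeckijSq Set.univ (s / 2) w).toReal) * √(1 / (3 - s)) := by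
  have hwm := hw.continuous.measurable
  have h0 : w 0 = 0 := hw.eq_zero 0 (by simp)
  have hA : ∫⁻ x in Ω, ENNReal.ofReal ((x ^ (-s / 2) * w x) ^ 2) ≤
      ENNReal.ofReal (s / 2 * (slobodeckijSq Set.univ (s / 2) w).toReal) := by
    rw [ENNReal.ofReal_mul (by linarith), ENNReal.ofReal_toReal hw.lt_top.ne]
    refine le_trans ?_ (hw.hardy_le (by linarith))
    refine le_trans (le_of_eq ?_) le_self_add
    refine setLIntegral_congr_fun measurableSet_Ioo fun x hx => ?_
    simp only [h0, sub_zero]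
    rw [mul_pow, ← Real.rpow_natCast (x ^ _), ← Real.rpow_mul hx.1.le, mul_comm]
    congr 3
    push_cast
    ring
  have hB : ∫⁻ x in Ω, ENNReal.ofReal ((x ^ (1 - s / 2)) ^ 2) ≤ ENNReal.ofReal (1 / (3 - s)) := by
    have := lintegral_Ω_rpow (c := 2 - s) (by linarith)
    rw [show 2 - s + 1 = 3 - s by ring] at this
    rw [← this]
    refine setLIntegral_mono' measurableSet_Ioo fun x hx => ?_
    rw [← Real.rpow_natCast, ← Real.rpow_mul hx.1.le]
    refine le_of_eq ?_
    congr 2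
    push_cast
    ring
  have m1 : Measurable fun x : ℝ => x ^ (-s / 2) * w x := by fun_prop
  have m2 : Measurable fun x : ℝ => x ^ (1 - s / 2) := by fun_prop
  have h := (integral_abs_mul_le_sqrt m1.aestronglyMeasurable m2.aestronglyMeasurable hA hB).2
  refine abs_integral_le_integral_abs.trans (le_trans (le_of_eq ?_) h)
  refine setIntegral_congr_fun measurableSet_Ioo fun x hx => ?_
  congr 1
  rw [mul_right_comm, ← Real.rpow_add hx.1]
  congr 2
  ring

/-- The factors are (1-x)^{-s/2} w and (1-x)^{3s/2-1}. Using Hardy at 1 rather than the L² norm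
keeps the bound in terms of the semi-norm alone, so the L² part remains free for the main term. -/
theorem IsEnergyFun.integral_mul_one_sub_rpow_le {s : ℝ} (hs : 1 < s) {w : ℝ → ℝ}
    (hw : IsEnergyFun (s / 2) w) :
    ∫ x in Ω, |w x * (1 - x) ^ (s - 1)| ≤
      √(s / 2 * (slobodeckijSq Set.univ (s / 2) w).toReal) * √(1 / (3 * s - 1)) := by
  have hwm := hw.continuous.measurable
  have h1 : w 1 = 0 := hw.eq_zero 1 (by simp)
  have hA : ∫⁻ x in Ω, ENNReal.ofReal (((1 - x) ^ (-s / 2) * w x) ^ 2) ≤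
      ENNReal.ofReal (s / 2 * (slobodeckijSq Set.univ (s / 2) w).toReal) := by
    rw [ENNReal.ofReal_mul (by linarith), ENNReal.ofReal_toReal hw.lt_top.ne]
    refine le_trans ?_ (hw.hardy_le (by linarith))
    refine le_trans (le_of_eq ?_) le_add_self
    refine setLIntegral_congr_fun measurableSet_Ioo fun x hx => ?_
    simp only [h1, sub_zero]
    rw [mul_pow, ← Real.rpow_natCast ((1 - x) ^ _), ← Real.rpow_mul (by linarith [hx.2]), mul_comm]
    congr 3
    push_cast
    ring
  have hB : ∫⁻ x in Ω, ENNReal.ofReal (((1 - x) ^ (3 * s / 2 - 1)) ^ 2) ≤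
      ENNReal.ofReal (1 / (3 * s - 1)) := by
    have := lintegral_Ω_one_sub_rpow (c := 3 * s - 2) (by linarith)
    rw [show 3 * s - 2 + 1 = 3 * s - 1 by ring] at this
    rw [← this]
    refine setLIntegral_mono' measurableSet_Ioo fun x hx => ?_
    rw [← Real.rpow_natCast, ← Real.rpow_mul (by linarith [hx.2])]
    refine le_of_eq ?_
    congr 2
    push_cast
    ring
  have m1 : Measurable fun x : ℝ => (1 - x) ^ (-s / 2) * w x := by fun_prop
  have m2 : Measurable fun x : ℝ => (1 - x) ^ (3 * s / 2 - 1) := by fun_prop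
  have h := (integral_abs_mul_le_sqrt m1.aestronglyMeasurable m2.aestronglyMeasurable hA hB).2
  refine le_trans (le_of_eq ?_) h
  refine setIntegral_congr_fun measurableSet_Ioo fun x hx => ?_
  congr 1
  rw [mul_right_comm, ← Real.rpow_add (by linarith [hx.2]), mul_comm]
  congr 2
  ring

/-- The factor y^{1-s} is at least 1 on Ω, and the other one integrates to 1/s. This crude bound on
the denominator of γ_φ suffices. -/
theorem one_div_le_integral_weight {s : ℝ} (hs : 1 < s) (hs₂ : s < 2) :
    1 / s ≤ ∫ y in Ω, y ^ (1 - s) * (1 - y) ^ (s - 1) := by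
  have hi1 : IntegrableOn (fun y : ℝ => y ^ (1 - s)) Ω := by
    have := intervalIntegral.intervalIntegrable_rpow' (a := 0) (b := 1)
      (show -1 < 1 - s by linarith)
    rwa [intervalIntegrable_iff_integrableOn_Ioo_of_le zero_le_one] at this
  have hm : Measurable fun y : ℝ => (1 - y) ^ (s - 1) := by fun_prop
  have hle1 : ∀ y ∈ Ω, (1 - y) ^ (s - 1) ≤ 1 := fun y hy =>
    Real.rpow_le_one (by linarith [hy.2]) (by linarith [hy.1]) (by linarith)
  have hnn : ∀ y ∈ Ω, 0 ≤ (1 - y) ^ (s - 1) := fun y hy =>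
    Real.rpow_nonneg (by linarith [hy.2]) _
  have hi2 : IntegrableOn (fun y : ℝ => y ^ (1 - s) * (1 - y) ^ (s - 1)) Ω := by
    refine hi1.mono' ((measurable_id.pow_const _).mul hm).aestronglyMeasurable ?_
    filter_upwards [ae_restrict_mem measurableSet_Ioo] with y hy
    have hy0 : 0 ≤ y ^ (1 - s) := Real.rpow_nonneg hy.1.le _
    rw [Real.norm_of_nonneg (mul_nonneg hy0 (hnn y hy))]
    exact mul_le_of_le_one_right hy0 (hle1 y hy)
  have hi3 : IntegrableOn (fun y : ℝ => (1 - y) ^ (s - 1)) Ω :=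
    (continuous_one_sub_rpow (by linarith)).integrableOn_Icc.mono_set Set.Ioo_subset_Icc_self
  have e : ∫ y in Ω, (1 - y) ^ (s - 1) = 1 / s := by
    have h := lintegral_Ω_one_sub_rpow (c := s - 1) (by linarith)
    rw [sub_add_cancel, ← ofReal_integral_eq_lintegral_ofReal hi3 (by
      filter_upwards [ae_restrict_mem measurableSet_Ioo] with y hy using hnn y hy)] at h
    rw [ENNReal.ofReal_eq_ofReal_iff (setIntegral_nonneg measurableSet_Ioo hnn)
      (by positivity)] at h
    exact h
  rw [← e]
  refine setIntegral_mono_on hi3 hi2 measurableSet_Ioo fun y hy => ?_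
  exact le_mul_of_one_le_left (hnn y hy)
    (Real.one_le_rpow_of_pos_of_le_one_of_nonpos hy.1 hy.2.le (by linarith))

/-- The map from trial to test functions. -/
def testMap (s : ℝ) : Kind → (ℝ → ℝ) → ℝ → ℝ
  | Kind.riemannLiouville, φ => φ
  | Kind.caputo, φ => caputoTest s φ

theorem testSpace_eq (s : ℝ) (κ : Kind) (X : Set (ℝ → ℝ)) :
    testSpace s κ X = testMap s κ '' X := by
  cases κ
  · ext φ
    simp [testSpace, testMap]
  · rfl

theorem continuous_testMap {s : ℝ} (hs : 1 < s) (κ : Kind) {φ : ℝ → ℝ} (hφ : Continuous φ) :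
    Continuous (testMap s κ φ) := by
  cases κ
  · exact hφ
  · exact continuous_caputoTest hs hφ

theorem testMap_congr {s : ℝ} (κ : Kind) {φ ψ : ℝ → ℝ} (h : φ =ᵐ[volume.restrict Ω] ψ) :
    testMap s κ φ =ᵐ[volume.restrict Ω] testMap s κ ψ := by
  cases κ
  · exact h
  · exact caputoTest_congr h

theorem testMap_smul (s : ℝ) (κ : Kind) (c : ℝ) (φ : ℝ → ℝ) :
    testMap s κ (c • φ) = c • testMap s κ φ := by
  cases κ
  · rfl
  · ext x
    simp only [testMap, caputoTest, Pi.smul_apply, smul_eq_mul]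
    have : ∫ y in Ω, y ^ (1 - s) * (c * φ y) = c * ∫ y in Ω, y ^ (1 - s) * φ y := by
      rw [← integral_const_mul]
      refine integral_congr_ae (Filter.Eventually.of_forall fun y => ?_)
      ring
    rw [this]
    ring

theorem integrableOn_rpow_mul {s : ℝ} (hs₂ : s < 2) {f : ℝ → ℝ} (hf : Continuous f) :
    IntegrableOn (fun y : ℝ => y ^ (1 - s) * f y) Ω := by
  have hi1 : IntegrableOn (fun y : ℝ => y ^ (1 - s)) Ω := by
    have := intervalIntegral.intervalIntegrable_rpow' (a := 0) (b := 1)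
      (show -1 < 1 - s by linarith)
    rwa [intervalIntegrable_iff_integrableOn_Ioo_of_le zero_le_one] at this
  obtain ⟨C, hC⟩ := (isCompact_Icc (a := (0 : ℝ)) (b := 1)).exists_bound_of_continuousOn
    hf.continuousOn
  have := hi1.bdd_mul (f := f) (c := C) hf.aestronglyMeasurable (by
    filter_upwards [ae_restrict_mem measurableSet_Ioo] with y hy
    exact hC y (Set.Ioo_subset_Icc_self hy))
  refine this.congr (Filter.Eventually.of_forall fun y => ?_)
  exact mul_comm _ _

theorem testMap_sub {s : ℝ} (hs₂ : s < 2) (κ : Kind) {f g : ℝ → ℝ} (hf : Continuous f)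
    (hg : Continuous g) (x : ℝ) :
    testMap s κ (fun x => f x - g x) x = testMap s κ f x - testMap s κ g x := by
  cases κ
  · rfl
  · simp only [testMap, caputoTest, mul_sub]
    rw [integral_sub (integrableOn_rpow_mul hs₂ hf) (integrableOn_rpow_mul hs₂ hg)]
    ring

theorem formA_testMap {s : ℝ} (hs : 1 < s) (hs₂ : s < 2) (κ : Kind) {f g u φ : ℝ → ℝ}
    (hf : IsEnergyFun (s / 2) f) (hg : IsEnergyFun (s / 2) g) (hfu : f =ᵐ[volume.restrict Ω] u)
    (hgφ : g =ᵐ[volume.restrict Ω] φ) : formA s u (testMap s κ φ) = formA s f g := by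
  cases κ
  · exact formA_congr (by linarith) hs₂ hf hg hfu hgφ
  · exact formA_caputoTest hs hs₂ hf hg hfu hgφ

/-- Cauchy-Schwarz in the plane; it merges the L² part and the semi-norm part without losing a
factor. -/
theorem sqrt_mul_add_sqrt_mul_le {a b c d : ℝ} (ha : 0 ≤ a) (hb : 0 ≤ b) (hc : 0 ≤ c)
    (hd : 0 ≤ d) : √a * √c + √b * √d ≤ √(a + b) * √(c + d) := by
  rw [← Real.sqrt_mul (add_nonneg ha hb) (c + d)]
  refine Real.le_sqrt_of_sq_le ?_
  have h1 := Real.sq_sqrt ha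
  have h2 := Real.sq_sqrt hb
  have h3 := Real.sq_sqrt hc
  have h4 := Real.sq_sqrt hd
  have e : (√a * √c + √b * √d) ^ 2 = a * c + b * d + 2 * (√a * √d) * (√b * √c) := by
    calc _ = √a ^ 2 * √c ^ 2 + √b ^ 2 * √d ^ 2 + 2 * (√a * √d) * (√b * √c) := by ring
      _ = _ := by rw [h1, h2, h3, h4]
  have e2 : (√a * √d) ^ 2 = a * d := by rw [mul_pow, h1, h4]
  have e3 : (√b * √c) ^ 2 = b * c := by rw [mul_pow, h2, h3]
  rw [e]
  nlinarith [sq_nonneg (√a * √d - √b * √c)]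

/-- The map from trial to test functions is a contraction in the relevant sense. -/
theorem integral_abs_mul_testMap_le {s : ℝ} (hs : 1 < s) (hs₂ : s < 2) (κ : Kind) {e w : ℝ → ℝ}
    (he : IsEnergyFun (s / 2) e) (hw : IsEnergyFun (s / 2) w) :
    ∫ x in Ω, |e x| * |testMap s κ w x| ≤ energyNorm s e * energyNorm s w := by
  have hL2 : ∀ {f : ℝ → ℝ}, IsEnergyFun (s / 2) f → ∫⁻ x in Ω, ENNReal.ofReal (f x ^ 2) ≤
      ENNReal.ofReal (∫⁻ x, ‖f x‖ₑ ^ 2).toReal := by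
    intro f hf
    have hfin := hf.energySq_lt_top
    rw [energySq, ENNReal.add_lt_top] at hfin
    rw [ENNReal.ofReal_toReal hfin.1.ne]
    simp only [enorm_sq_eq_ofReal]
    exact setLIntegral_le_lintegral _ _
  have hR1 := (integral_abs_mul_le_sqrt he.continuous.aestronglyMeasurable
    hw.continuous.aestronglyMeasurable (hL2 he) (hL2 hw)).2
  set a := (∫⁻ x, ‖e x‖ₑ ^ 2).toReal with ha
  set c := (∫⁻ x, ‖w x‖ₑ ^ 2).toReal with hc
  set b := (slobodeckijSq Set.univ (s / 2) e).toReal with hb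
  set d := (slobodeckijSq Set.univ (s / 2) w).toReal with hd
  have ha0 : 0 ≤ a := ENNReal.toReal_nonneg
  have hb0 : 0 ≤ b := ENNReal.toReal_nonneg
  have hc0 : 0 ≤ c := ENNReal.toReal_nonneg
  have hd0 : 0 ≤ d := ENNReal.toReal_nonneg
  have hcs := sqrt_mul_add_sqrt_mul_le ha0 hb0 hc0 hd0
  have hgoal : energyNorm s e * energyNorm s w = √(a + b) * √(c + d) := by
    rw [energyNorm, energyNorm, he.energySq_toReal, hw.energySq_toReal]
  rw [hgoal]
  cases κ
  · simp only [testMap, ← abs_mul]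
    refine hR1.trans (le_trans ?_ hcs)
    have : 0 ≤ √b * √d := by positivity
    linarith
  · have hR2 := hw.integral_rpow_mul_le hs hs₂
    have hR3 := he.integral_mul_one_sub_rpow_le hs
    have hD := one_div_le_integral_weight hs hs₂
    set D := ∫ y in Ω, y ^ (1 - s) * (1 - y) ^ (s - 1) with hDdef
    have hs0 : 0 < s := by linarith
    have hD0 : 0 < D := lt_of_lt_of_le (by positivity) hD
    set J := ∫ x in Ω, x ^ (1 - s) * w x with hJ
    set k := J / D with hk
    have hkle : |k| ≤ s * (√(s / 2 * d) * √(1 / (3 - s))) := by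
      rw [hk, abs_div, abs_of_pos hD0, div_le_iff₀ hD0]
      refine hR2.trans ?_
      have h1 : 1 ≤ s * D := by
        rw [div_le_iff₀ hs0] at hD
        linarith
      have h2 : 0 ≤ √(s / 2 * d) * √(1 / (3 - s)) := by positivity
      nlinarith
    have hIeq : ∀ f : ℝ → ℝ, Continuous f → IntegrableOn f Ω := fun f hf =>
      hf.integrableOn_Icc.mono_set Set.Ioo_subset_Icc_self
    have hce := he.continuous
    have hcw := hw.continuous
    have hcr := continuous_one_sub_rpow (c := s - 1) (by linarith)
    have hbound : ∫ x in Ω, |e x| * |testMap s Kind.caputo w x| ≤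
        ∫ x in Ω, (|e x * w x| + |k| * |e x * (1 - x) ^ (s - 1)|) := by
      refine integral_mono (hIeq _ ?_) (hIeq _ ?_) fun x => ?_
      · exact hce.abs.mul (continuous_testMap hs _ hcw).abs
      · exact (hce.mul hcw).abs.add ((hce.mul hcr).abs.const_mul _)
      · simp only [testMap, caputoTest]
        rw [← abs_mul, ← abs_mul]
        have : e x * (w x - J / D * (1 - x) ^ (s - 1)) =
            e x * w x - k * (e x * (1 - x) ^ (s - 1)) := by
          rw [hk]
          ring
        rw [this]
        exact abs_sub _ _
    have hsplit : ∫ x in Ω, (|e x * w x| + |k| * |e x * (1 - x) ^ (s - 1)|) =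
        (∫ x in Ω, |e x * w x|) + |k| * ∫ x in Ω, |e x * (1 - x) ^ (s - 1)| := by
      have i1 : IntegrableOn (fun x => |e x * w x|) Ω := hIeq _ (hce.mul hcw).abs
      have i2 : IntegrableOn (fun x => |e x * (1 - x) ^ (s - 1)|) Ω := hIeq _ (hce.mul hcr).abs
      rw [integral_add i1 (i2.const_mul _), integral_const_mul]
    have hkey : |k| * ∫ x in Ω, |e x * (1 - x) ^ (s - 1)| ≤ √b * √d := by
      have hpos : 0 ≤ ∫ x in Ω, |e x * (1 - x) ^ (s - 1)| :=
        integral_nonneg fun x => abs_nonneg _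
      refine (mul_le_mul hkle hR3 hpos (by positivity)).trans ?_
      have e3 : 0 < 3 - s := by linarith
      have e4 : 0 < 3 * s - 1 := by linarith
      rw [Real.sqrt_mul (by positivity), Real.sqrt_mul (by positivity)]
      have hss : √(s / 2) * √(s / 2) = s / 2 := Real.mul_self_sqrt (by positivity)
      -- After squaring this is s⁴ ≤ 4(3-s)(3s-1), true for 1 < s < 2. It says that the constants of
      -- the weighted integrals multiply to at most 1.
      have hq : √(1 / (3 - s)) * √(1 / (3 * s - 1)) ≤ 2 / s ^ 2 := by
        rw [← Real.sqrt_mul (by positivity)]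
        refine Real.sqrt_le_iff.2 ⟨by positivity, ?_⟩
        rw [div_mul_div_comm, div_pow, one_mul, div_le_div_iff₀ (by positivity) (by positivity)]
        nlinarith [mul_pos (sub_pos.2 hs) (sub_pos.2 hs₂), sq_nonneg (s - 1), sq_nonneg (s * s - 4),
          mul_nonneg (mul_pos (sub_pos.2 hs) (sub_pos.2 hs₂)).le (sq_nonneg s)]
      calc s * (√(s / 2) * √d * √(1 / (3 - s))) * (√(s / 2) * √b * √(1 / (3 * s - 1)))
          = s * (√(s / 2) * √(s / 2)) * (√(1 / (3 - s)) * √(1 / (3 * s - 1))) * (√b * √d) := by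
            ring
        _ ≤ s * (s / 2) * (2 / s ^ 2) * (√b * √d) := by
            rw [hss]
            gcongr
        _ = √b * √d := by
            field_simp
    linarith [hbound, hsplit, hkey, hR1, hcs]

/-! ### The nonlinearity -/

theorem IsLocLipschitz.nonneg {g : ℝ → ℝ → ℝ} {M l : ℝ} (hg : IsLocLipschitz g M l)
    (hM : 0 < M) : 0 ≤ l := by
  have : (ae (volume.restrict Ω)).NeBot := by
    rw [ae_neBot]
    intro h
    have := congrArg (fun μ => μ Set.univ) h
    simp at this
  obtain ⟨x, hx⟩ := hg.lip.exists
  have h := hx M 0 (abs_of_pos hM).le (by simpa using hM.le)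
  rw [sub_zero, abs_of_pos hM] at h
  have h2 : 0 ≤ l * M := (abs_nonneg _).trans h
  exact nonneg_of_mul_nonneg_left h2 hM

theorem IsLocLipschitz.ae_abs_le {g : ℝ → ℝ → ℝ} {M l : ℝ} (hg : IsLocLipschitz g M l)
    (hM : 0 < M) : ∀ᵐ x ∂volume.restrict Ω, ∀ t : ℝ, |t| ≤ M → |g x t| ≤ l * M := by
  filter_upwards [hg.lip, hg.zero] with x hx h0 t ht
  have h := hx t 0 ht (by simpa using hM.le)
  rw [h0, sub_zero, sub_zero] at h
  exact h.trans (mul_le_mul_of_nonneg_left ht (hg.nonneg hM))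

/-- The nonlinearity agrees on `[-M,M]` with a jointly measurable function. -/
theorem IsLocLipschitz.exists_measurable {g : ℝ → ℝ → ℝ} {M l : ℝ} (hg : IsLocLipschitz g M l)
    (hM : 0 < M) : ∃ G : ℝ → ℝ → ℝ, Measurable (Function.uncurry G) ∧
      ∀ᵐ x ∂volume.restrict Ω, ∀ t : ℝ, |t| ≤ M → G x t = g x t := by
  -- Clamping makes the function continuous in t on the whole line. Measurable representatives are
  -- chosen at rational t only, so a single null set `E` collects all exceptions.
  set c : ℝ → ℝ := fun t => max (-M) (min M t) with hc
  have hcc : Continuous c := by fun_prop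
  have hcM : ∀ t, |c t| ≤ M := fun t =>
    abs_le.2 ⟨le_max_left _ _, max_le (by linarith) (min_le_left _ _)⟩
  have hcid : ∀ t, |t| ≤ M → c t = t := fun t ht => by
    rw [abs_le] at ht
    simp only [hc]
    rw [min_eq_right ht.2, max_eq_right ht.1]
  set R : ℚ → ℝ → ℝ := fun q => (hg.meas (c q)).mk _ with hR
  have hae : ∀ᵐ x ∂volume.restrict Ω, (∀ q : ℚ, g x (c q) = R q x) ∧
      ∀ t₁ t₂ : ℝ, |t₁| ≤ M → |t₂| ≤ M → |g x t₁ - g x t₂| ≤ l * |t₁ - t₂| := by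
    have h1 : ∀ᵐ x ∂volume.restrict Ω, ∀ q : ℚ, g x (c q) = R q x :=
      ae_all_iff.2 fun q => (hg.meas (c q)).ae_eq_mk
    filter_upwards [h1, hg.lip] with x hx hl using ⟨hx, hl⟩
  obtain ⟨E, hE1, hE2, hE3⟩ := exists_measurable_superset_of_null (ae_iff.1 hae)
  have hgood : ∀ x ∉ E, (∀ q : ℚ, g x (c q) = R q x) ∧
      ∀ t₁ t₂ : ℝ, |t₁| ≤ M → |t₂| ≤ M → |g x t₁ - g x t₂| ≤ l * |t₁ - t₂| := by
    intro x hx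
    by_contra h
    exact hx (hE1 h)
  set H : ℝ → ℝ → ℝ := fun t => Eᶜ.indicator fun x => g x (c t) with hH
  have hcont : ∀ x, Continuous fun t => H t x := by
    intro x
    by_cases hx : x ∈ E
    · have : (fun t => H t x) = fun _ => 0 := by
        ext t
        exact Set.indicator_of_notMem (by simpa using hx) _
      rw [this]
      exact continuous_const
    · have : (fun t => H t x) = fun t => g x (c t) := by
        ext t
        exact Set.indicator_of_mem (show x ∈ Eᶜ from hx) _
      rw [this]
      have hL : LipschitzOnWith (Real.toNNReal l) (g x) (Set.Icc (-M) M) :=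
        LipschitzOnWith.of_dist_le_mul fun t₁ h₁ t₂ h₂ => by
          rw [Real.dist_eq, Real.dist_eq, Real.coe_toNNReal l (hg.nonneg hM)]
          exact (hgood x hx).2 t₁ t₂ (abs_le.2 h₁) (abs_le.2 h₂)
      exact hL.continuousOn.comp_continuous hcc fun t => abs_le.1 (hcM t)
  have hmq : ∀ q : ℚ, Measurable (H q) := by
    intro q
    have : H q = Eᶜ.indicator (R q) := by
      ext x
      by_cases hx : x ∈ Eᶜ
      · rw [hH]
        simp only [Set.indicator_of_mem hx]
        exact (hgood x hx).1 q
      · rw [hH]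
        simp only [Set.indicator_of_notMem hx]
    rw [this]
    exact (hg.meas (c q)).measurable_mk.indicator hE2.compl
  -- Measurability passes from rational to real t by continuity in t; a function that is continuous
  -- in t and measurable in x is jointly measurable.
  have hmt : ∀ t, Measurable (H t) := by
    intro t
    obtain ⟨q, -, -, hq⟩ := Real.exists_seq_rat_strictMono_tendsto t
    refine measurable_of_tendsto_metrizable (f := fun n => H (q n)) (fun n => hmq (q n)) ?_
    rw [tendsto_pi_nhds]
    intro x
    exact ((hcont x).tendsto t).comp hq
  refine ⟨fun x t => H t x,
    (measurable_uncurry_of_continuous_of_measurable hcont hmt).comp measurable_swap, ?_⟩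
  have hE4 : ∀ᵐ x ∂volume.restrict Ω, x ∉ E := measure_eq_zero_iff_ae_notMem.1 hE3
  filter_upwards [hE4] with x hx t ht
  simp only [hH]
  rw [Set.indicator_of_mem (show x ∈ Eᶜ from hx), hcid t ht]

theorem IsLocLipschitz.aestronglyMeasurable_comp {g : ℝ → ℝ → ℝ} {M l : ℝ}
    (hg : IsLocLipschitz g M l) (hM : 0 < M) {u : ℝ → ℝ}
    (hu : AEMeasurable u (volume.restrict Ω)) (hb : ∀ᵐ x ∂volume.restrict Ω, |u x| ≤ M) :
    AEStronglyMeasurable (fun x => g x (u x)) (volume.restrict Ω) := by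
  obtain ⟨G, hG, hGg⟩ := hg.exists_measurable hM
  have h1 : AEMeasurable (fun x => Function.uncurry G (x, u x)) (volume.restrict Ω) :=
    hG.comp_aemeasurable (aemeasurable_id.prodMk hu)
  refine h1.aestronglyMeasurable.congr ?_
  filter_upwards [hGg, hb] with x hx hxb
  exact hx _ hxb

theorem IsLocLipschitz.integrableOn_comp_mul {g : ℝ → ℝ → ℝ} {M l : ℝ}
    (hg : IsLocLipschitz g M l) (hM : 0 < M) {u v : ℝ → ℝ}
    (hu : AEMeasurable u (volume.restrict Ω)) (hb : ∀ᵐ x ∂volume.restrict Ω, |u x| ≤ M)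
    (hv : IntegrableOn v Ω) : IntegrableOn (fun x => g x (u x) * v x) Ω := by
  refine Integrable.bdd_mul (f := fun x => g x (u x)) (c := l * M) hv
    (hg.aestronglyMeasurable_comp hM hu hb) ?_
  filter_upwards [hg.ae_abs_le hM, hb] with x hx hxb
  exact hx _ hxb

/-- Shows that functions bounded by M satisfy the integrability condition in `spaceU`. The joint
measurability of the nonlinearity is needed for that of the integral with variable limit |ψ(x)|. -/
theorem IsLocLipschitz.integrableOn_primG {g : ℝ → ℝ → ℝ} {M l : ℝ} (hg : IsLocLipschitz g M l)
    (hM : 0 < M) {ψ : ℝ → ℝ} (hψ : Measurable ψ) (hb : ∀ x ∈ Ω, |ψ x| ≤ M) :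
    IntegrableOn (fun x => primG g x (ψ x)) Ω := by
  obtain ⟨G, hG, hGg⟩ := hg.exists_measurable hM
  set k : ℝ → ℝ → ℝ := fun x τ => (Set.Ioc 0 |ψ x|).indicator (G x) τ with hk
  have hkm : Measurable (Function.uncurry k) := by
    have hset : MeasurableSet {p : ℝ × ℝ | p.2 ∈ Set.Ioc 0 |ψ p.1|} :=
      (measurableSet_lt measurable_const measurable_snd).inter
        (measurableSet_le measurable_snd (hψ.comp measurable_fst).abs)
    exact hG.indicator hset
  have hInt : StronglyMeasurable fun x => ∫ τ, k x τ :=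
    hkm.stronglyMeasurable.integral_prod_right
  have heq : ∀ᵐ x ∂volume.restrict Ω, ∫ τ, k x τ = primG g x (ψ x) := by
    filter_upwards [hGg, ae_restrict_mem measurableSet_Ioo] with x hx hxΩ
    rw [primG, intervalIntegral.integral_of_le (abs_nonneg _), hk]
    simp only
    rw [integral_indicator measurableSet_Ioc]
    refine setIntegral_congr_fun measurableSet_Ioc fun τ hτ => ?_
    refine hx τ ?_
    rw [abs_of_pos hτ.1]
    exact hτ.2.trans (hb x hxΩ)
  refine (integrable_const (l * M * M)).mono' (hInt.aestronglyMeasurable.congr heq) ?_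
  filter_upwards [hg.ae_abs_le hM, ae_restrict_mem measurableSet_Ioo] with x hx hxΩ
  have h1 : ‖∫ τ in (0 : ℝ)..|ψ x|, g x τ‖ ≤ l * M * |(|ψ x|) - 0| := by
    refine intervalIntegral.norm_integral_le_of_norm_le_const fun τ hτ => ?_
    rw [Set.uIoc_of_le (abs_nonneg _)] at hτ
    refine hx τ ?_
    rw [abs_of_pos hτ.1]
    exact hτ.2.trans (hb x hxΩ)
  rw [sub_zero, abs_abs] at h1
  exact h1.trans (mul_le_mul_of_nonneg_left (hb x hxΩ)
    (mul_nonneg (hg.nonneg hM) hM.le))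

/-! ### The weak equation for finite element test functions. -/

theorem feSpace.smul_mem {r N : ℕ} {v : ℝ → ℝ} (hv : v ∈ feSpace r N) (c : ℝ) :
    c • v ∈ feSpace r N := by
  obtain ⟨v1, v2, v3, v4⟩ := hv
  refine ⟨v1.const_smul c, by simp [v2], by simp [v3], fun i hi => ?_⟩
  obtain ⟨p, hp, hpe⟩ := v4 i hi
  refine ⟨Polynomial.C c * p, (Polynomial.natDegree_C_mul_le c p).trans hp, fun x hx => ?_⟩
  rw [Pi.smul_apply, hpe x hx, Polynomial.eval_mul, Polynomial.eval_C, smul_eq_mul]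

theorem indicator_ae_eq_self (v : ℝ → ℝ) : Ω.indicator v =ᵐ[volume.restrict Ω] v :=
  indicator_ae_eq_restrict measurableSet_Ioo

theorem primG_congr_ae {g : ℝ → ℝ → ℝ} {φ ψ : ℝ → ℝ} (h : φ =ᵐ[volume.restrict Ω] ψ) :
    (fun x => primG g x (φ x)) =ᵐ[volume.restrict Ω] fun x => primG g x (ψ x) := by
  filter_upwards [h] with x hx
  rw [hx]

theorem formB_smul (g : ℝ → ℝ → ℝ) (u v : ℝ → ℝ) (c : ℝ) :
    formB g u (c • v) = c * formB g u v := by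
  unfold formB
  rw [← integral_const_mul]
  refine integral_congr_ae (Filter.Eventually.of_forall fun x => ?_)
  simp only [Pi.smul_apply, smul_eq_mul]
  ring

theorem formA_testMap_smul {s : ℝ} (hs : 1 < s) (hs₂ : s < 2) (κ : Kind) {f g u φ : ℝ → ℝ}
    (hf : IsEnergyFun (s / 2) f) (hg : IsEnergyFun (s / 2) g) (hfu : f =ᵐ[volume.restrict Ω] u)
    (hgφ : g =ᵐ[volume.restrict Ω] φ) (c : ℝ) :
    formA s u (testMap s κ (c • φ)) = c * formA s u (testMap s κ φ) := by
  have h1 := hg.linear_comb hg c 0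
  rw [formA_testMap hs hs₂ κ hf hg hfu hgφ, formA_testMap hs hs₂ κ hf h1 hfu,
    formA_linear_comb_right (by linarith) hs₂ hg hg hf, zero_mul, add_zero]
  filter_upwards [hgφ] with x hx
  simp [hx]

/-- A weak solution satisfies the equation also for the test functions of the finite element
method, although these need not belong to the test space of the continuous problem. -/
theorem IsWeakSolution.eq_of_mem_feSpace {κ : Kind} {s : ℝ} (hs : 1 < s) (hs₂ : s < 2)
    {g : ℝ → ℝ → ℝ} {M l : ℝ} (hM : 0 < M) (hg : IsLocLipschitz g M l)
    {F : (ℝ → ℝ) →ₗ[ℝ] ℝ} {u : ℝ → ℝ} (hu : IsWeakSolution κ s g F u) {r N : ℕ} (hN : 0 < N)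
    {φ : ℝ → ℝ} (hφ : φ ∈ feSpace r N) :
    formA s u (testMap s κ φ) + formB g u (testMap s κ φ) = F (testMap s κ φ) := by
  obtain ⟨B, hB⟩ := (isCompact_Icc (a := (0 : ℝ)) (b := 1)).exists_bound_of_continuousOn hφ.1
  have hB0 : 0 ≤ B := (norm_nonneg _).trans (hB 0 (by simp))
  -- The function φ may leave U because G(·,φ) is controlled only for |φ| ≤ M. The multiple εφ
  -- satisfies this bound, and ε cancels since the equation is linear in the test function. The
  -- summand 1 guards against B = 0.
  set ε : ℝ := M / (B + 1) with hε
  have hε0 : 0 < ε := by positivity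
  have hψ := feSpace.smul_mem hφ ε
  have hen := isEnergyFun_of_mem_feSpace hs hs₂ hN hψ
  have hφe := isEnergyFun_of_mem_feSpace hs hs₂ hN hφ
  obtain ⟨f, hf, hfu⟩ := hu.1.1.exists_isEnergyFun hs hs₂
  have hmem : ε • φ ∈ spaceU s g := by
    refine ⟨hen.memTilde (by linarith) hs₂ (indicator_ae_eq_self _), ?_⟩
    refine (hg.integrableOn_primG hM hen.continuous.measurable fun x hx => ?_).congr
      (primG_congr_ae (indicator_ae_eq_self _))
    rw [Set.indicator_of_mem hx, Pi.smul_apply, smul_eq_mul, abs_mul, abs_of_pos hε0, hε,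
      div_mul_eq_mul_div, div_le_iff₀ (by positivity)]
    have := hB x (Set.Ioo_subset_Icc_self hx)
    rw [Real.norm_eq_abs] at this
    exact mul_le_mul_of_nonneg_left (by linarith) hM.le
  have h := hu.2 (testMap s κ (ε • φ)) (by
    rw [testSpace_eq]
    exact Set.mem_image_of_mem _ hmem)
  rw [formA_testMap_smul hs hs₂ κ hf hφe hfu (indicator_ae_eq_self _), testMap_smul, formB_smul,
    map_smul, smul_eq_mul, ← mul_add] at h
  exact mul_left_cancel₀ (ne_of_gt hε0) h

/-! ### The error estimate -/

/-- Quasi-optimality of the finite element solution. -/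
theorem exists_energyNorm_error_le {s : ℝ} (hs : 1 < s) (hs₂ : s < 2) {l : ℝ} (hl : 0 ≤ l)
    (hlc : l < coercivityConst s) (κ : Kind) : ∃ C : ℝ, 0 < C ∧
    ∀ (g : ℝ → ℝ → ℝ) (M : ℝ) (F : (ℝ → ℝ) →ₗ[ℝ] ℝ) (u : ℝ → ℝ) (r N : ℕ) (uh f vh : ℝ → ℝ),
      0 < M → IsLocLipschitz g M l → 0 < N → IsWeakSolution κ s g F u →
      (∀ᵐ x ∂volume.restrict Ω, |u x| ≤ M) → IsFESolution κ s r N g F uh →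
      (∀ x ∈ Ω, |uh x| ≤ M) → IsEnergyFun (s / 2) f → f =ᵐ[volume.restrict Ω] u →
      vh ∈ feSpace r N →
      energyNorm s (fun x => f x - Ω.indicator uh x) ≤
        C * energyNorm s (fun x => f x - Ω.indicator vh x) := by
  have hs0 : 0 < s := by linarith
  obtain ⟨CA, hCA, hA⟩ := exists_abs_formA_le hs0 hs₂
  -- An admissible constant above l is taken, so attainment of the supremum is not needed. The set
  -- is nonempty because the supremum of the empty set is 0, which does not exceed l.
  obtain ⟨c, hcmem, hc⟩ : ∃ c ∈ {c : ℝ | ∀ v : ℝ → ℝ, MemTilde (s / 2) v →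
      c * (tildeNorm (s / 2) v).toReal ^ 2 ≤ formA s v v}, l < c := by
    refine exists_lt_of_lt_csSup ?_ hlc
    rw [Set.nonempty_iff_ne_empty]
    intro he
    rw [coercivityConst, he, Real.sSup_empty] at hlc
    linarith
  have hcl : 0 < c - l := by linarith
  refine ⟨(CA + l) / (c - l), by positivity, ?_⟩
  intro g M F u r N uh f vh hM hg hN hu hub huh huhb hf hfu hvh
  have hfh := isEnergyFun_of_mem_feSpace hs hs₂ hN huh.1
  have hfv := isEnergyFun_of_mem_feSpace hs hs₂ hN hvh
  set fh := Ω.indicator uh with hfhdef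
  set fv := Ω.indicator vh with hfvdef
  have he := hf.sub hfh
  have hw := hf.sub hfv
  have hp := hfv.sub hfh
  -- `e` is the error, `w` the approximation error, and `p` = `e` - `w` is the difference of two
  -- finite element functions, hence admissible for testing.
  set e : ℝ → ℝ := fun x => f x - fh x with hedef
  set w : ℝ → ℝ := fun x => f x - fv x with hwdef
  set p : ℝ → ℝ := fun x => fv x - fh x with hpdef
  have hφ : vh - uh ∈ feSpace r N := feSpace.sub_mem hvh huh.1
  have hpφ : p =ᵐ[volume.restrict Ω] vh - uh := by
    filter_upwards [indicator_ae_eq_self vh, indicator_ae_eq_self uh] with x h1 h2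
    simp only [hpdef, Pi.sub_apply]
    rw [hfvdef, hfhdef, h1, h2]
  have hTp : testMap s κ p =ᵐ[volume.restrict Ω] testMap s κ (vh - uh) := testMap_congr κ hpφ
  have h1 := hu.eq_of_mem_feSpace hs hs₂ hM hg hN hφ
  have h2 := huh.2 (testMap s κ (vh - uh)) (by
    rw [testSpace_eq]
    exact Set.mem_image_of_mem _ hφ)
  rw [formA_testMap hs hs₂ κ hf hp hfu hpφ] at h1
  rw [formA_testMap hs hs₂ κ hfh hp (indicator_ae_eq_self uh) hpφ] at h2
  have hIeq : ∀ f : ℝ → ℝ, Continuous f → IntegrableOn f Ω := fun f hf =>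
    hf.integrableOn_Icc.mono_set Set.Ioo_subset_Icc_self
  have hTpc := continuous_testMap hs κ hp.continuous
  have hTφi : IntegrableOn (testMap s κ (vh - uh)) Ω := (hIeq _ hTpc).congr hTp
  have hum : AEMeasurable u (volume.restrict Ω) :=
    hf.continuous.aemeasurable.congr hfu
  have huhm : AEMeasurable uh (volume.restrict Ω) :=
    hfh.continuous.aemeasurable.congr (indicator_ae_eq_self uh)
  have huhb' : ∀ᵐ x ∂volume.restrict Ω, |uh x| ≤ M :=
    (ae_restrict_iff' measurableSet_Ioo).2 (Filter.Eventually.of_forall huhb)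
  have i1 := hg.integrableOn_comp_mul hM hum hub hTφi
  have i2 := hg.integrableOn_comp_mul hM huhm huhb' hTφi
  have hTe := continuous_testMap hs κ he.continuous
  have hTw := continuous_testMap hs κ hw.continuous
  -- The test function of `p` is that of `e` minus that of `w`, and the estimate with constant 1
  -- applies to each.
  have hB : |formB g u (testMap s κ (vh - uh)) - formB g uh (testMap s κ (vh - uh))| ≤
      l * (energyNorm s e * energyNorm s e + energyNorm s e * energyNorm s w) := by
    unfold formB
    rw [← integral_sub i1 i2]
    have hle : ∀ᵐ x ∂volume.restrict Ω, |g x (u x) * testMap s κ (vh - uh) x -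
        g x (uh x) * testMap s κ (vh - uh) x| ≤
        l * (|e x| * |testMap s κ e x| + |e x| * |testMap s κ w x|) := by
      filter_upwards [hg.lip, hub, huhb', hfu, indicator_ae_eq_self uh, hTp]
        with x hx hx1 hx2 hx3 hx4 hx5
      rw [← sub_mul, abs_mul, ← hx5]
      have e1 : e x = u x - uh x := by
        simp only [hedef]
        rw [hx3, hfhdef, hx4]
      have e2 : testMap s κ p x = testMap s κ w x * (-1) + testMap s κ e x := by
        have := testMap_sub hs₂ κ he.continuous hw.continuous x
        have hpe : (fun x => e x - w x) = p := by
          ext y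
          simp only [hedef, hwdef, hpdef]
          ring
        rw [hpe] at this
        rw [this]
        ring
      have e3 : |testMap s κ p x| ≤ |testMap s κ e x| + |testMap s κ w x| := by
        rw [e2]
        refine (abs_add_le _ _).trans ?_
        rw [abs_mul, abs_neg, abs_one, mul_one, add_comm]
      have e4 := hx (u x) (uh x) hx1 hx2
      rw [← e1] at e4
      calc _ ≤ l * |e x| * (|testMap s κ e x| + |testMap s κ w x|) :=
            mul_le_mul e4 e3 (abs_nonneg _) (mul_nonneg hl (abs_nonneg _))
        _ = _ := by ring
    have j1 : IntegrableOn (fun x => |e x| * |testMap s κ e x|) Ω :=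
      hIeq _ (he.continuous.abs.mul hTe.abs)
    have j2 : IntegrableOn (fun x => |e x| * |testMap s κ w x|) Ω :=
      hIeq _ (he.continuous.abs.mul hTw.abs)
    calc _ ≤ ∫ x in Ω, |g x (u x) * testMap s κ (vh - uh) x -
            g x (uh x) * testMap s κ (vh - uh) x| := abs_integral_le_integral_abs
      _ ≤ ∫ x in Ω, l * (|e x| * |testMap s κ e x| + |e x| * |testMap s κ w x|) :=
          integral_mono_ae (i1.sub i2).abs ((j1.add j2).const_mul l) hle
      _ = l * ((∫ x in Ω, |e x| * |testMap s κ e x|) + ∫ x in Ω, |e x| * |testMap s κ w x|) := by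
          rw [integral_const_mul, integral_add j1 j2]
      _ ≤ _ := mul_le_mul_of_nonneg_left (add_le_add
          (integral_abs_mul_testMap_le hs hs₂ κ he he)
          (integral_abs_mul_testMap_le hs hs₂ κ he hw)) hl
  have hAp : formA s e p = formA s f p - formA s fh p := by
    have := formA_linear_comb_left hs0 hs₂ hf hfh hp 1 (-1)
    have hee : (fun x => 1 * f x + -1 * fh x) = e := by
      ext x
      simp only [hedef]
      ring
    rw [hee] at this
    linarith
  have hAe : formA s e e = formA s e w + formA s e p := by
    have := formA_linear_comb_right hs0 hs₂ hw hp he 1 1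
    have hee : (fun x => 1 * w x + 1 * p x) = e := by
      ext x
      simp only [hedef, hwdef, hpdef]
      ring
    rw [hee] at this
    linarith
  have hco := hcmem e (he.memTilde hs0 hs₂ Filter.EventuallyEq.rfl)
  rw [toReal_tildeNorm hs0 hs₂ he.continuous he.eq_zero Filter.EventuallyEq.rfl] at hco
  have hAw := (abs_le.1 (hA e w he hw)).2
  have hBl := (abs_le.1 hB).1
  have hne := energyNorm_nonneg s e
  have hnw := energyNorm_nonneg s w
  -- The collected bounds give (c - l)‖e‖² ≤ (C_A + l)‖e‖‖w‖; one factor ‖e‖ is cancelled when it is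
  -- positive.
  rcases hne.eq_or_lt with h0 | hpos
  · rw [← h0]
    positivity
  · rw [div_mul_eq_mul_div, le_div_iff₀ hcl]
    refine le_of_mul_le_mul_left ?_ hpos
    nlinarith

end FracBVP

end

theorem theorem4p3 (s : ℝ) (hs₁ : 1 < s) (hs₂ : s < 2) (r : ℕ) (hr : 1 ≤ r)
    (l : ℝ) (hl : l < FracBVP.coercivityConst s)
    (κ : FracBVP.Kind) (γ : ℝ)
    (hγ : (κ = FracBVP.Kind.riemannLiouville ∧ s / 2 ≤ γ ∧ γ ≤ s - 1 / 2) ∨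
      (κ = FracBVP.Kind.caputo ∧ γ = s)) :
    ∃ C : ℝ, 0 < C ∧
      ∀ (g : ℝ → ℝ → ℝ) (M : ℝ) (F : (ℝ → ℝ) →ₗ[ℝ] ℝ) (u : ℝ → ℝ) (N : ℕ) (uh : ℝ → ℝ),
        0 < M → FracBVP.IsLocLipschitz g M l → 0 < N →
        FracBVP.IsWeakSolution κ s g F u →
        (∀ᵐ x ∂MeasureTheory.volume.restrict FracBVP.Ω, |u x| ≤ M) →
        FracBVP.IsFESolution κ s r N g F uh →
        (∀ x ∈ FracBVP.Ω, |uh x| ≤ M) →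
        FracBVP.sobolevNorm FracBVP.Ω (s / 2) (u - uh) ≤
          ENNReal.ofReal (C * (1 / (N : ℝ)) ^ (γ - s / 2)) * FracBVP.sobolevNorm FracBVP.Ω γ u := by
  have hγ₁ : s / 2 ≤ γ := by rcases hγ with ⟨-, h, -⟩ | ⟨-, h⟩ <;> linarith
  have hγ₂ : γ < 2 := by rcases hγ with ⟨-, -, h⟩ | ⟨-, h⟩ <;> linarith
  have hs0 : 0 < s := by linarith
  -- A negative Lipschitz constant is impossible for M > 0, so any C serves.
  rcases lt_or_ge l 0 with hneg | hl0
  · exact ⟨1, one_pos, fun g M F u N uh hM hg => absurd (hg.nonneg hM) (not_le.2 hneg)⟩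
  obtain ⟨C₁, hC₁, H₁⟩ := FracBVP.exists_energyNorm_error_le hs₁ hs₂ hl0 hl κ
  obtain ⟨C₂, hC₂, H₂⟩ := FracBVP.exists_nodalInterp_error_le hs₁ hs₂ hγ₁ hγ₂
  refine ⟨C₁ * √C₂, by positivity, ?_⟩
  intro g M F u N uh hM hg hN hu hub huh huhb
  obtain ⟨f, hf, hfu⟩ := hu.1.1.exists_isEnergyFun hs₁ hs₂
  -- Piecewise linear functions already attain the rate because γ < 2; a larger r only enlarges the
  -- space of competitors.
  have hvh := FracBVP.nodalInterp_mem_feSpace hr hN hf.eq_zero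
  have hvi : FracBVP.Ω.indicator (FracBVP.nodalInterp N f) = FracBVP.nodalInterp N f := by
    ext x
    by_cases hx : x ∈ FracBVP.Ω
    · rw [Set.indicator_of_mem hx]
    · rw [Set.indicator_of_notMem hx, FracBVP.nodalInterp_eq_zero hN hf.eq_zero hx]
  have h1 := H₁ g M F u r N uh f _ hM hg hN hu hub huh huhb hf hfu hvh
  have h2 := H₂ N f u hN hf.continuous hf.eq_zero hfu
  have hfh := FracBVP.isEnergyFun_of_mem_feSpace hs₁ hs₂ hN huh.1
  have hfv := FracBVP.isEnergyFun_of_mem_feSpace hs₁ hs₂ hN hvh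
  have he := hf.sub hfh
  have hw := hf.sub hfv
  have hnorm : ∀ {v : ℝ → ℝ}, FracBVP.IsEnergyFun (s / 2) v →
      FracBVP.energySq s v ^ (1 / 2 : ℝ) = ENNReal.ofReal (FracBVP.energyNorm s v) := by
    intro v hv
    rw [FracBVP.energyNorm, Real.sqrt_eq_rpow, ENNReal.toReal_rpow, ENNReal.ofReal_toReal
      (ENNReal.rpow_lt_top_of_nonneg (by norm_num) hv.energySq_lt_top.ne).ne]
  have hN' : (0 : ℝ) < N := by exact_mod_cast hN
  have hh : (0 : ℝ) < 1 / N := by positivity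
  calc FracBVP.sobolevNorm FracBVP.Ω (s / 2) (u - uh)
      ≤ FracBVP.energySq s (fun x => f x - FracBVP.Ω.indicator uh x) ^ (1 / 2 : ℝ) := by
        refine FracBVP.sobolevNorm_Ω_le hs0 hs₂ he.continuous ?_
        filter_upwards [hfu, FracBVP.indicator_ae_eq_self uh] with x hx1 hx2
        rw [hx1, hx2, Pi.sub_apply]
    _ ≤ ENNReal.ofReal C₁ * FracBVP.energySq s
          (fun x => f x - FracBVP.Ω.indicator (FracBVP.nodalInterp N f) x) ^ (1 / 2 : ℝ) := by
        rw [hnorm he, hnorm hw, ← ENNReal.ofReal_mul hC₁.le]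
        exact ENNReal.ofReal_le_ofReal h1
    _ ≤ ENNReal.ofReal C₁ * (ENNReal.ofReal (C₂ * (1 / (N : ℝ)) ^ (2 * γ - s)) *
          FracBVP.sobolevNorm FracBVP.Ω γ u ^ 2) ^ (1 / 2 : ℝ) := by
        rw [hvi]
        exact mul_le_mul_right (ENNReal.rpow_le_rpow h2 (by norm_num)) _
    _ = _ := by
        rw [ENNReal.mul_rpow_of_nonneg _ _ (by norm_num), ← mul_assoc,
          ENNReal.ofReal_rpow_of_pos (by positivity), ← ENNReal.ofReal_mul hC₁.le,
          Real.mul_rpow hC₂.le (by positivity), ← Real.rpow_mul hh.le, ← Real.sqrt_eq_rpow,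
          ← ENNReal.rpow_natCast, ← ENNReal.rpow_mul]
        have e1 : (2 * γ - s) * (1 / 2) = γ - s / 2 := by ring
        have e2 : ((2 : ℕ) : ℝ) * (1 / 2) = 1 := by norm_num
        rw [e1, e2, ENNReal.rpow_one, mul_assoc C₁]
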